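/- **Setting.** Consider a triangular array indexed by the sample size $n\to\infty$; all objects below may depend on $n$ (the index is suppressed), and "constant" means independent of $n$. Let $\mathcal X=\{1,\dots,r\}^d$, let $\varphi:\mathcal X\to\mathbb R^p$, and let $$p(x\mid\theta)=\frac{e^{\theta^\top\varphi(x)}}{C(\theta)},\qquad C(\theta)=\sum_{x\in\mathcal X}e^{\theta^\top\varphi(x)} .$$ The data $x_1,\dots,x_n$ are i.i.d. from $p(\cdot\mid\theta^*)$, and $Y_1,Y_2,\dots$ is a Markov chain on $\mathcal X$ with transition matrix $P$, initial mass function $q$ and strictly positive stationary mass function $h$. With $m$ draws of the chain put $$\mathcal L(\theta)=-\frac1n\sum_{i=1}^n\theta^\top\varphi(x_i)+\log\Big(\frac1m\sum_{i=1}^m\frac{e^{\theta^\top\varphi(Y_i)}}{h(Y_i)}\Big).$$ Write $\theta=(\alpha,\beta^\top)^\top$ with $\alpha\in\mathbb R$ the first coordinate, $H^*=\operatorname{Cov}_{\theta^*}(\varphi(X))$ with blocks $H^*_{\alpha\alpha},H^*_{\alpha\beta},H^*_{\beta\beta}$, $w^*=(H^*_{\beta\beta})^{-1}H^*_{\alpha\beta}$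 and $H^*_{\alpha|\beta}=H^*_{\alpha\alpha}-w^{*\top}H^*_{\alpha\beta}$. For $\lambda_1,\lambda_2,\lambda'>0$ let $$\widehat\theta=(\widehat\alpha,\widehat\beta^\top)^\top=\arg\min_\theta\ \mathcal L(\theta)+\lambda_1\|\theta\|_1+\lambda_2\|\theta\|_2^2,$$ $$\widehat w\in\arg\min_w\ \tfrac12w^\top\nabla^2_{\beta\beta}\mathcal L(\widehat\theta)w-w^\top\nabla^2_{\alpha\beta}\mathcal L(\widehat\theta)+\lambda'\|w\|_1,$$ where $\widehat\theta$ and $\widehat w$ are functions of the data $(x_1,\dots,x_n,Y_1,\dots,Y_m)$, and put $$\widehat U(\alpha,\beta)=\nabla_\alpha\mathcal L(\alpha,\beta)-\widehat w^\top\nabla_\beta\mathcal L(\alpha,\beta),\qquad \widetilde\alpha=\widehat\alpha-\Big[\tfrac{\partial\widehat U(\alpha,\widehat\beta)}{\partial\alpha}\Big|_{\alpha=\widehat\alpha}\Big]^{-1}\widehat U(\widehat\alpha,\widehat\beta),$$ $$\widehat H_{\alpha|\beta}=\nabla^2_{\alpha\alpha}\mathcal L(\widehat\theta)-\widehat w^\top\nabla^2_{\alpha\beta}\mathcal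 L(\widehat\theta).$$ **Assumptions.** There are constants such that for all $n$: 1. $\|\varphi(x)\|_\infty\le K$ for all $x\in\mathcal X$, $\|\theta^*\|_\infty\le B$, $\|w^*\|_\infty\le D$. 2. (Compatibility) For all $T\subseteq\{1,\dots,p\}$, all $\zeta>1$ and all $\theta\ne0$ with $\|\theta_{T^c}\|_1\le\zeta\|\theta_T\|_1$, one has $|T|\,\theta^\top H^*\theta\ge C_{\min}\|\theta_T\|_1^2$, with $C_{\min}>0$. 3. All eigenvalues of $H^*$ lie in $[\lambda_{\min},\lambda_{\max}]$, with $\lambda_{\min}>0$. 4. (Sparsity) $s=\|\theta^*\|_0=O(1)$ and $s'=\|w^*\|_0=O(1)$. 5. (Chain) Let $\kappa$ be the norm of the operator $f\mapsto Pf$ on $\{f\in L^2(h):\sum_yh(y)f(y)=0\}$ (for a reversible chain, the largest absolute value of its spectrum on this space). Then $\kappa\le\kappa_0<1$, $\max_y p(y\mid\theta^*)/h(y)\le M_0$ and $\sum_y q(y)^2/h(y)\le Q_0$ (the last sum equals $1$ when the chain is stationary). 6. (Tuning) $\lambda_1\asymp\sqrt{\tfrac{\log p}{n}}+\sqrt{\tfrac{\log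 p}{m}}+\tfrac{\log p}{m}$ and $\lambda_1\asymp\lambda_2\asymp\lambda'=o(1)$; moreover $\lambda_1\ge A\sqrt{\log p/n}$ for all large $n$, for some constant $A>4\sqrt2\,K$. 7. (Regime) $p\to\infty$, $\ \tfrac{\log p}{\sqrt n}+\tfrac{\log p}{\sqrt m}+\tfrac{\log^{3/2}p}{m}=o(1)$, and $\tfrac mn\gtrsim\log p$. **Theorem.** The decorrelated one-step estimator satisfies $\sqrt n(\widetilde\alpha-\alpha^*)\rightsquigarrow N(0,1/H^*_{\alpha|\beta})$. Since $H^*_{\alpha|\beta}$ may vary with $n$, this means that $\operatorname E f(\sqrt n(\widetilde\alpha-\alpha^*))-\int f\,dN(0,1/H^*_{\alpha|\beta})\to0$ for every bounded continuous $f$, or equivalently $\sqrt{nH^*_{\alpha|\beta}}\,(\widetilde\alpha-\alpha^*)\rightsquigarrow N(0,1)$. Moreover $\widehat H_{\alpha|\beta}-H^*_{\alpha|\beta}\to0$ in probability, $\sqrt{n\widehat H_{\alpha|\beta}}\,(\widetilde\alpha-\alpha^*)\rightsquigarrow N(0,1)$, and for every $\eta\in(0,1)$, with $z=\Phi^{-1}(1-\eta/2)$,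 $$\Pr\Big(\widehat H_{\alpha|\beta}>0\ \text{ and }\ \alpha^*\in\Big[\widetilde\alpha-\frac{z}{\sqrt{n\widehat H_{\alpha|\beta}}},\ \widetilde\alpha+\frac{z}{\sqrt{n\widehat H_{\alpha|\beta}}}\Big]\Big)\longrightarrow1-\eta .$$ -/

import Mathlib

open MeasureTheory ProbabilityTheory Filter Topology Asymptotics
open scoped Matrix

namespace MRF

/-! ### Canonical exponential family on a finite sample space -/

/-- The normalising constant `C(θ) = ∑ₓ exp(θᵀ φ(x))`. -/
noncomputable def partitionFn {S ι : Type*} [Fintype S] [Fintype ι]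
    (φ : S → ι → ℝ) (θ : ι → ℝ) : ℝ :=
  ∑ x, Real.exp (θ ⬝ᵥ φ x)

/-- The probability mass function `p(x ∣ θ) = exp(θᵀ φ(x)) / C(θ)`. -/
noncomputable def pmass {S ι : Type*} [Fintype S] [Fintype ι]
    (φ : S → ι → ℝ) (θ : ι → ℝ) (x : S) : ℝ :=
  Real.exp (θ ⬝ᵥ φ x) / partitionFn φ θ

/-- The mean vector of `φ(X)` when `X ∼ p(· ∣ θ)`. -/
noncomputable def meanStat {S ι : Type*} [Fintype S] [Fintype ι]
    (φ : S → ι → ℝ) (θ : ι → ℝ) (j : ι) : ℝ :=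
  ∑ x, pmass φ θ x * φ x j

/-- The covariance matrix of `φ(X)` when `X ∼ p(· ∣ θ)`. -/
noncomputable def covStat {S ι : Type*} [Fintype S] [Fintype ι]
    (φ : S → ι → ℝ) (θ : ι → ℝ) : Matrix ι ι ℝ :=
  Matrix.of fun i j =>
    ∑ x, pmass φ θ x * ((φ x i - meanStat φ θ i) * (φ x j - meanStat φ θ j))

/-- The MCMC negative log-likelihood
`-(1/n) ∑ᵢ θᵀ φ(xᵢ) + log ((1/m) ∑ᵢ exp(θᵀ φ(yᵢ)) / h(yᵢ))`. -/
noncomputable def mcmcLoss {S ι : Type*} [Fintype ι] {n m : ℕ}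
    (φ : S → ι → ℝ) (h : S → ℝ) (x : Fin n → S) (y : Fin m → S) (θ : ι → ℝ) : ℝ :=
  -((1 / (n : ℝ)) * ∑ i, θ ⬝ᵥ φ (x i))
    + Real.log ((1 / (m : ℝ)) * ∑ i, Real.exp (θ ⬝ᵥ φ (y i)) / h (y i))

/-! ### Derivatives, norms, blocks -/

/-- The partial derivative `∂f/∂θⱼ`. -/
noncomputable def pderiv {ι : Type*} [Fintype ι] [DecidableEq ι]
    (f : (ι → ℝ) → ℝ) (j : ι) (θ : ι → ℝ) : ℝ :=
  fderiv ℝ f θ (Pi.single j 1)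

/-- The Hessian matrix `(∂²f/∂θᵢ∂θⱼ)`. -/
noncomputable def hess {ι : Type*} [Fintype ι] [DecidableEq ι]
    (f : (ι → ℝ) → ℝ) (θ : ι → ℝ) : Matrix ι ι ℝ :=
  Matrix.of fun i j => pderiv (pderiv f j) i θ

/-- The `ℓ₁`-norm. -/
def norm1 {ι : Type*} [Fintype ι] (v : ι → ℝ) : ℝ := ∑ j, |v j|

/-- The number of non-zero entries. -/
noncomputable def norm0 {ι : Type*} (v : ι → ℝ) : ℕ := {j | v j ≠ 0}.ncard

/-- The `αβ`-block (a vector) of a matrix, `α` being the coordinate `0` and `β` the others. -/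
def blockAB {k : ℕ} (A : Matrix (Fin (k + 1)) (Fin (k + 1)) ℝ) : Fin k → ℝ :=
  fun j => A j.succ 0

/-- The `ββ`-block of a matrix. -/
def blockBB {k : ℕ} (A : Matrix (Fin (k + 1)) (Fin (k + 1)) ℝ) : Matrix (Fin k) (Fin k) ℝ :=
  A.submatrix Fin.succ Fin.succ

/-- The decorrelation direction `w* = (H_ββ)⁻¹ H_αβ`. -/
noncomputable def decorrWeight {k : ℕ} (H : Matrix (Fin (k + 1)) (Fin (k + 1)) ℝ) : Fin k → ℝ :=
  (blockBB H)⁻¹ *ᵥ blockAB H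

/-- The partial information `H_{α|β} = H_αα - w*ᵀ H_αβ`. -/
noncomputable def partialInfo {k : ℕ} (H : Matrix (Fin (k + 1)) (Fin (k + 1)) ℝ) : ℝ :=
  H 0 0 - decorrWeight H ⬝ᵥ blockAB H

/-! ### Compatibility factor -/

/-- The cone `𝒞(ζ, T) = {θ : ‖θ_{Tᶜ}‖₁ ≤ ζ ‖θ_T‖₁}`. -/
def cone {ι : Type*} [Fintype ι] [DecidableEq ι] (ζ : ℝ) (T : Finset ι) : Set (ι → ℝ) :=
  {θ | ∑ j ∈ Tᶜ, |θ j| ≤ ζ * ∑ j ∈ T, |θ j|}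

/-- The compatibility factor `inf |T| (θᵀ A θ) / ‖θ_T‖₁²` over non-zero `θ ∈ 𝒞(ζ, T)`; the infimum
is taken in `[-∞, ∞]`, so that it is `+∞` for `T = ∅`, where the cone is `{0}`. -/
noncomputable def compatFactor {ι : Type*} [Fintype ι] [DecidableEq ι]
    (ζ : ℝ) (T : Finset ι) (A : Matrix ι ι ℝ) : EReal :=
  ⨅ θ ∈ {θ : ι → ℝ | θ ≠ 0 ∧ θ ∈ cone ζ T},
    (((T.card : ℝ) * (θ ⬝ᵥ A *ᵥ θ) / (∑ j ∈ T, |θ j|) ^ 2 : ℝ) : EReal)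

/-! ### Samples and Markov chains -/

/-- `X₁, …, Xₙ` are independent and each has the probability mass function `f`. -/
structure IsIIDSample {Ω S : Type*} [MeasurableSpace Ω] [MeasurableSpace S] {n : ℕ}
    (μ : Measure Ω) (X : Fin n → Ω → S) (f : S → ℝ) : Prop where
  measurable : ∀ i, Measurable (X i)
  indep : iIndepFun X μ
  law : ∀ i x, μ.real {ω | X i ω = x} = f x

/-- `Y` is a Markov chain with initial mass function `q` and transition probabilities `P`. -/
structure IsMarkovChain {Ω S : Type*} [MeasurableSpace Ω] [MeasurableSpace S]
    (μ : Measure Ω) (Y : ℕ → Ω → S) (q : S → ℝ) (P : S → S → ℝ) : Prop where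
  measurable : ∀ i, Measurable (Y i)
  law : ∀ (t : ℕ) (y : ℕ → S), μ.real {ω | ∀ i ≤ t, Y i ω = y i}
    = q (y 0) * ∏ i ∈ Finset.range t, P (y i) (y (i + 1))

/-- `P` is a transition matrix with the strictly positive stationary distribution `h`. -/
structure IsStationary {S : Type*} [Fintype S] (h : S → ℝ) (P : S → S → ℝ) : Prop where
  nonneg : ∀ x y, 0 ≤ P x y
  row_sum : ∀ x, ∑ y, P x y = 1
  pos : ∀ x, 0 < h x
  sum_one : ∑ x, h x = 1
  invariant : ∀ y, ∑ x, h x * P x y = h y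

/-- `κ`, the norm of the transition operator `(P f)(x) = ∑ᵧ P(x, y) f(y)` on the orthogonal
complement of the constants in `L²(h)`; `1 - κ` is the absolute spectral gap. For a reversible
chain `κ` is the largest absolute value of a spectral value of `P` on that space. -/
noncomputable def kappa {S : Type*} [Fintype S] (h : S → ℝ) (P : S → S → ℝ) : ℝ :=
  sSup {r | ∃ f : S → ℝ, ∑ x, h x * f x = 0 ∧ ∑ x, h x * f x ^ 2 ≤ 1 ∧
    r = Real.sqrt (∑ x, h x * (∑ y, P x y * f y) ^ 2)}

/-- `M₂ = max_y p(y ∣ θ) / h(y)`. It dominates `M₁ = E_h (p(Y ∣ θ) / h(Y))²`. -/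
noncomputable def maxRatio {S ι : Type*} [Fintype S] [Fintype ι]
    (φ : S → ι → ℝ) (θ : ι → ℝ) (h : S → ℝ) : ℝ :=
  ⨆ y, pmass φ θ y / h y

/-! ### The estimators, as functions of the loss `L` -/

/-- `θ` is an Elastic-net-penalised minimiser of `L`. -/
def IsElasticNet {ι : Type*} [Fintype ι] (L : (ι → ℝ) → ℝ) (lam₁ lam₂ : ℝ) (θ : ι → ℝ) : Prop :=
  IsMinOn (fun η : ι → ℝ => L η + lam₁ * norm1 η + lam₂ * ∑ j, η j ^ 2) Set.univ θ

/-- `w` is a lasso-type estimate of the decorrelation direction, computed from the matrix `A`. -/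
def IsDecorrLasso {k : ℕ} (A : Matrix (Fin (k + 1)) (Fin (k + 1)) ℝ) (lam : ℝ)
    (w : Fin k → ℝ) : Prop :=
  IsMinOn (fun u : Fin k → ℝ =>
    1 / 2 * (u ⬝ᵥ blockBB A *ᵥ u) - u ⬝ᵥ blockAB A + lam * norm1 u) Set.univ w

/-- The decorrelated score `U(a, b) = ∇_α L(a, b) - wᵀ ∇_β L(a, b)`. -/
noncomputable def decorrScore {k : ℕ} (L : (Fin (k + 1) → ℝ) → ℝ) (w : Fin k → ℝ)
    (a : ℝ) (b : Fin k → ℝ) : ℝ :=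
  pderiv L 0 (Matrix.vecCons a b)
    - w ⬝ᵥ fun j : Fin k => pderiv L j.succ (Matrix.vecCons a b)

/-- The decorrelated one-step estimator built from `θ = (θ₀, β)` and `w`. -/
noncomputable def oneStep {k : ℕ} (L : (Fin (k + 1) → ℝ) → ℝ) (θ : Fin (k + 1) → ℝ)
    (w : Fin k → ℝ) : ℝ :=
  θ 0 - (deriv (fun a => decorrScore L w a (Matrix.vecTail θ)) (θ 0))⁻¹
    * decorrScore L w (θ 0) (Matrix.vecTail θ)

/-- The plug-in estimator `∇²_αα L(θ) - wᵀ ∇²_αβ L(θ)` of the partial information. -/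
noncomputable def plugInInfo {k : ℕ} (L : (Fin (k + 1) → ℝ) → ℝ) (θ : Fin (k + 1) → ℝ)
    (w : Fin k → ℝ) : ℝ :=
  hess L θ 0 0 - w ⬝ᵥ blockAB (hess L θ)

end MRF

/-!
The Monte Carlo loss is, up to a constant, a linear function of `θ` plus the logarithm of an
importance sampling average over the chain. Its gradient is therefore the difference of the mean of
`φ` under the normalised importance weights (`chainWeight`) and the sample mean, and its Hessian is
the covariance matrix of `φ` under these weights; moving `θ` tilts the weights exponentially.

Two concentration inequalities control the loss at the true parameter. Hoeffding's inequality bounds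
the sampling error of the data. For the chain, `IsStationary.tilted_step` shows that one step
multiplies `E_h[exp(s f) b²]` by at most `1 + O(s²)` when `f` is centred, because the spectral gap
absorbs the first-order term; iterating along the Feynman-Kac recursion bounds the moment generating
function of an ergodic sum, and Chernoff's bound gives
`IsMarkovChain.measureReal_abs_avg_ge_le`. Since the ratio of the target to the stationary
mass function is bounded, this carries over to the self-normalised averages.
A union bound over the `p + p²` entries is affordable because `m λ² ≳ (log p)²`. So with probability
tending to one the gradient is at most `λ / 2` and the Hessian is within a small multiple of `λ` of
the information matrix `H*`, entry by entry.

On that event the argument is deterministic (`exists_oneStep_expansion`). The smallest eigenvalue of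
`H*` gives curvature on cones around the sparse targets, and the basic inequalities of the Elastic
net and of the lasso give errors of order `λ` in the `ℓ₁`-norm; the Elastic net is localised first,
by convexity along the segment to the minimiser. Expanding the decorrelated score at the estimate,
the linear term in the nuisance direction is at most `‖θ̂ - θ*‖₁ λ'`, by the stationarity condition of
the lasso, and the remaining errors are quadratic as well. Hence `Ĥ (α̃ - α*)` equals minus the score
at the true parameter in the direction `v = (1, -w*)`, up to `O(λ²)`, and `√n λ² → 0`.

That score is the sum of a sampling error and a Monte Carlo error of the scalar statistic `vᵀ φ`, whose
variance under the model is the partial information. The Monte Carlo error is negligible since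
`m / n → ∞`, and the central limit theorem for bounded triangular arrays applies to the sampling
error. `limits_of_expansion` converts this into the limits of the standardised and of the studentised
estimator and into the coverage of the interval.
-/

namespace MRF

/-! ### Weighted means and covariances over a finite index set -/

section Weights

variable {I : Type*} [Fintype I]

/-- A probability vector indexed by the finite type `I`. -/
structure IsWeight (a : I → ℝ) : Prop where
  nonneg : ∀ i, 0 ≤ a i
  sum_one : ∑ i, a i = 1

/-- The mean of `f` under the weights `a`. -/
def wmean (a f : I → ℝ) : ℝ := ∑ i, a i * f i

/-- The covariance of `f` and `g` under the weights `a`. -/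
def wcov (a f g : I → ℝ) : ℝ :=
  wmean a fun i => (f i - wmean a f) * (g i - wmean a g)

/-- The exponential tilt of the weights `a` by the function `g`. -/
noncomputable def reweight (a g : I → ℝ) (i : I) : ℝ :=
  a i * Real.exp (g i) / wmean a fun j => Real.exp (g j)

lemma wmean_add (a f g : I → ℝ) : wmean a (fun i => f i + g i) = wmean a f + wmean a g := by
  simp [wmean, mul_add, Finset.sum_add_distrib]

lemma wmean_sub (a f g : I → ℝ) : wmean a (fun i => f i - g i) = wmean a f - wmean a g := by
  simp [wmean, mul_sub, Finset.sum_sub_distrib]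

lemma wmean_const_mul (a f : I → ℝ) (c : ℝ) : wmean a (fun i => c * f i) = c * wmean a f := by
  simp only [wmean, Finset.mul_sum]
  exact Finset.sum_congr rfl fun i _ => by ring

lemma wmean_mul_const (a f : I → ℝ) (c : ℝ) : wmean a (fun i => f i * c) = wmean a f * c := by
  simp only [wmean, Finset.sum_mul]
  exact Finset.sum_congr rfl fun i _ => by ring

lemma wmean_sum {J : Type*} (t : Finset J) (a : I → ℝ) (f : J → I → ℝ) :
    wmean a (fun i => ∑ j ∈ t, f j i) = ∑ j ∈ t, wmean a (f j) := by
  simp only [wmean, Finset.mul_sum]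
  exact Finset.sum_comm

lemma IsWeight.wmean_const {a : I → ℝ} (ha : IsWeight a) (c : ℝ) : wmean a (fun _ => c) = c := by
  simp [wmean, ← Finset.sum_mul, ha.sum_one]

lemma IsWeight.wmean_mono {a : I → ℝ} (ha : IsWeight a) {f g : I → ℝ} (h : ∀ i, f i ≤ g i) :
    wmean a f ≤ wmean a g :=
  Finset.sum_le_sum fun i _ => mul_le_mul_of_nonneg_left (h i) (ha.nonneg i)

lemma IsWeight.wmean_nonneg {a : I → ℝ} (ha : IsWeight a) {f : I → ℝ} (h : ∀ i, 0 ≤ f i) :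
    0 ≤ wmean a f :=
  Finset.sum_nonneg fun i _ => mul_nonneg (ha.nonneg i) (h i)

lemma IsWeight.wmean_le {a : I → ℝ} (ha : IsWeight a) {f : I → ℝ} {c : ℝ} (h : ∀ i, f i ≤ c) :
    wmean a f ≤ c := (ha.wmean_mono h).trans_eq (ha.wmean_const c)

lemma IsWeight.le_wmean {a : I → ℝ} (ha : IsWeight a) {f : I → ℝ} {c : ℝ} (h : ∀ i, c ≤ f i) :
    c ≤ wmean a f := (ha.wmean_const c).symm.trans_le (ha.wmean_mono h)

lemma IsWeight.abs_wmean_le {a : I → ℝ} (ha : IsWeight a) {f : I → ℝ} {c : ℝ}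
    (h : ∀ i, |f i| ≤ c) : |wmean a f| ≤ c :=
  abs_le.2 ⟨ha.le_wmean fun i => (abs_le.1 (h i)).1, ha.wmean_le fun i => (abs_le.1 (h i)).2⟩

lemma IsWeight.wmean_sub_const {a : I → ℝ} (ha : IsWeight a) (f : I → ℝ) (c : ℝ) :
    wmean a (fun i => f i - c) = wmean a f - c := by
  rw [wmean_sub, ha.wmean_const]

lemma IsWeight.abs_sub_wmean_le {a : I → ℝ} (ha : IsWeight a) {f : I → ℝ} {c : ℝ}
    (h : ∀ i, |f i| ≤ c) (i : I) : |f i - wmean a f| ≤ 2 * c := by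
  have h1 := ha.abs_wmean_le h
  have h2 := h i
  rw [abs_le] at *
  constructor <;> linarith [h1.1, h1.2, h2.1, h2.2]

lemma IsWeight.wcov_eq {a : I → ℝ} (ha : IsWeight a) (f g : I → ℝ) :
    wcov a f g = wmean a (fun i => f i * g i) - wmean a f * wmean a g := by
  have : (fun i => (f i - wmean a f) * (g i - wmean a g)) = fun i =>
      (f i * g i - f i * wmean a g) - (wmean a f * g i - wmean a f * wmean a g) := by
    funext i; ring
  rw [wcov, this, wmean_sub, wmean_sub, wmean_sub, wmean_mul_const, wmean_const_mul,
    ha.wmean_const]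
  ring

lemma wcov_comm (a f g : I → ℝ) : wcov a f g = wcov a g f := by
  simp only [wcov, mul_comm]

lemma IsWeight.wcov_sub_const {a : I → ℝ} (ha : IsWeight a) (f g : I → ℝ) (c c' : ℝ) :
    wcov a (fun i => f i - c) (fun i => g i - c') = wcov a f g := by
  simp only [wcov, ha.wmean_sub_const]
  congr 1; funext i; ring

lemma IsWeight.wcov_self_nonneg {a : I → ℝ} (ha : IsWeight a) (f : I → ℝ) : 0 ≤ wcov a f f :=
  ha.wmean_nonneg fun _ => mul_self_nonneg _

lemma IsWeight.wcov_self_le {a : I → ℝ} (ha : IsWeight a) (f : I → ℝ) (c : ℝ) :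
    wcov a f f ≤ wmean a fun i => (f i - c) ^ 2 := by
  have h1 : (fun i => (f i - c) ^ 2) = fun i => (f i - c) * (f i - c) := by funext i; ring
  rw [← ha.wcov_sub_const f f c c, ha.wcov_eq, h1]
  nlinarith [mul_self_nonneg (wmean a fun i => f i - c)]

lemma IsWeight.abs_wcov_le {a : I → ℝ} (ha : IsWeight a) {f g : I → ℝ} {c c' : ℝ}
    (hf : ∀ i, |f i| ≤ c) (hg : ∀ i, |g i| ≤ c') : |wcov a f g| ≤ 4 * (c * c') := by
  refine ha.abs_wmean_le fun i => ?_
  rw [abs_mul]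
  calc _ ≤ (2 * c) * (2 * c') := mul_le_mul (ha.abs_sub_wmean_le hf i) (ha.abs_sub_wmean_le hg i)
        (abs_nonneg _) ((abs_nonneg _).trans (ha.abs_sub_wmean_le hf i))
    _ = _ := by ring

lemma wmean_dot {J : Type*} [Fintype J] (a : I → ℝ) (Φ : I → J → ℝ) (u : J → ℝ) :
    wmean a (fun i => u ⬝ᵥ Φ i) = u ⬝ᵥ fun j => wmean a fun i => Φ i j := by
  simp only [dotProduct]
  rw [wmean_sum]
  exact Finset.sum_congr rfl fun j _ => wmean_const_mul _ _ _

/-- The covariance of two linear statistics is the bilinear form of the covariance matrix. -/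
lemma wcov_dot {J : Type*} [Fintype J] (a : I → ℝ) (Φ : I → J → ℝ) (u v : J → ℝ) :
    wcov a (fun i => u ⬝ᵥ Φ i) (fun i => v ⬝ᵥ Φ i) =
      u ⬝ᵥ (Matrix.of fun j l => wcov a (fun i => Φ i j) (fun i => Φ i l)) *ᵥ v := by
  have h : ∀ (w : J → ℝ) i, w ⬝ᵥ Φ i - wmean a (fun i => w ⬝ᵥ Φ i) =
      ∑ j, w j * (Φ i j - wmean a fun i => Φ i j) := by
    intro w i
    rw [wmean_dot]
    simp only [dotProduct, mul_sub, Finset.sum_sub_distrib]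
  simp only [wcov, h, Finset.sum_mul_sum]
  rw [wmean_sum]
  simp only [dotProduct, Matrix.mulVec, Matrix.of_apply, Finset.mul_sum]
  refine Finset.sum_congr rfl fun j _ => ?_
  rw [wmean_sum]
  refine Finset.sum_congr rfl fun l _ => ?_
  rw [← wmean_mul_const, ← wmean_const_mul]
  congr 1; funext i; ring

/-! ### Changing the weights -/

lemma IsWeight.wmean_exp_pos {a : I → ℝ} (ha : IsWeight a) (g : I → ℝ) :
    0 < wmean a fun i => Real.exp (g i) := by
  have : ∃ i, 0 < a i := by
    by_contra! h
    have := Finset.sum_nonpos fun i (_ : i ∈ Finset.univ) => h i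
    linarith [ha.sum_one]
  obtain ⟨i, hi⟩ := this
  exact Finset.sum_pos' (fun j _ => mul_nonneg (ha.nonneg j) (Real.exp_pos _).le)
    ⟨i, Finset.mem_univ _, mul_pos hi (Real.exp_pos _)⟩

lemma IsWeight.reweight {a : I → ℝ} (ha : IsWeight a) (g : I → ℝ) : IsWeight (reweight a g) where
  nonneg i := div_nonneg (mul_nonneg (ha.nonneg i) (Real.exp_pos _).le) (ha.wmean_exp_pos g).le
  sum_one := by
    simp only [MRF.reweight, ← Finset.sum_div]
    exact div_self (ha.wmean_exp_pos g).ne'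

lemma IsWeight.wmean_reweight {a : I → ℝ} (g f : I → ℝ) :
    wmean (MRF.reweight a g) f =
      wmean a (fun i => f i * Real.exp (g i)) / wmean a fun i => Real.exp (g i) := by
  conv_lhs => rw [wmean]
  simp only [MRF.reweight]
  conv_rhs => rw [wmean, Finset.sum_div]
  exact Finset.sum_congr rfl fun i _ => by ring

lemma IsWeight.reweight_sub_const {a : I → ℝ} (g : I → ℝ) (c : ℝ) :
    MRF.reweight a (fun i => g i - c) = MRF.reweight a g := by
  have h1 : (wmean a fun i => Real.exp (g i - c)) = (wmean a fun i => Real.exp (g i)) *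
      Real.exp (-c) := by
    rw [← wmean_mul_const]; simp [← Real.exp_add, sub_eq_add_neg]
  funext i
  rw [MRF.reweight, h1, MRF.reweight, sub_eq_add_neg, Real.exp_add, ← mul_assoc,
    mul_div_mul_right _ _ (Real.exp_pos _).ne']

/-- A tilt by a function of size at most `η ≤ 1/4` changes each weight by a relative amount
of at most `4 η`. -/
lemma IsWeight.abs_reweight_sub_le {a : I → ℝ} (ha : IsWeight a) {g : I → ℝ} {η : ℝ}
    (hη : η ≤ 1 / 4) (hg : ∀ i, |g i| ≤ η) (i : I) :
    |MRF.reweight a g i - a i| ≤ 4 * η * a i := by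
  have hη0 : 0 ≤ η := (abs_nonneg _).trans (hg i)
  have hZ := ha.wmean_exp_pos g
  set Z := wmean a fun i => Real.exp (g i) with hZdef
  have h1 : Z ≤ Real.exp η := ha.wmean_le fun i => Real.exp_le_exp.2 (abs_le.1 (hg i)).2
  have h2 : Real.exp (-η) ≤ Z := ha.le_wmean fun i => Real.exp_le_exp.2 (abs_le.1 (hg i)).1
  have h3 : Real.exp (g i) ≤ Real.exp η := Real.exp_le_exp.2 (abs_le.1 (hg i)).2
  have h4 : Real.exp (-η) ≤ Real.exp (g i) := Real.exp_le_exp.2 (abs_le.1 (hg i)).1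
  have e1 : Real.exp η ≤ 1 + η + η ^ 2 := by
    have := (abs_le.1 (Real.abs_exp_sub_one_sub_id_le (x := η) (by rw [abs_of_nonneg hη0]; linarith))).2
    linarith
  have e2 : 1 - η ≤ Real.exp (-η) := by linarith [Real.add_one_le_exp (-η)]
  have hb : |Real.exp (g i) / Z - 1| ≤ 4 * η := by
    rw [div_sub_one hZ.ne', abs_div, abs_of_pos hZ, div_le_iff₀ hZ, abs_le]
    constructor <;> nlinarith
  have : MRF.reweight a g i - a i = (Real.exp (g i) / Z - 1) * a i := by
    rw [MRF.reweight]; ring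
  rw [this, abs_mul, abs_of_nonneg (ha.nonneg i)]
  exact mul_le_mul_of_nonneg_right hb (ha.nonneg i)

variable {a b : I → ℝ} {τ : ℝ}

lemma abs_wmean_sub_wmean_le (hab : ∀ i, |b i - a i| ≤ τ * a i)
    (f : I → ℝ) : |wmean b f - wmean a f| ≤ τ * wmean a fun i => |f i| := by
  have : wmean b f - wmean a f = ∑ i, (b i - a i) * f i := by
    simp [wmean, sub_mul, Finset.sum_sub_distrib]
  rw [this, wmean, Finset.mul_sum]
  refine (Finset.abs_sum_le_sum_abs _ _).trans (Finset.sum_le_sum fun i _ => ?_)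
  rw [abs_mul, ← mul_assoc]
  exact mul_le_mul_of_nonneg_right (hab i) (abs_nonneg _)

lemma IsWeight.abs_wcov_sub_le_mul_wmean_abs (ha : IsWeight a) (hb : IsWeight b) (hτ0 : 0 ≤ τ) (hτ : τ ≤ 1)
    (hab : ∀ i, |b i - a i| ≤ τ * a i) (f g : I → ℝ) {M : ℝ} (hM : 0 ≤ M)
    (hg : ∀ i, |g i - wmean a g| ≤ M) :
    |wcov b f g - wcov a f g| ≤ 2 * τ * M * wmean a fun i => |f i - wmean a f| := by
  set F := fun i => f i - wmean a f with hF
  set G := fun i => g i - wmean a g with hG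
  have hF0 : wmean a F = 0 := by rw [hF, ha.wmean_sub_const, sub_self]
  have hG0 : wmean a G = 0 := by rw [hG, ha.wmean_sub_const, sub_self]
  have hEF : 0 ≤ wmean a fun i => |F i| := ha.wmean_nonneg fun _ => abs_nonneg _
  have e1 : wcov b f g = wmean b (fun i => F i * G i) - wmean b F * wmean b G := by
    rw [← hb.wcov_sub_const f g (wmean a f) (wmean a g), hb.wcov_eq]
  have e2 : wcov a f g = wmean a (fun i => F i * G i) := rfl
  have h1 := abs_wmean_sub_wmean_le hab fun i => F i * G i
  have h2 := abs_wmean_sub_wmean_le hab F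
  have h3 := abs_wmean_sub_wmean_le hab G
  rw [hF0, sub_zero] at h2
  rw [hG0, sub_zero] at h3
  have h4 : (wmean a fun i => |F i * G i|) ≤ M * wmean a fun i => |F i| := by
    rw [← wmean_const_mul]
    refine ha.wmean_mono fun i => ?_
    rw [abs_mul, mul_comm]
    exact mul_le_mul_of_nonneg_right (hg i) (abs_nonneg _)
  have h5 : (wmean a fun i => |G i|) ≤ M := ha.wmean_le hg
  have h6 : |wmean b G| ≤ M := h3.trans (by nlinarith)
  have h7 : |wmean b F * wmean b G| ≤ τ * (wmean a fun i => |F i|) * M := by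
    rw [abs_mul]; exact mul_le_mul h2 h6 (abs_nonneg _) (mul_nonneg hτ0 hEF)
  rw [e1, e2]
  calc |wmean b (fun i => F i * G i) - wmean b F * wmean b G - wmean a (fun i => F i * G i)|
      = |(wmean b (fun i => F i * G i) - wmean a (fun i => F i * G i)) - wmean b F * wmean b G| := by
        congr 1; ring
    _ ≤ _ := abs_sub _ _
    _ ≤ τ * (M * wmean a fun i => |F i|) + τ * (wmean a fun i => |F i|) * M := by
        gcongr; exact h1.trans (by gcongr)
    _ = _ := by ring

lemma IsWeight.abs_wcov_sub_le (ha : IsWeight a) (hb : IsWeight b) (hτ0 : 0 ≤ τ) (hτ : τ ≤ 1)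
    (hab : ∀ i, |b i - a i| ≤ τ * a i) {f g : I → ℝ} {c c' : ℝ}
    (hf : ∀ i, |f i| ≤ c) (hg : ∀ i, |g i| ≤ c') (hc' : 0 ≤ c') :
    |wcov b f g - wcov a f g| ≤ 8 * τ * (c * c') := by
  refine (ha.abs_wcov_sub_le_mul_wmean_abs hb hτ0 hτ hab f g (by positivity)
    (ha.abs_sub_wmean_le hg)).trans ?_
  calc _ ≤ 2 * τ * (2 * c') * (2 * c) := by
        gcongr; exact ha.wmean_le (ha.abs_sub_wmean_le hf)
    _ = _ := by ring

/-- A change of weights perturbs a covariance by at most a fraction of the variance of one of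
the two functions, up to an error of second order in the perturbation. -/
lemma IsWeight.abs_wcov_sub_le_var (ha : IsWeight a) (hb : IsWeight b) (hτ0 : 0 ≤ τ) (hτ : τ ≤ 1)
    (hab : ∀ i, |b i - a i| ≤ τ * a i) (f : I → ℝ) {g : I → ℝ} {c : ℝ} (hc : 0 ≤ c)
    (hg : ∀ i, |g i| ≤ c) :
    |wcov b f g - wcov a f g| ≤ 1 / 8 * wcov a f f + 32 * (τ * c) ^ 2 := by
  refine (ha.abs_wcov_sub_le_mul_wmean_abs hb hτ0 hτ hab f g (by positivity)
    (ha.abs_sub_wmean_le hg)).trans ?_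
  rw [wcov, ← wmean_const_mul, ← wmean_const_mul, ← ha.wmean_const (32 * (τ * c) ^ 2), ← wmean_add]
  refine ha.wmean_mono fun i => ?_
  rw [← abs_mul_abs_self (f i - wmean a f)]
  nlinarith [sq_nonneg (|f i - wmean a f| - 16 * (τ * c))]

lemma IsWeight.le_wcov_self (ha : IsWeight a) (hτ0 : τ ≤ 1)
    (hab : ∀ i, |b i - a i| ≤ τ * a i) (f : I → ℝ) :
    (1 - τ) * wcov a f f ≤ wcov b f f := by
  have h := ha.wcov_self_le f (wmean b f)
  refine (mul_le_mul_of_nonneg_left h (by linarith)).trans ?_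
  rw [wmean, wcov, wmean, Finset.mul_sum]
  refine Finset.sum_le_sum fun i _ => ?_
  have := (abs_le.1 (hab i)).1
  nlinarith [sq_nonneg (f i - wmean b f)]

/-- First-order expansion of a mean under an exponential tilt. -/
lemma IsWeight.abs_wmean_reweight_sub_le {a : I → ℝ} (ha : IsWeight a) {f g : I → ℝ} {c η : ℝ}
    (hη : η ≤ 1 / 4) (hf : ∀ i, |f i| ≤ c) (hg : ∀ i, |g i| ≤ η) (hη0 : 0 ≤ η) (hc : 0 ≤ c) :
    |wmean (MRF.reweight a g) f - wmean a f - wcov a f g| ≤ 64 * c * η ^ 2 := by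
  set F := fun i => f i - wmean a f with hF
  set G := fun i => g i - wmean a g with hG
  have hF0 : wmean a F = 0 := by rw [hF, ha.wmean_sub_const, sub_self]
  have hG0 : wmean a G = 0 := by rw [hG, ha.wmean_sub_const, sub_self]
  have hFc : ∀ i, |F i| ≤ 2 * c := ha.abs_sub_wmean_le hf
  have hGc : ∀ i, |G i| ≤ 2 * η := ha.abs_sub_wmean_le hg
  have hGe : ∀ i, |Real.exp (G i) - 1 - G i| ≤ 4 * η ^ 2 := fun i => by
    refine (Real.abs_exp_sub_one_sub_id_le ((hGc i).trans (by linarith))).trans ?_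
    rw [← sq_abs]; nlinarith [hGc i, abs_nonneg (G i)]
  -- tilting by `g` and by its centred version `G` gives the same weights
  have e1 : wmean (MRF.reweight a g) f - wmean a f =
      wmean a (fun i => F i * Real.exp (G i)) / wmean a fun i => Real.exp (G i) := by
    rw [← IsWeight.wmean_reweight, ← (ha.reweight g).wmean_sub_const, hG,
      IsWeight.reweight_sub_const]
  have hZ := ha.wmean_exp_pos G
  set Z := wmean a fun i => Real.exp (G i)
  have e2 : wmean a (fun i => F i * Real.exp (G i)) =
      wcov a f g + wmean a (fun i => F i * (Real.exp (G i) - 1 - G i)) := by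
    have : (fun i => F i * Real.exp (G i)) = fun i =>
      (F i * G i + F i * (Real.exp (G i) - 1 - G i)) + F i := by funext i; ring
    rw [this, wmean_add, wmean_add, hF0, add_zero]; rfl
  have e3 : |wmean a (fun i => F i * (Real.exp (G i) - 1 - G i))| ≤ 8 * c * η ^ 2 :=
    ha.abs_wmean_le fun i => by
      rw [abs_mul]
      calc _ ≤ (2 * c) * (4 * η ^ 2) := mul_le_mul (hFc i) (hGe i) (abs_nonneg _) (by positivity)
        _ = _ := by ring
  have e4 : Z - 1 = wmean a fun i => Real.exp (G i) - 1 - G i := by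
    rw [wmean_sub, hG0, ha.wmean_sub_const, sub_zero]
  have e5 : |Z - 1| ≤ 4 * η ^ 2 := e4 ▸ ha.abs_wmean_le hGe
  have e6 : |wcov a f g| ≤ 4 * (c * η) := ha.abs_wcov_le hf hg
  have hZ2 : 1 / 2 ≤ Z := by
    have := (abs_le.1 e5).1
    nlinarith
  rw [e1, e2, div_sub' hZ.ne', abs_div, abs_of_pos hZ, div_le_iff₀ hZ]
  calc _ = |wmean a (fun i => F i * (Real.exp (G i) - 1 - G i)) - (Z - 1) * wcov a f g| := by
        congr 1; ring
    _ ≤ _ := abs_sub _ _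
    _ ≤ 8 * c * η ^ 2 + 4 * η ^ 2 * (4 * (c * η)) := by
        rw [abs_mul]; gcongr
    _ ≤ 64 * c * η ^ 2 * (1 / 2) := by
        nlinarith [mul_nonneg hc (sq_nonneg η), mul_nonneg (mul_nonneg hc (sq_nonneg η)) hη0]
    _ ≤ _ := by gcongr

/-- Quadratic lower bound for the cumulant generating function of a small function. -/
lemma IsWeight.le_log_wmean_exp {a : I → ℝ} (ha : IsWeight a) {g : I → ℝ}
    (hg : ∀ i, |g i| ≤ 1 / 2) :
    wmean a g + 1 / 8 * wcov a g g ≤ Real.log (wmean a fun i => Real.exp (g i)) := by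
  set G := fun i => g i - wmean a g with hG
  have hG0 : wmean a G = 0 := by rw [hG, ha.wmean_sub_const, sub_self]
  have hGc : ∀ i, |G i| ≤ 1 := fun i => (ha.abs_sub_wmean_le hg i).trans (by norm_num)
  have hV : wcov a g g = wmean a fun i => G i * G i := rfl
  have hV1 : wcov a g g ≤ 1 := hV ▸ ha.wmean_le fun i => by
    rw [← abs_mul_abs_self]; nlinarith [hGc i, abs_nonneg (G i)]
  have hV0 := ha.wcov_self_nonneg g
  have e1 : (wmean a fun i => Real.exp (g i)) =
      Real.exp (wmean a g) * wmean a fun i => Real.exp (G i) := by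
    rw [← wmean_const_mul]; simp [← Real.exp_add, hG]
  -- the quadratic coefficient `1 / 4 < 1 / 2` absorbs the cubic remainder on `[-1, 1]`
  have hpt : ∀ x : ℝ, |x| ≤ 1 → 1 + x + 1 / 4 * (x * x) ≤ Real.exp x := by
    intro x hx
    have := Real.exp_bound hx (n := 3) (by norm_num)
    norm_num [Finset.sum_range_succ, Nat.factorial] at this
    have h1 := (abs_le.1 this).1
    have h2 : |x| ^ 3 ≤ x ^ 2 := by
      rw [← sq_abs x]; nlinarith [abs_nonneg x, sq_nonneg |x|]
    nlinarith
  have e2 : 1 + 1 / 4 * wcov a g g ≤ wmean a fun i => Real.exp (G i) := by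
    rw [hV, ← wmean_const_mul]
    have := ha.wmean_mono (f := fun i => 1 + G i + 1 / 4 * (G i * G i)) fun i => hpt _ (hGc i)
    rwa [wmean_add, wmean_add, ha.wmean_const, hG0, add_zero] at this
  rw [e1, Real.log_mul (Real.exp_pos _).ne' (ha.wmean_exp_pos G).ne', Real.log_exp]
  have e3 : 1 / 8 * wcov a g g ≤ Real.log (1 + 1 / 4 * wcov a g g) := by
    set y := 1 / 4 * wcov a g g
    have hy : 0 ≤ y := by positivity
    have := Real.one_sub_inv_le_log_of_pos (x := 1 + y) (by linarith)
    refine le_trans ?_ this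
    have h1 : y ≤ 1 := by simp only [y]; linarith
    have h2 : 1 / 8 * wcov a g g = y / 2 := by simp only [y]; ring
    have h3 : 1 - (1 + y)⁻¹ = y / (1 + y) := by field_simp; ring
    rw [h2, h3]
    exact div_le_div_of_nonneg_left hy (by linarith) (by linarith)
  have := Real.log_le_log (by linarith) e2
  linarith

/-- Convexity of the cumulant generating function along a ray. -/
lemma IsWeight.log_wmean_exp_mul_le {a : I → ℝ} (ha : IsWeight a) (g : I → ℝ) {t : ℝ}
    (h0 : 0 ≤ t) (h1 : t ≤ 1) :
    Real.log (wmean a fun i => Real.exp (t * g i)) ≤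
      t * Real.log (wmean a fun i => Real.exp (g i)) := by
  rw [← Real.log_rpow (ha.wmean_exp_pos g)]
  refine Real.log_le_log (ha.wmean_exp_pos fun i => t * g i) ?_
  have := (Real.concaveOn_rpow h0 h1).le_map_sum (t := Finset.univ) (w := a)
    (p := fun i => Real.exp (g i)) (fun i _ => ha.nonneg i) ha.sum_one
    (fun i _ => (Real.exp_pos _).le)
  simp only [smul_eq_mul, ← Real.exp_mul] at this
  simpa only [wmean, mul_comm t] using this

end Weights

/-! ### The derivatives of the Monte Carlo likelihood -/

section Loss

variable {S ι : Type*} [Fintype ι] {n m : ℕ}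

/-- The importance weights of the Monte Carlo draws `y` for the parameter `θ`. -/
noncomputable def chainWeight (φ : S → ι → ℝ) (h : S → ℝ) (y : Fin m → S) (θ : ι → ℝ)
    (i : Fin m) : ℝ :=
  Real.exp (θ ⬝ᵥ φ (y i)) / h (y i) / ∑ l, Real.exp (θ ⬝ᵥ φ (y l)) / h (y l)

variable (φ : S → ι → ℝ) {h : S → ℝ} (x : Fin n → S) (y : Fin m → S)

lemma sum_exp_div_pos (hh : ∀ s, 0 < h s) (hm : 0 < m) (θ : ι → ℝ) :
    0 < ∑ l, Real.exp (θ ⬝ᵥ φ (y l)) / h (y l) := by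
  have : Nonempty (Fin m) := ⟨⟨0, hm⟩⟩
  exact Finset.sum_pos (fun i _ => div_pos (Real.exp_pos _) (hh _)) Finset.univ_nonempty

lemma isWeight_chainWeight (hh : ∀ s, 0 < h s) (hm : 0 < m) (θ : ι → ℝ) :
    IsWeight (chainWeight φ h y θ) where
  nonneg i := div_nonneg (div_pos (Real.exp_pos _) (hh _)).le (sum_exp_div_pos φ y hh hm θ).le
  sum_one := by
    simp only [chainWeight, ← Finset.sum_div _ _ (∑ l, Real.exp (θ ⬝ᵥ φ (y l)) / h (y l))]
    exact div_self (sum_exp_div_pos φ y hh hm θ).ne'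

lemma wmean_chainWeight (θ : ι → ℝ) (f : Fin m → ℝ) :
    wmean (chainWeight φ h y θ) f = (∑ i, Real.exp (θ ⬝ᵥ φ (y i)) / h (y i) * f i) /
      ∑ l, Real.exp (θ ⬝ᵥ φ (y l)) / h (y l) := by
  rw [wmean, Finset.sum_div]
  exact Finset.sum_congr rfl fun i _ => by rw [chainWeight]; ring

lemma wmean_chainWeight_exp (θ δ : ι → ℝ) :
    wmean (chainWeight φ h y θ) (fun i => Real.exp (δ ⬝ᵥ φ (y i))) =
      (∑ l, Real.exp ((θ + δ) ⬝ᵥ φ (y l)) / h (y l)) /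
        ∑ l, Real.exp (θ ⬝ᵥ φ (y l)) / h (y l) := by
  rw [wmean_chainWeight]
  congr 1
  refine Finset.sum_congr rfl fun i _ => ?_
  rw [add_dotProduct, Real.exp_add]; ring

lemma chainWeight_add (hh : ∀ s, 0 < h s) (hm : 0 < m) (θ δ : ι → ℝ) :
    chainWeight φ h y (θ + δ) =
      reweight (chainWeight φ h y θ) fun i => δ ⬝ᵥ φ (y i) := by
  funext i
  have h1 := (sum_exp_div_pos φ y hh hm θ).ne'
  have h2 := (sum_exp_div_pos φ y hh hm (θ + δ)).ne'
  rw [reweight, wmean_chainWeight_exp φ y, chainWeight, chainWeight]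
  have h3 : Real.exp ((θ + δ) ⬝ᵥ φ (y i)) = Real.exp (θ ⬝ᵥ φ (y i)) * Real.exp (δ ⬝ᵥ φ (y i)) := by
    rw [add_dotProduct, Real.exp_add]
  rw [h3]
  field_simp

/-- The mean statistic of the data. -/
noncomputable def sampleMean (j : ι) : ℝ := (1 / (n : ℝ)) * ∑ i, φ (x i) j

lemma dotProduct_sampleMean (u : ι → ℝ) :
    (1 / (n : ℝ)) * ∑ i, u ⬝ᵥ φ (x i) = u ⬝ᵥ sampleMean φ x := by
  simp only [dotProduct, sampleMean, Finset.mul_sum]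
  rw [Finset.sum_comm]
  exact Finset.sum_congr rfl fun j _ => Finset.sum_congr rfl fun i _ => by ring

lemma mcmcLoss_add_sub (hh : ∀ s, 0 < h s) (hm : 0 < m) (θ δ : ι → ℝ) :
    mcmcLoss φ h x y (θ + δ) - mcmcLoss φ h x y θ = - (δ ⬝ᵥ sampleMean φ x) +
      Real.log (wmean (chainWeight φ h y θ) fun i => Real.exp (δ ⬝ᵥ φ (y i))) := by
  have h1 := (sum_exp_div_pos φ y hh hm θ).ne'
  have h2 := (sum_exp_div_pos φ y hh hm (θ + δ)).ne'
  have hm' : (1 / (m : ℝ)) ≠ 0 := by positivity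
  rw [wmean_chainWeight_exp φ y, Real.log_div h2 h1, mcmcLoss, mcmcLoss,
    Real.log_mul hm' h1, Real.log_mul hm' h2, dotProduct_sampleMean, dotProduct_sampleMean,
    add_dotProduct]
  ring

lemma differentiable_dotProduct_left (v : ι → ℝ) :
    Differentiable ℝ fun θ : ι → ℝ => θ ⬝ᵥ v := by
  unfold dotProduct; fun_prop

lemma differentiable_sum_exp (f : Fin m → ℝ) :
    Differentiable ℝ fun θ : ι → ℝ => ∑ i, Real.exp (θ ⬝ᵥ φ (y i)) / h (y i) * f i := by
  have := fun i => differentiable_dotProduct_left (φ (y i))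
  fun_prop

lemma differentiable_mcmcLoss (hh : ∀ s, 0 < h s) (hm : 0 < m) :
    Differentiable ℝ (mcmcLoss φ h x y) := by
  have h1 := fun i => differentiable_dotProduct_left (φ (x i))
  have h2 : Differentiable ℝ fun θ : ι → ℝ => ∑ i, Real.exp (θ ⬝ᵥ φ (y i)) / h (y i) := by
    simpa using differentiable_sum_exp φ y (h := h) fun _ => 1
  refine Differentiable.add (by fun_prop) (Differentiable.log (by fun_prop) fun θ => ?_)
  have := (sum_exp_div_pos φ y hh hm θ).ne'
  positivity

lemma differentiable_wmean_chainWeight (hh : ∀ s, 0 < h s) (hm : 0 < m) (f : Fin m → ℝ) :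
    Differentiable ℝ fun θ => wmean (chainWeight φ h y θ) f := by
  have h2 : Differentiable ℝ fun θ : ι → ℝ => ∑ i, Real.exp (θ ⬝ᵥ φ (y i)) / h (y i) := by
    simpa using differentiable_sum_exp φ y (h := h) fun _ => 1
  simp only [wmean_chainWeight, div_eq_mul_inv (Finset.sum _ _)]
  exact (differentiable_sum_exp φ y f).mul (h2.inv fun θ => (sum_exp_div_pos φ y hh hm θ).ne')

variable [DecidableEq ι]

lemma pderiv_eq_of_hasDerivAt {f : (ι → ℝ) → ℝ} {θ : ι → ℝ} (hf : DifferentiableAt ℝ f θ) {j : ι}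
    {f' : ℝ} (h' : HasDerivAt (fun t : ℝ => f (θ + t • Pi.single j 1)) f' 0) :
    pderiv f j θ = f' := by
  rw [pderiv, ← hf.lineDeriv_eq_fderiv]
  exact h'.deriv

lemma add_smul_single_dotProduct (θ v : ι → ℝ) (j : ι) (t : ℝ) :
    (θ + t • Pi.single j 1) ⬝ᵥ v = θ ⬝ᵥ v + t * v j := by
  rw [add_dotProduct, smul_dotProduct, single_dotProduct, one_mul, smul_eq_mul]

lemma hasDerivAt_exp_dotProduct (θ v : ι → ℝ) (j : ι) (c : ℝ) :
    HasDerivAt (fun t : ℝ => Real.exp ((θ + t • Pi.single j 1) ⬝ᵥ v) / c)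
      (Real.exp (θ ⬝ᵥ v) / c * v j) 0 := by
  simp only [add_smul_single_dotProduct]
  have h1 : HasDerivAt (fun t : ℝ => θ ⬝ᵥ v + t * v j) (v j) 0 := by
    simpa using ((hasDerivAt_id (0 : ℝ)).mul_const (v j)).const_add (θ ⬝ᵥ v)
  have := (h1.exp).div_const c
  simp only [zero_mul, add_zero] at this
  exact this.congr_deriv (by ring)

lemma pderiv_mcmcLoss (hh : ∀ s, 0 < h s) (hm : 0 < m) (θ : ι → ℝ) (j : ι) :
    pderiv (mcmcLoss φ h x y) j θ =
      wmean (chainWeight φ h y θ) (fun i => φ (y i) j) - sampleMean φ x j := by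
  refine pderiv_eq_of_hasDerivAt (differentiable_mcmcLoss φ x y hh hm θ) ?_
  have h0 := (sum_exp_div_pos φ y hh hm θ).ne'
  have hm' : (1 / (m : ℝ)) ≠ 0 := by positivity
  have h1 : HasDerivAt (fun t : ℝ => -((1 / (n : ℝ)) * ∑ i, (θ + t • Pi.single j 1) ⬝ᵥ φ (x i)))
      (- sampleMean φ x j) 0 := by
    refine HasDerivAt.neg (HasDerivAt.const_mul _ (HasDerivAt.fun_sum fun i _ => ?_))
    simp only [add_smul_single_dotProduct]
    simpa using ((hasDerivAt_id (0 : ℝ)).mul_const (φ (x i) j)).const_add (θ ⬝ᵥ φ (x i))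
  have h2 : HasDerivAt (fun t : ℝ => (1 / (m : ℝ)) *
      ∑ i, Real.exp ((θ + t • Pi.single j 1) ⬝ᵥ φ (y i)) / h (y i)) _ 0 :=
    HasDerivAt.const_mul _ (HasDerivAt.fun_sum fun i _ => hasDerivAt_exp_dotProduct θ (φ (y i)) j _)
  have h3 := h1.add (h2.log (by simpa using mul_ne_zero hm' h0))
  refine h3.congr_deriv ?_
  rw [wmean_chainWeight]
  simp only [zero_smul, add_zero]
  rw [mul_div_mul_left _ _ hm']
  ring

lemma hasDerivAt_wmean_chainWeight (hh : ∀ s, 0 < h s) (hm : 0 < m) (θ : ι → ℝ) (j : ι)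
    (f : Fin m → ℝ) :
    HasDerivAt (fun t : ℝ => wmean (chainWeight φ h y (θ + t • Pi.single j 1)) f)
      (wcov (chainWeight φ h y θ) (fun i => φ (y i) j) f) 0 := by
  have h0 := (sum_exp_div_pos φ y hh hm θ).ne'
  simp only [(isWeight_chainWeight φ y hh hm θ).wcov_eq, wmean_chainWeight]
  have h1 : HasDerivAt (fun t : ℝ =>
      ∑ i, Real.exp ((θ + t • Pi.single j 1) ⬝ᵥ φ (y i)) / h (y i) * f i) _ 0 :=
    HasDerivAt.fun_sum fun i _ => (hasDerivAt_exp_dotProduct θ (φ (y i)) j _).mul_const (f i)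
  have h2 : HasDerivAt (fun t : ℝ =>
      ∑ i, Real.exp ((θ + t • Pi.single j 1) ⬝ᵥ φ (y i)) / h (y i)) _ 0 :=
    HasDerivAt.fun_sum fun i _ => hasDerivAt_exp_dotProduct θ (φ (y i)) j _
  have h3 := h1.div h2 (by simpa using h0)
  refine h3.congr_deriv ?_
  simp only [zero_smul, add_zero, mul_assoc]
  field_simp

lemma differentiable_pderiv_mcmcLoss (hh : ∀ s, 0 < h s) (hm : 0 < m) (j : ι) :
    Differentiable ℝ (pderiv (mcmcLoss φ h x y) j) := by
  rw [funext fun θ => pderiv_mcmcLoss φ x y hh hm θ j]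
  exact (differentiable_wmean_chainWeight φ y hh hm _).sub_const _

lemma hess_mcmcLoss (hh : ∀ s, 0 < h s) (hm : 0 < m) (θ : ι → ℝ) :
    hess (mcmcLoss φ h x y) θ = Matrix.of fun i j =>
      wcov (chainWeight φ h y θ) (fun l => φ (y l) i) (fun l => φ (y l) j) := by
  ext i j
  rw [hess, Matrix.of_apply, Matrix.of_apply]
  refine pderiv_eq_of_hasDerivAt (differentiable_pderiv_mcmcLoss φ x y hh hm j θ) ?_
  rw [funext fun θ => pderiv_mcmcLoss φ x y hh hm θ j]
  exact (hasDerivAt_wmean_chainWeight φ y hh hm θ i _).sub_const _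

end Loss

section OneStep

variable {S : Type*} {k n m : ℕ} (φ : S → Fin (k + 1) → ℝ) {h : S → ℝ}
  (x : Fin n → S) (y : Fin m → S)

lemma hasDerivAt_vecCons (b : Fin k → ℝ) (a : ℝ) :
    HasDerivAt (fun a : ℝ => (Matrix.vecCons a b : Fin (k + 1) → ℝ)) (Pi.single 0 1) a := by
  rw [hasDerivAt_pi]
  intro j
  refine Fin.cases ?_ (fun j => ?_) j
  · exact (hasDerivAt_id' a).congr_deriv (by simp)
  · exact (hasDerivAt_const a (b j)).congr_deriv (by simp)

/-- The slope of the decorrelated score in the parameter of interest is the plug-in estimate of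
the partial information. -/
lemma deriv_decorrScore (hh : ∀ s, 0 < h s) (hm : 0 < m) (θ : Fin (k + 1) → ℝ) (w : Fin k → ℝ) :
    deriv (fun a => decorrScore (mcmcLoss φ h x y) w a (Matrix.vecTail θ)) (θ 0) =
      plugInInfo (mcmcLoss φ h x y) θ w := by
  have hθ : (Matrix.vecCons (θ 0) (Matrix.vecTail θ) : Fin (k + 1) → ℝ) = θ :=
    Matrix.cons_head_tail θ
  have key : ∀ j, HasDerivAt (fun a : ℝ => pderiv (mcmcLoss φ h x y) j
      (Matrix.vecCons a (Matrix.vecTail θ))) (hess (mcmcLoss φ h x y) θ 0 j) (θ 0) := by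
    intro j
    have h1 := ((differentiable_pderiv_mcmcLoss φ x y hh hm j)
      (Matrix.vecCons (θ 0) (Matrix.vecTail θ))).hasFDerivAt
    have h2 := h1.comp_hasDerivAt (θ 0) (hasDerivAt_vecCons (Matrix.vecTail θ) (θ 0))
    rw [hθ] at h2
    exact h2
  have hsym : ∀ j : Fin k, hess (mcmcLoss φ h x y) θ 0 j.succ
      = hess (mcmcLoss φ h x y) θ j.succ 0 := by
    intro j
    rw [hess_mcmcLoss φ x y hh hm]
    simp only [Matrix.of_apply]
    exact wcov_comm _ _ _
  have h3 : HasDerivAt (fun a => decorrScore (mcmcLoss φ h x y) w a (Matrix.vecTail θ))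
      (plugInInfo (mcmcLoss φ h x y) θ w) (θ 0) := by
    refine (key 0).sub ?_
    simp only [dotProduct, blockAB, ← hsym]
    exact HasDerivAt.fun_sum fun j _ => (key j.succ).const_mul (w j)
  exact h3.deriv

end OneStep

/-! ### Rates of the two penalised estimators on a good event -/

section Norms

variable {ι : Type*} [Fintype ι]

lemma norm1_nonneg (v : ι → ℝ) : 0 ≤ norm1 v := Finset.sum_nonneg fun _ _ => abs_nonneg _

lemma norm1_eq_add_compl [DecidableEq ι] (v : ι → ℝ) (T : Finset ι) :
    norm1 v = ∑ j ∈ T, |v j| + ∑ j ∈ Tᶜ, |v j| := (Finset.sum_add_sum_compl T _).symm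

lemma norm1_smul (t : ℝ) (v : ι → ℝ) : norm1 (t • v) = |t| * norm1 v := by
  simp [norm1, abs_mul, Finset.mul_sum]

lemma norm1_add_le (u v : ι → ℝ) : norm1 (u + v) ≤ norm1 u + norm1 v := by
  rw [norm1, norm1, norm1, ← Finset.sum_add_distrib]
  exact Finset.sum_le_sum fun j _ => abs_add_le _ _

lemma abs_dotProduct_le (u v : ι → ℝ) {c : ℝ} (h : ∀ j, |v j| ≤ c) : |u ⬝ᵥ v| ≤ norm1 u * c := by
  rw [dotProduct, norm1, Finset.sum_mul]
  refine (Finset.abs_sum_le_sum_abs _ _).trans (Finset.sum_le_sum fun j _ => ?_)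
  rw [abs_mul]
  exact mul_le_mul_of_nonneg_left (h j) (abs_nonneg _)

lemma abs_mulVec_le (M : Matrix ι ι ℝ) (v : ι → ℝ) {c : ℝ} (h : ∀ i j, |M i j| ≤ c) (i : ι) :
    |(M *ᵥ v) i| ≤ norm1 v * c := by
  rw [Matrix.mulVec, dotProduct_comm]
  exact abs_dotProduct_le v _ (h i)

lemma abs_dotProduct_mulVec_le (M : Matrix ι ι ℝ) (u v : ι → ℝ) {c : ℝ} (h : ∀ i j, |M i j| ≤ c) :
    |u ⬝ᵥ M *ᵥ v| ≤ norm1 u * (norm1 v * c) :=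
  abs_dotProduct_le u _ (abs_mulVec_le M v h)

lemma norm1_vecCons {k : ℕ} (a : ℝ) (v : Fin k → ℝ) :
    norm1 (Matrix.vecCons a v) = |a| + norm1 v := by
  simp [norm1, Fin.sum_univ_succ]

/-- Adding a perturbation to a vector supported on `T` lowers its `ℓ₁`-norm by at most the
mass of the perturbation on `T`, less its mass off `T`. -/
lemma le_norm1_add_sub [DecidableEq ι] {v : ι → ℝ} {T : Finset ι} (hv : ∀ j ∉ T, v j = 0)
    (u : ι → ℝ) : ∑ j ∈ Tᶜ, |u j| - ∑ j ∈ T, |u j| ≤ norm1 (v + u) - norm1 v := by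
  rw [norm1_eq_add_compl (v + u) T, norm1_eq_add_compl v T]
  have h1 : ∑ j ∈ Tᶜ, |(v + u) j| = ∑ j ∈ Tᶜ, |u j| :=
    Finset.sum_congr rfl fun j hj => by simp [hv j (Finset.mem_compl.1 hj)]
  have h2 : ∑ j ∈ Tᶜ, |v j| = 0 :=
    Finset.sum_eq_zero fun j hj => by simp [hv j (Finset.mem_compl.1 hj)]
  have h3 : ∑ j ∈ T, |v j| ≤ ∑ j ∈ T, |(v + u) j| + ∑ j ∈ T, |u j| := by
    rw [← Finset.sum_add_distrib]
    refine Finset.sum_le_sum fun j _ => ?_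
    have := abs_sub (v j + u j) (u j)
    simpa using this
  linarith

/-- A vector in a cone whose curvature is bounded below and whose curvature is at most linear in
its mass on the support is short. -/
lemma cone_rate {a b V Q lam ζ q ev ρ s : ℝ} (ha : 0 ≤ a) (hb : 0 ≤ b) (hev : 0 < ev) (hs : 0 < s)
    (hq : 0 ≤ q) (hlam : 0 ≤ lam) (hζ : 0 ≤ ζ) (hρ0 : 0 ≤ ρ)
    (hV : ev * Q - ρ * (a + b) ^ 2 ≤ V) (haQ : a ^ 2 ≤ s * Q)
    (hVle : V / 8 ≤ lam * q * a) (hcone : a + b ≤ ζ * a) (hρ : ρ * ζ ^ 2 * (2 * s) ≤ ev) :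
    a + b ≤ ζ * (16 * s * q / ev) * lam := by
  have h1 : (a + b) ^ 2 ≤ (ζ * a) ^ 2 := by gcongr
  have h2 : ρ * (a + b) ^ 2 ≤ ρ * (ζ * a) ^ 2 := by gcongr
  have h3 : ev * a ^ 2 ≤ s * (V + ρ * (ζ * a) ^ 2) := by
    have : ev * a ^ 2 ≤ ev * (s * Q) := by gcongr
    nlinarith
  have h4 : ρ * ζ ^ 2 * (2 * s) * a ^ 2 ≤ ev * a ^ 2 := by gcongr
  have h5 : ev * a * a ≤ 16 * s * q * lam * a := by nlinarith
  have h6 : a ≤ 16 * s * q / ev * lam := by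
    rcases ha.eq_or_lt with h0 | h0
    · rw [← h0]; positivity
    · have := le_of_mul_le_mul_right h5 h0
      rw [div_mul_eq_mul_div, le_div_iff₀ hev]; linarith
  calc a + b ≤ ζ * a := hcone
    _ ≤ ζ * (16 * s * q / ev * lam) := by gcongr
    _ = _ := by ring

/-- The variant of `cone_rate` in which the basic inequality has an error term `E`: either the error
is dominated by the mass on the support, and the vector lies in a cone, or the error alone bounds
the vector. -/
lemma cone_rate_add_error {p r V Q lam E ev ρ s : ℝ} (hp0 : 0 ≤ p) (hr0 : 0 ≤ r) (hev : 0 < ev)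
    (hs : 0 < s) (hlam : 0 < lam) (hE0 : 0 ≤ E) (hρ0 : 0 ≤ ρ) (hV0 : 0 ≤ V)
    (hV : ev * Q - ρ * (p + r) ^ 2 ≤ V) (hpQ : p ^ 2 ≤ s * Q)
    (hbasic : V / 8 + lam / 2 * r ≤ lam * (3 / 2) * p + E) (hρ : ρ * 6 ^ 2 * (2 * s) ≤ ev) :
    p + r ≤ 6 * (16 * s * (5 / 2) / ev) * lam + 6 * (E / lam) := by
  have hlast1 : 0 ≤ 6 * (16 * s * (5 / 2) / ev) * lam := by positivity
  have hlast2 : 0 ≤ 6 * (E / lam) := by positivity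
  have hr0' : 0 ≤ lam * r := by positivity
  rcases le_or_gt E (lam * p) with hc | hc
  · have hcone : p + r ≤ 6 * p := by
      have : lam * r ≤ lam * (5 * p) := by linarith
      have := le_of_mul_le_mul_left this hlam
      linarith
    have := cone_rate hp0 hr0 hev hs (by norm_num : (0 : ℝ) ≤ 5 / 2) hlam.le
      (by norm_num : (0 : ℝ) ≤ 6) hρ0 hV hpQ (by linarith) hcone hρ
    linarith
  · have h1 : p ≤ E / lam := by rw [le_div_iff₀ hlam]; linarith
    have h2 : r ≤ 5 * (E / lam) := by
      rw [← mul_div_assoc, le_div_iff₀ hlam]; linarith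
    linarith

lemma sq_sum_abs_le (v : ι → ℝ) (T : Finset ι) {s : ℝ} (hs : (T.card : ℝ) ≤ s) :
    (∑ j ∈ T, |v j|) ^ 2 ≤ s * ∑ j, v j ^ 2 := by
  have h1 := sq_sum_le_card_mul_sum_sq (s := T) (f := fun j => |v j|)
  simp only [sq_abs] at h1
  have h2 : ∑ j ∈ T, v j ^ 2 ≤ ∑ j, v j ^ 2 :=
    Finset.sum_le_sum_of_subset_of_nonneg (Finset.subset_univ _) fun _ _ _ => sq_nonneg _
  have h0 : 0 ≤ ∑ j ∈ T, v j ^ 2 := Finset.sum_nonneg fun _ _ => sq_nonneg _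
  calc _ ≤ (T.card : ℝ) * ∑ j ∈ T, v j ^ 2 := h1
    _ ≤ s * ∑ j ∈ T, v j ^ 2 := by gcongr
    _ ≤ _ := mul_le_mul_of_nonneg_left h2 ((Nat.cast_nonneg _).trans hs)

end Norms

section ElasticNet

variable {S ι : Type*} [Fintype ι] {n m : ℕ} {φ : S → ι → ℝ} {h : S → ℝ}
  {x : Fin n → S} {y : Fin m → S}

/-- The Elastic-net criterion along a segment from `θ` to a point at which it is no larger than
at `θ` stays below its value at `θ`. -/
lemma elasticNet_segment (hh : ∀ s, 0 < h s) (hm : 0 < m) {lam₁ lam₂ : ℝ} (h1 : 0 ≤ lam₁)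
    (h2 : 0 ≤ lam₂) (θ δ : ι → ℝ) {t : ℝ} (ht0 : 0 ≤ t) (ht1 : t ≤ 1)
    (hle : mcmcLoss φ h x y (θ + δ) + lam₁ * norm1 (θ + δ) + lam₂ * ∑ j, (θ + δ) j ^ 2 ≤
      mcmcLoss φ h x y θ + lam₁ * norm1 θ + lam₂ * ∑ j, θ j ^ 2) :
    mcmcLoss φ h x y (θ + t • δ) + lam₁ * norm1 (θ + t • δ) + lam₂ * ∑ j, (θ + t • δ) j ^ 2 ≤
      mcmcLoss φ h x y θ + lam₁ * norm1 θ + lam₂ * ∑ j, θ j ^ 2 := by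
  have hw := isWeight_chainWeight φ y hh hm θ
  have e1 := mcmcLoss_add_sub φ x y hh hm θ δ
  have e2 := mcmcLoss_add_sub φ x y hh hm θ (t • δ)
  simp only [smul_dotProduct, smul_eq_mul] at e2
  have e3 := hw.log_wmean_exp_mul_le (fun i => δ ⬝ᵥ φ (y i)) ht0 ht1
  have e4 : norm1 (θ + t • δ) ≤ (1 - t) * norm1 θ + t * norm1 (θ + δ) := by
    have : θ + t • δ = (1 - t) • θ + t • (θ + δ) := by module
    rw [this]
    refine (norm1_add_le _ _).trans_eq ?_
    rw [norm1_smul, norm1_smul, abs_of_nonneg ht0, abs_of_nonneg (by linarith)]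
  have e5 : ∑ j, (θ + t • δ) j ^ 2 ≤ (1 - t) * ∑ j, θ j ^ 2 + t * ∑ j, (θ + δ) j ^ 2 := by
    rw [Finset.mul_sum, Finset.mul_sum, ← Finset.sum_add_distrib]
    refine Finset.sum_le_sum fun j _ => ?_
    simp only [Pi.add_apply, Pi.smul_apply, smul_eq_mul]
    nlinarith [mul_nonneg (mul_nonneg ht0 (sub_nonneg.2 ht1)) (sq_nonneg (δ j))]
  have e6 : mcmcLoss φ h x y (θ + t • δ) - mcmcLoss φ h x y θ ≤
      t * (mcmcLoss φ h x y (θ + δ) - mcmcLoss φ h x y θ) := by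
    rw [e1, e2]; linarith
  have e7 := mul_le_mul_of_nonneg_left e4 h1
  have e8 := mul_le_mul_of_nonneg_left e5 h2
  nlinarith

variable [DecidableEq ι]

/-- A small perturbation that does not increase the Elastic-net criterion is of the order of the
tuning parameter. -/
lemma elasticNet_local (hh : ∀ s, 0 < h s) (hm : 0 < m) {lam₁ lam₂ c B K ev ρ s : ℝ}
    (h1 : 0 < lam₁) (h2 : 0 ≤ lam₂) (h21 : lam₂ ≤ c * lam₁) (hB0 : 0 ≤ B) (hc : 0 ≤ c)
    (hev : 0 < ev) (hs : 0 < s) (hρ0 : 0 ≤ ρ) {T : Finset ι} (hT : (T.card : ℝ) ≤ s)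
    {θ Δ : ι → ℝ} (hsupp : ∀ j ∉ T, θ j = 0) (hB : ∀ j, |θ j| ≤ B)
    (hK : ∀ i j, |φ i j| ≤ K)
    (hgrad : ∀ j, |wmean (chainWeight φ h y θ) (fun i => φ (y i) j) - sampleMean φ x j| ≤ lam₁ / 2)
    (hRE : ∀ u : ι → ℝ, ev * ∑ j, u j ^ 2 - ρ * norm1 u ^ 2 ≤
      wcov (chainWeight φ h y θ) (fun i => u ⬝ᵥ φ (y i)) (fun i => u ⬝ᵥ φ (y i)))
    (hρ : ρ * (4 + 4 * c * B) ^ 2 * (2 * s) ≤ ev)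
    (hΔ : norm1 Δ * K ≤ 1 / 2)
    (hle : mcmcLoss φ h x y (θ + Δ) + lam₁ * norm1 (θ + Δ) + lam₂ * ∑ j, (θ + Δ) j ^ 2 ≤
      mcmcLoss φ h x y θ + lam₁ * norm1 θ + lam₂ * ∑ j, θ j ^ 2) :
    norm1 Δ ≤ (4 + 4 * c * B) * (16 * s * (3 / 2 + 2 * c * B) / ev) * lam₁ := by
  have hw := isWeight_chainWeight φ y hh hm θ
  have hloss := mcmcLoss_add_sub φ x y hh hm θ Δ
  have hlog := hw.le_log_wmean_exp (g := fun i => Δ ⬝ᵥ φ (y i)) fun i =>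
    (abs_dotProduct_le Δ _ (hK (y i))).trans hΔ
  have hV := hRE Δ
  have hV0 := hw.wcov_self_nonneg fun i => Δ ⬝ᵥ φ (y i)
  set V := wcov (chainWeight φ h y θ) (fun i => Δ ⬝ᵥ φ (y i)) (fun i => Δ ⬝ᵥ φ (y i))
  rw [wmean_dot] at hlog
  have hg := (abs_le.1 (abs_dotProduct_le Δ _ hgrad)).1
  have hg' : (Δ ⬝ᵥ fun j => wmean (chainWeight φ h y θ) (fun i => φ (y i) j) - sampleMean φ x j) =
      (Δ ⬝ᵥ fun j => wmean (chainWeight φ h y θ) (fun i => φ (y i) j)) - Δ ⬝ᵥ sampleMean φ x := by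
    simp only [dotProduct, mul_sub, Finset.sum_sub_distrib]
  have hn := le_norm1_add_sub hsupp Δ
  rw [norm1_eq_add_compl Δ T] at hV hg ⊢
  set a := ∑ j ∈ T, |Δ j| with ha
  set b := ∑ j ∈ Tᶜ, |Δ j| with hb
  have ha0 : 0 ≤ a := Finset.sum_nonneg fun _ _ => abs_nonneg _
  have hb0 : 0 ≤ b := Finset.sum_nonneg fun _ _ => abs_nonneg _
  -- the ridge penalty can decrease only through the coordinates in `T`, where `θ` is bounded
  have hsq : -(2 * B * a) ≤ ∑ j, (θ + Δ) j ^ 2 - ∑ j, θ j ^ 2 := by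
    have e1 : ∑ j, 2 * θ j * Δ j = ∑ j ∈ T, 2 * θ j * Δ j := by
      refine (Finset.sum_subset (Finset.subset_univ T) fun j _ hj => ?_).symm
      simp [hsupp j hj]
    have e2 : ∑ j, 2 * θ j * Δ j ≤ ∑ j, (θ + Δ) j ^ 2 - ∑ j, θ j ^ 2 := by
      rw [← Finset.sum_sub_distrib]
      refine Finset.sum_le_sum fun j _ => ?_
      simp only [Pi.add_apply]
      nlinarith [sq_nonneg (Δ j)]
    have e3 : -(2 * B * a) ≤ ∑ j ∈ T, 2 * θ j * Δ j := by
      rw [ha, Finset.mul_sum, ← Finset.sum_neg_distrib]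
      refine Finset.sum_le_sum fun j _ => ?_
      have : |θ j * Δ j| ≤ B * |Δ j| := by
        rw [abs_mul]; exact mul_le_mul_of_nonneg_right (hB j) (abs_nonneg _)
      linarith [(abs_le.1 this).1]
    linarith
  have hl2 : -(2 * B * a) * lam₂ ≤ lam₂ * (∑ j, (θ + Δ) j ^ 2 - ∑ j, θ j ^ 2) := by
    rw [mul_comm]; exact mul_le_mul_of_nonneg_left hsq h2
  have hl2' : 2 * B * a * lam₂ ≤ 2 * B * a * (c * lam₁) := by gcongr
  have hl1 := mul_le_mul_of_nonneg_left hn h1.le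
  -- the basic inequality: the noise level `lam₁ / 2` leaves half of the penalty off the support
  have hbasic : V / 8 + lam₁ / 2 * b ≤ lam₁ * (3 / 2 + 2 * c * B) * a := by nlinarith
  have hcone : a + b ≤ (4 + 4 * c * B) * a := by
    have : lam₁ * b ≤ lam₁ * ((3 + 4 * c * B) * a) := by nlinarith
    have := le_of_mul_le_mul_left this h1
    linarith
  exact cone_rate ha0 hb0 hev hs (by positivity) h1.le (by positivity) hρ0 hV
    (sq_sum_abs_le Δ T hT) (by nlinarith) hcone hρ

/-- The `ℓ₁`-rate of the Elastic-net estimator. -/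
lemma elasticNet_rate (hh : ∀ s, 0 < h s) (hm : 0 < m) {lam₁ lam₂ c B K ev ρ s : ℝ}
    (h1 : 0 < lam₁) (h2 : 0 ≤ lam₂) (h21 : lam₂ ≤ c * lam₁) (hB0 : 0 ≤ B) (hc : 0 ≤ c)
    (hev : 0 < ev) (hs : 0 < s) (hρ0 : 0 ≤ ρ) (hK0 : 0 < K)
    {T : Finset ι} (hT : (T.card : ℝ) ≤ s)
    {θ θh : ι → ℝ} (hsupp : ∀ j ∉ T, θ j = 0) (hB : ∀ j, |θ j| ≤ B)
    (hK : ∀ i j, |φ i j| ≤ K)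
    (hgrad : ∀ j, |wmean (chainWeight φ h y θ) (fun i => φ (y i) j) - sampleMean φ x j| ≤ lam₁ / 2)
    (hRE : ∀ u : ι → ℝ, ev * ∑ j, u j ^ 2 - ρ * norm1 u ^ 2 ≤
      wcov (chainWeight φ h y θ) (fun i => u ⬝ᵥ φ (y i)) (fun i => u ⬝ᵥ φ (y i)))
    (hρ : ρ * (4 + 4 * c * B) ^ 2 * (2 * s) ≤ ev)
    (hsmall : (4 + 4 * c * B) * (16 * s * (3 / 2 + 2 * c * B) / ev) * lam₁ * K < 1 / 2)
    (hmin : IsElasticNet (mcmcLoss φ h x y) lam₁ lam₂ θh) :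
    norm1 (θh - θ) ≤ (4 + 4 * c * B) * (16 * s * (3 / 2 + 2 * c * B) / ev) * lam₁ := by
  set δ := θh - θ with hδ
  have hle : mcmcLoss φ h x y (θ + δ) + lam₁ * norm1 (θ + δ) + lam₂ * ∑ j, (θ + δ) j ^ 2 ≤
      mcmcLoss φ h x y θ + lam₁ * norm1 θ + lam₂ * ∑ j, θ j ^ 2 := by
    have : θ + δ = θh := by rw [hδ]; abel
    rw [this]
    exact hmin (Set.mem_univ θ)
  by_cases hcase : norm1 δ * K ≤ 1 / 2
  · exact elasticNet_local hh hm h1 h2 h21 hB0 hc hev hs hρ0 hT hsupp hB hK hgrad hRE hρ hcase hle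
  · -- otherwise a point on the segment at the boundary of the local region violates the local rate
    exfalso
    push Not at hcase
    have hpos : 0 < norm1 δ * K := by linarith
    set t := (1 / 2) / (norm1 δ * K) with ht
    have ht0 : 0 ≤ t := by positivity
    have ht1 : t ≤ 1 := (div_le_one hpos).2 hcase.le
    have hle' := elasticNet_segment hh hm h1.le h2 θ δ ht0 ht1 hle
    have hn : norm1 (t • δ) * K = 1 / 2 := by
      rw [norm1_smul, abs_of_nonneg ht0, mul_assoc, ht, div_mul_cancel₀ _ hpos.ne']
    have := elasticNet_local hh hm h1 h2 h21 hB0 hc hev hs hρ0 hT hsupp hB hK hgrad hRE hρ hn.le hle'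
    nlinarith

end ElasticNet

section Lasso

variable {k : ℕ}

lemma vecCons_zero_dotProduct_mulVec (A : Matrix (Fin (k + 1)) (Fin (k + 1)) ℝ) (u w : Fin k → ℝ) :
    (Matrix.vecCons 0 u : Fin (k + 1) → ℝ) ⬝ᵥ A *ᵥ Matrix.vecCons 1 (-w) =
      u ⬝ᵥ (blockAB A - blockBB A *ᵥ w) := by
  simp only [dotProduct, Matrix.mulVec, Fin.sum_univ_succ, Matrix.cons_val_zero,
    Matrix.cons_val_succ, zero_mul, zero_add, mul_one, Pi.sub_apply, blockAB, blockBB,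
    Matrix.submatrix_apply, Pi.neg_apply, mul_neg, Finset.sum_neg_distrib, sub_eq_add_neg]

lemma vecCons_zero_dotProduct_mulVec_self (A : Matrix (Fin (k + 1)) (Fin (k + 1)) ℝ)
    (u : Fin k → ℝ) :
    (Matrix.vecCons 0 u : Fin (k + 1) → ℝ) ⬝ᵥ A *ᵥ Matrix.vecCons 0 u = u ⬝ᵥ blockBB A *ᵥ u := by
  simp only [dotProduct, Matrix.mulVec, Fin.sum_univ_succ, Matrix.cons_val_zero,
    Matrix.cons_val_succ, zero_mul, zero_add, mul_zero, blockBB, Matrix.submatrix_apply]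

lemma dotProduct_mulVec_comm {J : Type*} [Fintype J] {A : Matrix J J ℝ} (hA : A.IsSymm)
    (u v : J → ℝ) : u ⬝ᵥ A *ᵥ v = v ⬝ᵥ A *ᵥ u := by
  rw [Matrix.dotProduct_mulVec, dotProduct_comm, ← Matrix.mulVec_transpose, hA.eq]

lemma decorrLasso_le {A : Matrix (Fin (k + 1)) (Fin (k + 1)) ℝ} (hA : A.IsSymm) {lam : ℝ}
    {w : Fin k → ℝ} (hw : IsDecorrLasso A lam w) (w' : Fin k → ℝ) :
    1 / 2 * ((w - w') ⬝ᵥ blockBB A *ᵥ (w - w')) - (w - w') ⬝ᵥ (blockAB A - blockBB A *ᵥ w')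
      + lam * (norm1 w - norm1 w') ≤ 0 := by
  have hB : (blockBB A).IsSymm := hA.submatrix _
  have h1 := hw (Set.mem_univ w')
  simp only [Set.mem_ofPred_eq] at h1
  have h2 := dotProduct_mulVec_comm hB w w'
  simp only [Matrix.mulVec_sub, dotProduct_sub, sub_dotProduct]
  linarith

/-- The stationarity condition of the lasso: each partial derivative of the quadratic part is at
most the tuning parameter in absolute value. -/
lemma decorrLasso_kkt {A : Matrix (Fin (k + 1)) (Fin (k + 1)) ℝ} (hA : A.IsSymm) {lam : ℝ}
    (hlam : 0 ≤ lam) {w : Fin k → ℝ} (hw : IsDecorrLasso A lam w) (j : Fin k) :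
    |(blockAB A - blockBB A *ᵥ w) j| ≤ lam := by
  have key : ∀ σ : ℝ, |σ| = 1 → σ * (blockAB A - blockBB A *ᵥ w) j ≤ lam := by
    intro σ hσ
    refine le_of_forall_pos_le_add fun ε hε => ?_
    -- move `w` by `σ t` along the coordinate `j`; the step `t` is so small that the second-order
    -- term is at most `ε t`
    set q := |blockBB A j j| with hq
    have hq0 : 0 ≤ q := abs_nonneg _
    set t := ε / (q + 1) with ht
    have ht0 : 0 < t := by positivity
    have h1 := hw (Set.mem_univ (w + (σ * t) • Pi.single j 1))
    simp only [Set.mem_ofPred_eq] at h1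
    have h2 := dotProduct_mulVec_comm (A := blockBB A) (hA.submatrix _) w (Pi.single j 1)
    have h3 : norm1 (w + (σ * t) • Pi.single j 1) ≤ norm1 w + t := by
      refine (norm1_add_le _ _).trans_eq ?_
      rw [norm1_smul, abs_mul, hσ, one_mul, abs_of_pos ht0]
      simp [norm1, Pi.single_apply, apply_ite abs]
    simp only [Matrix.mulVec_add, dotProduct_add, add_dotProduct, Matrix.mulVec_smul,
      dotProduct_smul, smul_dotProduct, smul_eq_mul, h2, single_dotProduct, one_mul] at h1
    have h4 : (blockBB A *ᵥ Pi.single j 1) j = blockBB A j j := by simp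
    rw [h4] at h1
    have h5 : blockBB A j j ≤ q := le_abs_self _
    have h6 : σ * σ = 1 := by rw [← abs_mul_abs_self, hσ, one_mul]
    have h7 : t * q ≤ ε := by
      rw [ht, div_mul_eq_mul_div, div_le_iff₀ (by positivity)]; nlinarith
    have h8 := mul_le_mul_of_nonneg_left h3 hlam
    have h9 : t * (σ * (blockAB A - blockBB A *ᵥ w) j) ≤ t * (lam + ε) := by
      have e1 : (blockAB A - blockBB A *ᵥ w) j = blockAB A j - (blockBB A *ᵥ w) j := rfl
      have e2 : σ * t * (σ * t * blockBB A j j) = t * t * blockBB A j j := by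
        linear_combination (t * t * blockBB A j j) * h6
      have e3 : t * t * blockBB A j j ≤ t * ε := by
        calc t * t * blockBB A j j ≤ t * t * q := by gcongr
          _ = t * (t * q) := by ring
          _ ≤ t * ε := by gcongr
      have e4 : 0 ≤ t * ε := by positivity
      rw [e1]
      nlinarith
    exact le_of_mul_le_mul_left h9 ht0
  rw [abs_le]
  have := key 1 (by simp)
  have := key (-1) (by simp)
  constructor <;> linarith

variable {I : Type*} [Fintype I]

/-- The covariance matrix of the vector-valued function `Φ` under the weights `a`. -/
def wcovMatrix {J : Type*} (a : I → ℝ) (Φ : I → J → ℝ) : Matrix J J ℝ :=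
  Matrix.of fun j l => wcov a (fun i => Φ i j) (fun i => Φ i l)

lemma wcovMatrix_isSymm {J : Type*} (a : I → ℝ) (Φ : I → J → ℝ) : (wcovMatrix a Φ).IsSymm := by
  ext i j; exact wcov_comm _ _ _

/-- The `ℓ₁`-rate of the lasso estimate of the decorrelation direction, computed from weights `b`
that are a small perturbation of weights `a` whose covariance matrix is close to `H`. -/
lemma decorrLasso_rate {a b : I → ℝ} (ha : IsWeight a) (hb : IsWeight b) {τ : ℝ} (hτ0 : 0 ≤ τ)
    (hτ : τ ≤ 1 / 2) (hab : ∀ i, |b i - a i| ≤ τ * a i) {Φ : I → Fin (k + 1) → ℝ} {K : ℝ}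
    (hK0 : 0 ≤ K) (hK : ∀ i j, |Φ i j| ≤ K) {H : Matrix (Fin (k + 1)) (Fin (k + 1)) ℝ} {ρ ev s : ℝ}
    (hρ0 : 0 ≤ ρ) (hev : 0 < ev) (hs : 0 < s)
    (hH : ∀ i j, |wcovMatrix a Φ i j - H i j| ≤ ρ)
    (hRE : ∀ u : Fin (k + 1) → ℝ, ev * ∑ j, u j ^ 2 - ρ * norm1 u ^ 2 ≤
      wcov a (fun i => u ⬝ᵥ Φ i) (fun i => u ⬝ᵥ Φ i))
    {w wh : Fin k → ℝ} (hw : blockAB H = blockBB H *ᵥ w) {T : Finset (Fin k)}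
    (hT : (T.card : ℝ) ≤ s) (hsupp : ∀ j ∉ T, w j = 0) {D lam : ℝ} (hD : 1 + norm1 w ≤ D)
    (hlam : 0 < lam) (hρlam : D * ρ ≤ lam / 2) (hρ : ρ * 6 ^ 2 * (2 * s) ≤ ev)
    (hmin : IsDecorrLasso (wcovMatrix b Φ) lam wh) :
    norm1 (wh - w) ≤ 6 * (16 * s * (5 / 2) / ev) * lam + 6 * (32 * (τ * (D * K)) ^ 2 / lam) := by
  set Δ := wh - w with hΔ
  set u : Fin (k + 1) → ℝ := Matrix.vecCons 0 Δ with hu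
  set v : Fin (k + 1) → ℝ := Matrix.vecCons 1 (-w) with hv
  have hv1 : norm1 v ≤ D := by
    rw [hv, norm1_vecCons, abs_one]
    have : norm1 (-w) = norm1 w := by simp [norm1]
    rwa [this]
  have hD0 : 0 ≤ D := (norm1_nonneg v).trans hv1
  have hu1 : norm1 u = norm1 Δ := by rw [hu, norm1_vecCons, abs_zero, zero_add]
  have hmin' := decorrLasso_le (wcovMatrix_isSymm b Φ) hmin w
  rw [← vecCons_zero_dotProduct_mulVec_self, ← vecCons_zero_dotProduct_mulVec] at hmin'
  have hvK : ∀ i, |v ⬝ᵥ Φ i| ≤ D * K := fun i =>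
    (abs_dotProduct_le v _ (hK i)).trans (by gcongr)
  have e1 : u ⬝ᵥ wcovMatrix b Φ *ᵥ u = wcov b (fun i => u ⬝ᵥ Φ i) (fun i => u ⬝ᵥ Φ i) :=
    (wcov_dot b Φ u u).symm
  have e2 : u ⬝ᵥ wcovMatrix b Φ *ᵥ v = wcov b (fun i => u ⬝ᵥ Φ i) (fun i => v ⬝ᵥ Φ i) :=
    (wcov_dot b Φ u v).symm
  have e3 : u ⬝ᵥ wcovMatrix a Φ *ᵥ v = wcov a (fun i => u ⬝ᵥ Φ i) (fun i => v ⬝ᵥ Φ i) :=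
    (wcov_dot a Φ u v).symm
  -- the population gradient vanishes at `w`, so that only the error of the Hessian contributes
  have e4 : u ⬝ᵥ H *ᵥ v = 0 := by
    rw [hu, hv, vecCons_zero_dotProduct_mulVec, hw, sub_self, dotProduct_zero]
  have e5 : |u ⬝ᵥ wcovMatrix a Φ *ᵥ v| ≤ norm1 Δ * (lam / 2) := by
    have h1 := abs_dotProduct_mulVec_le (wcovMatrix a Φ - H) u v (c := ρ) hH
    rw [Matrix.sub_mulVec, dotProduct_sub, e4, sub_zero, hu1] at h1
    refine h1.trans ?_
    have := norm1_nonneg Δ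
    gcongr
    exact (mul_le_mul_of_nonneg_right hv1 hρ0).trans hρlam
  -- the change of weights costs a fraction of the curvature and an error of second order
  have e6 := ha.abs_wcov_sub_le_var hb hτ0 (by linarith) hab (fun i => u ⬝ᵥ Φ i)
    (by positivity) hvK
  have e7 := ha.le_wcov_self (by linarith) hab fun i => u ⬝ᵥ Φ i
  have hV := hRE u
  have hV0 := ha.wcov_self_nonneg fun i => u ⬝ᵥ Φ i
  rw [e1, e2] at hmin'
  rw [e3] at e5
  set V := wcov a (fun i => u ⬝ᵥ Φ i) (fun i => u ⬝ᵥ Φ i)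
  set E := 32 * (τ * (D * K)) ^ 2 with hE
  have hE0 : 0 ≤ E := by positivity
  have hn := le_norm1_add_sub hsupp Δ
  have hwΔ : w + Δ = wh := by rw [hΔ]; abel
  have hQ : ∑ j, u j ^ 2 = ∑ j, Δ j ^ 2 := by simp [hu, Fin.sum_univ_succ]
  rw [hwΔ] at hn
  rw [hu1, hQ] at hV
  rw [norm1_eq_add_compl Δ T] at hV e5 ⊢
  set p := ∑ j ∈ T, |Δ j| with hp
  set r := ∑ j ∈ Tᶜ, |Δ j| with hr
  have hp0 : 0 ≤ p := Finset.sum_nonneg fun _ _ => abs_nonneg _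
  have hr0 : 0 ≤ r := Finset.sum_nonneg fun _ _ => abs_nonneg _
  have hl := mul_le_mul_of_nonneg_left hn hlam.le
  have hbasic : V / 8 + lam / 2 * r ≤ lam * (3 / 2) * p + E := by
    have h1 := (abs_le.1 e5).2
    have h2 := (abs_le.1 e6).2
    have h3 : 1 / 2 * V ≤ (1 - τ) * V := mul_le_mul_of_nonneg_right (by linarith) hV0
    linarith
  exact cone_rate_add_error hp0 hr0 hev hs hlam hE0 hρ0 hV0 hV (sq_sum_abs_le Δ T hT) hbasic hρ

end Lasso

/-! ### The expansion of the one-step estimator on a good event -/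

section Expansion

/-- The support of `v` as a finite set. -/
noncomputable def suppFinset {ι : Type*} [Fintype ι] (v : ι → ℝ) : Finset ι :=
  letI := Classical.decPred fun j => v j ≠ 0
  Finset.univ.filter fun j => v j ≠ 0

lemma eq_zero_of_notMem_suppFinset {ι : Type*} [Fintype ι] {v : ι → ℝ} {j : ι}
    (hj : j ∉ suppFinset v) : v j = 0 := by
  simpa [suppFinset] using hj

lemma card_suppFinset {ι : Type*} [Fintype ι] (v : ι → ℝ) : (suppFinset v).card = norm0 v := by
  rw [norm0, ← Set.ncard_coe_finset]
  congr 1; ext j; simp [suppFinset]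

lemma norm1_le_norm0_mul {ι : Type*} [Fintype ι] {v : ι → ℝ} {D : ℝ} (h : ∀ j, |v j| ≤ D) :
    norm1 v ≤ norm0 v * D := by
  classical
  rw [norm1_eq_add_compl v (suppFinset v), Finset.sum_eq_zero (s := (suppFinset v)ᶜ), add_zero,
    ← card_suppFinset, ← nsmul_eq_mul]
  · exact Finset.sum_le_card_nsmul _ _ _ fun j _ => h j
  · intro j hj
    rw [eq_zero_of_notMem_suppFinset (Finset.mem_compl.1 hj), abs_zero]

variable {k : ℕ}

lemma dotProduct_mulVec_vecCons_one {A : Matrix (Fin (k + 1)) (Fin (k + 1)) ℝ} (hA : A.IsSymm)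
    (δ : Fin (k + 1) → ℝ) (w : Fin k → ℝ) :
    δ ⬝ᵥ A *ᵥ Matrix.vecCons 1 (-w) = δ 0 * (A 0 0 - w ⬝ᵥ blockAB A) +
      Matrix.vecTail δ ⬝ᵥ (blockAB A - blockBB A *ᵥ w) := by
  have h1 : ∀ j : Fin k, A 0 j.succ = A j.succ 0 := fun j => hA.apply _ _
  simp only [dotProduct, Matrix.mulVec, Fin.sum_univ_succ, Matrix.cons_val_zero,
    Matrix.cons_val_succ, mul_one, Pi.sub_apply, blockAB, blockBB, Matrix.submatrix_apply,
    Pi.neg_apply, mul_neg, Finset.sum_neg_distrib, sub_eq_add_neg, h1, Matrix.vecTail,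
    Function.comp_apply, mul_comm (w _)]

variable {S : Type*} {n m : ℕ} {φ : S → Fin (k + 1) → ℝ} {h : S → ℝ}
  {x : Fin n → S} {y : Fin m → S}

lemma decorrScore_mcmcLoss (hh : ∀ s, 0 < h s) (hm : 0 < m) (w : Fin k → ℝ)
    (θ : Fin (k + 1) → ℝ) :
    decorrScore (mcmcLoss φ h x y) w (θ 0) (Matrix.vecTail θ) =
      (Matrix.vecCons 1 (-w) : Fin (k + 1) → ℝ) ⬝ᵥ fun j =>
        wmean (chainWeight φ h y θ) (fun i => φ (y i) j) - sampleMean φ x j := by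
  have hθ : (Matrix.vecCons (θ 0) (Matrix.vecTail θ) : Fin (k + 1) → ℝ) = θ :=
    Matrix.cons_head_tail θ
  simp only [decorrScore, hθ, pderiv_mcmcLoss φ x y hh hm, dotProduct, Fin.sum_univ_succ,
    Matrix.cons_val_zero, Matrix.cons_val_succ, Pi.neg_apply, one_mul, neg_mul,
    Finset.sum_neg_distrib, sub_eq_add_neg]

lemma plugInInfo_mcmcLoss (hh : ∀ s, 0 < h s) (hm : 0 < m) (w : Fin k → ℝ)
    (θ : Fin (k + 1) → ℝ) :
    plugInInfo (mcmcLoss φ h x y) θ w =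
      wcovMatrix (chainWeight φ h y θ) (fun i => φ (y i)) 0 0 -
        w ⬝ᵥ blockAB (wcovMatrix (chainWeight φ h y θ) fun i => φ (y i)) := by
  rw [plugInInfo, hess_mcmcLoss φ x y hh hm]; rfl

/-- The error of the linearisation of the decorrelated score, in terms of the errors of the two
penalised estimators. The nuisance part of the linear term is controlled by the stationarity
condition of the lasso, the curvature by the expansion of the tilted mean. -/
lemma abs_score_expansion_le (hh : ∀ s, 0 < h s) (hm : 0 < m) {K : ℝ} (hK0 : 0 ≤ K)
    (hK : ∀ s j, |φ s j| ≤ K) {θs θh : Fin (k + 1) → ℝ} {w wh : Fin k → ℝ} {lam₁ lam' N r₁ r₂ : ℝ}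
    (hlam' : 0 ≤ lam')
    (hgrad : ∀ j, |wmean (chainWeight φ h y θs) (fun i => φ (y i) j) - sampleMean φ x j| ≤ lam₁ / 2)
    (hN : 1 + norm1 wh ≤ N)
    (hr₁ : norm1 (θh - θs) ≤ r₁) (hr₁K : r₁ * K ≤ 1 / 4) (hr₂ : norm1 (wh - w) ≤ r₂)
    (hlam₁ : 0 ≤ lam₁)
    (hmin : IsDecorrLasso (hess (mcmcLoss φ h x y) θh) lam' wh) :
    |plugInInfo (mcmcLoss φ h x y) θh wh * (θh 0 - θs 0) -
        decorrScore (mcmcLoss φ h x y) wh (θh 0) (Matrix.vecTail θh) +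
        decorrScore (mcmcLoss φ h x y) w (θs 0) (Matrix.vecTail θs)| ≤
      64 * (N * K) * (r₁ * K) ^ 2 + r₁ * lam' + r₂ * (lam₁ / 2) := by
  set δ := θh - θs with hδ
  set a := chainWeight φ h y θs with ha_def
  set b := chainWeight φ h y θh with hb_def
  have hb : IsWeight b := isWeight_chainWeight φ y hh hm θh
  -- the expansion is around the estimate, whose weights enter the stationarity condition
  have hab : a = reweight b fun i => (-δ) ⬝ᵥ φ (y i) := by
    rw [hb_def, ← chainWeight_add φ y hh hm, hδ, ha_def]
    congr 1; abel
  set A := wcovMatrix b fun i => φ (y i) with hA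
  have hAs : A.IsSymm := wcovMatrix_isSymm _ _
  have hhess : hess (mcmcLoss φ h x y) θh = A := by rw [hess_mcmcLoss φ x y hh hm]; rfl
  rw [hhess] at hmin
  rw [plugInInfo_mcmcLoss hh hm, decorrScore_mcmcLoss hh hm, decorrScore_mcmcLoss hh hm]
  set v : Fin (k + 1) → ℝ := Matrix.vecCons 1 (-wh) with hv
  set f := fun i => v ⬝ᵥ φ (y i) with hf
  have hr0 : 0 ≤ r₁ := (norm1_nonneg _).trans hr₁
  have hv1 : norm1 v ≤ N := by
    rw [hv, norm1_vecCons, abs_one]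
    simpa [norm1] using hN
  have hfK : ∀ i, |f i| ≤ N * K := fun i =>
    (abs_dotProduct_le v _ (hK (y i))).trans (by gcongr)
  have hgK : ∀ i, |(-δ) ⬝ᵥ φ (y i)| ≤ r₁ * K := fun i => by
    rw [neg_dotProduct, abs_neg]
    exact (abs_dotProduct_le δ _ (hK (y i))).trans (by gcongr)
  have hNK : 0 ≤ N * K := mul_nonneg ((norm1_nonneg v).trans hv1) hK0
  have e1 := hb.abs_wmean_reweight_sub_le hr₁K hfK hgK (by positivity) hNK
  rw [← hab] at e1
  have e2 : wcov b f (fun i => (-δ) ⬝ᵥ φ (y i)) = - (δ ⬝ᵥ A *ᵥ v) := by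
    have : wcov b f (fun i => (-δ) ⬝ᵥ φ (y i)) = v ⬝ᵥ A *ᵥ (-δ) := wcov_dot _ _ _ _
    rw [this, Matrix.mulVec_neg, dotProduct_neg, dotProduct_mulVec_comm hAs]
  rw [e2, dotProduct_mulVec_vecCons_one hAs] at e1
  have e3 : |Matrix.vecTail δ ⬝ᵥ (blockAB A - blockBB A *ᵥ wh)| ≤ r₁ * lam' := by
    refine (abs_dotProduct_le _ _ fun j => decorrLasso_kkt hAs hlam' hmin j).trans ?_
    have : norm1 (Matrix.vecTail δ) ≤ norm1 δ := by
      rw [norm1, norm1, Fin.sum_univ_succ]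
      exact le_add_of_nonneg_left (abs_nonneg _)
    gcongr
    exact this.trans hr₁
  set grad := fun j => wmean a (fun i => φ (y i) j) - sampleMean φ x j with hgrad_def
  have e4 : |(Matrix.vecCons 0 (wh - w) : Fin (k + 1) → ℝ) ⬝ᵥ grad| ≤ r₂ * (lam₁ / 2) := by
    refine (abs_dotProduct_le _ _ hgrad).trans ?_
    rw [norm1_vecCons, abs_zero, zero_add]
    gcongr
  -- replacing the direction `wh` by `w` in the score at the true parameter
  have e5 : (Matrix.vecCons 1 (-w) : Fin (k + 1) → ℝ) ⬝ᵥ grad =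
      v ⬝ᵥ grad + (Matrix.vecCons 0 (wh - w) : Fin (k + 1) → ℝ) ⬝ᵥ grad := by
    rw [← add_dotProduct, hv, Matrix.cons_add_cons]
    congr 2
    · simp
    · abel
  have e6 : ∀ p : Fin m → ℝ, (v ⬝ᵥ fun j => wmean p (fun i => φ (y i) j) - sampleMean φ x j) =
      wmean p f - v ⬝ᵥ sampleMean φ x := by
    intro p
    rw [hf, wmean_dot]
    simp only [dotProduct, mul_sub, Finset.sum_sub_distrib]
  rw [e5, e6 b, hgrad_def, e6 a]
  have e7 : δ 0 = θh 0 - θs 0 := rfl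
  rw [e7] at e1
  rw [abs_le] at *
  constructor <;> linarith [e1.1, e1.2, e3.1, e3.2, e4.1, e4.2]

lemma abs_plugIn_sub_le {A H : Matrix (Fin (k + 1)) (Fin (k + 1)) ℝ} {w wh : Fin k → ℝ}
    {D ρ c r : ℝ} (hD : 1 + norm1 w ≤ D) (hAH : ∀ i j, |A i j - H i j| ≤ ρ)
    (hA : ∀ i j, |A i j| ≤ c) (hρ : 0 ≤ ρ) (hc : 0 ≤ c) (hr : norm1 (wh - w) ≤ r) :
    |(A 0 0 - wh ⬝ᵥ blockAB A) - (H 0 0 - w ⬝ᵥ blockAB H)| ≤ D * ρ + r * c := by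
  have h1 := hAH 0 0
  have h2 : |w ⬝ᵥ (blockAB A - blockAB H)| ≤ norm1 w * ρ :=
    abs_dotProduct_le _ _ fun j : Fin k => hAH j.succ 0
  have h3 : |(wh - w) ⬝ᵥ blockAB A| ≤ r * c :=
    (abs_dotProduct_le _ _ fun j : Fin k => hA j.succ 0).trans (by gcongr)
  have h4 : (1 + norm1 w) * ρ ≤ D * ρ := by gcongr
  rw [dotProduct_sub] at h2
  rw [sub_dotProduct] at h3
  rw [abs_le] at *
  constructor <;> linarith [h1.1, h1.2, h2.1, h2.2, h3.1, h3.2]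

lemma lasso_error_le {C₁ C₂ K N s ev c lam₁ lam' τ : ℝ} (hev : 0 < ev) (hs : 0 < s)
    (hl1 : 0 ≤ lam₁) (hl' : 0 < lam') (h'1 : lam' ≤ c * lam₁) (h1' : lam₁ ≤ c * lam')
    (hτ : τ = 4 * (C₁ * lam₁ * K))
    (hC₂ : C₂ = 6 * (16 * s * (5 / 2) / ev) * c + 6 * (32 * (4 * (C₁ * K) * (N * K)) ^ 2 * c)) :
    6 * (16 * s * (5 / 2) / ev) * lam' + 6 * (32 * (τ * (N * K)) ^ 2 / lam') ≤ C₂ * lam₁ := by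
  have e1 : 32 * (τ * (N * K)) ^ 2 / lam' ≤
      32 * (4 * (C₁ * K) * (N * K)) ^ 2 * (c * lam₁) := by
    have e2 : 32 * (τ * (N * K)) ^ 2 =
        32 * (4 * (C₁ * K) * (N * K)) ^ 2 * (lam₁ * lam₁) := by rw [hτ]; ring
    have e3 : lam₁ * lam₁ ≤ c * lam₁ * lam' := by
      calc lam₁ * lam₁ ≤ lam₁ * (c * lam') := by gcongr
        _ = _ := by ring
    rw [div_le_iff₀ hl', e2, mul_assoc (32 * (4 * (C₁ * K) * (N * K)) ^ 2)]
    gcongr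
  calc _ ≤ 6 * (16 * s * (5 / 2) / ev) * (c * lam₁) +
        6 * (32 * (4 * (C₁ * K) * (N * K)) ^ 2 * (c * lam₁)) := by gcongr
    _ = C₂ * lam₁ := by rw [hC₂]; ring

/-- On the event where the score at the true parameter and the Monte Carlo information matrix are
close to their targets, the plug-in information is consistent and the one-step correction
linearises, with an error of the order of the square of the tuning parameter. The constants depend
only on the bounds of the model. -/
theorem exists_oneStep_expansion {K B D ev c : ℝ} (s₀ : ℕ) (hK0 : 0 < K) (hB0 : 0 ≤ B)
    (hD0 : 0 ≤ D) (hev : 0 < ev) (hc : 0 ≤ c) :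
    ∃ C c₀ : ℝ, 0 < C ∧ 0 < c₀ ∧ ∀ {S : Type} {k n m : ℕ} {φ : S → Fin (k + 1) → ℝ} {h : S → ℝ}
      {x : Fin n → S} {y : Fin m → S} {θs θh : Fin (k + 1) → ℝ} {w wh : Fin k → ℝ}
      {H : Matrix (Fin (k + 1)) (Fin (k + 1)) ℝ} {lam₁ lam₂ lam' ρ : ℝ},
      (∀ s, 0 < h s) → 0 < m → (∀ s j, |φ s j| ≤ K) → (∀ j, |θs j| ≤ B) → (∀ j, |w j| ≤ D) →
      norm0 θs ≤ s₀ → norm0 w ≤ s₀ → (∀ u : Fin (k + 1) → ℝ, ev * ∑ j, u j ^ 2 ≤ u ⬝ᵥ H *ᵥ u) →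
      blockAB H = blockBB H *ᵥ w →
      0 < lam₁ → 0 < lam₂ → 0 < lam' → lam₂ ≤ c * lam₁ → lam' ≤ c * lam₁ → lam₁ ≤ c * lam' →
      lam₁ ≤ c₀ → 0 ≤ ρ → ρ ≤ lam₁ → (1 + s₀ * D) * ρ ≤ lam' / 2 →
      (∀ j, |wmean (chainWeight φ h y θs) (fun i => φ (y i) j) - sampleMean φ x j| ≤ lam₁ / 2) →
      (∀ i j, |wcovMatrix (chainWeight φ h y θs) (fun i => φ (y i)) i j - H i j| ≤ ρ) →
      IsElasticNet (mcmcLoss φ h x y) lam₁ lam₂ θh →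
      IsDecorrLasso (hess (mcmcLoss φ h x y) θh) lam' wh →
      |plugInInfo (mcmcLoss φ h x y) θh wh - (H 0 0 - w ⬝ᵥ blockAB H)| ≤ C * lam₁ ∧
      |plugInInfo (mcmcLoss φ h x y) θh wh * (θh 0 - θs 0) -
        decorrScore (mcmcLoss φ h x y) wh (θh 0) (Matrix.vecTail θh) +
        decorrScore (mcmcLoss φ h x y) w (θs 0) (Matrix.vecTail θs)| ≤ C * lam₁ ^ 2 := by
  -- `s` bounds the sparsity and is positive; `C₁` and `C₂` are the constants in the `ℓ₁`-rates of
  -- the two penalised estimators, `C₃` and `C₄` those of the two conclusions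
  set s : ℝ := s₀ + 1 with hs_def
  have hs : 0 < s := by positivity
  set N : ℝ := 1 + s₀ * D with hN_def
  have hN : 0 < N := by positivity
  set Z : ℝ := 4 + 4 * c * B with hZ_def
  have hZ : 0 < Z := by positivity
  set C₁ : ℝ := Z * (16 * s * (3 / 2 + 2 * c * B) / ev) with hC₁_def
  have hC₁ : 0 < C₁ := by positivity
  set C₂ : ℝ := 6 * (16 * s * (5 / 2) / ev) * c + 6 * (32 * (4 * (C₁ * K) * (N * K)) ^ 2 * c)
    with hC₂_def
  have hC₂ : 0 ≤ C₂ := by positivity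
  set C₃ : ℝ := N * (1 + 8 * (4 * (C₁ * K)) * (K * K)) + C₂ * (4 * (K * K)) with hC₃_def
  have hC₃ : 0 < C₃ := by positivity
  set C₄ : ℝ := 64 * ((N + 1) * K) * (C₁ * K) ^ 2 + C₁ * c + C₂ / 2 with hC₄_def
  have hC₄ : 0 ≤ C₄ := by positivity
  -- the threshold makes every smallness condition on the tuning parameter hold
  obtain ⟨c₀, hc₀, h1, h2, h3, h4⟩ : ∃ c₀ : ℝ, 0 < c₀ ∧ c₀ * (Z ^ 2 * (2 * s)) ≤ ev ∧
      c₀ * (6 ^ 2 * (2 * s)) ≤ ev ∧ c₀ * (C₁ * K) ≤ 1 / 16 ∧ c₀ * C₂ ≤ 1 := by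
    have key : ∀ p q : ℝ, 0 < p → 0 ≤ q → ∃ e : ℝ, 0 < e ∧ ∀ e', 0 < e' → e' ≤ e → e' * q ≤ p := by
      intro p q hp hq
      refine ⟨p / (q + 1), by positivity, fun e' he' h => ?_⟩
      rw [le_div_iff₀ (by positivity)] at h
      nlinarith
    obtain ⟨a₁, ha₁, k₁⟩ := key ev (Z ^ 2 * (2 * s)) hev (by positivity)
    obtain ⟨a₂, ha₂, k₂⟩ := key ev (6 ^ 2 * (2 * s)) hev (by positivity)
    obtain ⟨a₃, ha₃, k₃⟩ := key (1 / 16) (C₁ * K) (by norm_num) (by positivity)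
    obtain ⟨a₄, ha₄, k₄⟩ := key 1 C₂ one_pos hC₂
    have hpos : 0 < min (min a₁ a₂) (min a₃ a₄) := by positivity
    exact ⟨_, hpos, k₁ _ hpos ((min_le_left _ _).trans (min_le_left _ _)),
      k₂ _ hpos ((min_le_left _ _).trans (min_le_right _ _)),
      k₃ _ hpos ((min_le_right _ _).trans (min_le_left _ _)),
      k₄ _ hpos ((min_le_right _ _).trans (min_le_right _ _))⟩
  refine ⟨C₃ + C₄, c₀, by positivity, hc₀, ?_⟩
  clear_value C₄ C₃ C₂ C₁ Z N s
  intro S k n m φ h x y θs θh w wh H lam₁ lam₂ lam' ρ hh hm hK hB hD hs0 hs0' hH hw hl1 hl2 hl'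
    h21 h'1 h1' hsmall hρ0 hρ1 hρ' hgrad hHess hEN hLasso
  have ha := isWeight_chainWeight φ y hh hm θs
  have hb := isWeight_chainWeight φ y hh hm θh
  -- the curvature of the information matrix is inherited up to `ρ` times the squared `ℓ₁`-norm
  have hRE : ∀ u : Fin (k + 1) → ℝ, ev * ∑ j, u j ^ 2 - ρ * norm1 u ^ 2 ≤
      wcov (chainWeight φ h y θs) (fun i => u ⬝ᵥ φ (y i)) (fun i => u ⬝ᵥ φ (y i)) := by
    intro u
    have e1 : wcov (chainWeight φ h y θs) (fun i => u ⬝ᵥ φ (y i)) (fun i => u ⬝ᵥ φ (y i)) =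
      u ⬝ᵥ wcovMatrix (chainWeight φ h y θs) (fun i => φ (y i)) *ᵥ u := wcov_dot _ _ _ _
    have e2 := abs_dotProduct_mulVec_le
      (wcovMatrix (chainWeight φ h y θs) (fun i => φ (y i)) - H) u u (c := ρ) hHess
    rw [Matrix.sub_mulVec, dotProduct_sub] at e2
    have e3 := (abs_le.1 e2).1
    have e4 := hH u
    rw [e1]
    linarith
  have hcard : ((suppFinset θs).card : ℝ) ≤ s := by
    rw [card_suppFinset, hs_def]
    have : (norm0 θs : ℝ) ≤ s₀ := by exact_mod_cast hs0
    linarith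
  have hcard' : ((suppFinset w).card : ℝ) ≤ s := by
    rw [card_suppFinset, hs_def]
    have : (norm0 w : ℝ) ≤ s₀ := by exact_mod_cast hs0'
    linarith
  have hρc : ρ ≤ c₀ := hρ1.trans hsmall
  have hr1 : norm1 (θh - θs) ≤ C₁ * lam₁ := by
    have e1 : ρ * (4 + 4 * c * B) ^ 2 * (2 * s) ≤ ev := by
      refine le_trans ?_ h1
      rw [mul_assoc, hZ_def]; gcongr
    have e2 := elasticNet_rate (θh := θh) hh hm hl1 hl2.le h21 hB0 hc hev hs hρ0 hK0 hcard
      (fun j hj => eq_zero_of_notMem_suppFinset hj) hB hK hgrad hRE e1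
    rw [← hZ_def, ← hC₁_def] at e2
    refine e2 ?_ hEN
    calc C₁ * lam₁ * K = lam₁ * (C₁ * K) := by ring
        _ ≤ c₀ * (C₁ * K) := by gcongr
        _ < 1 / 2 := by linarith
  have hηle : C₁ * lam₁ * K ≤ 1 / 16 := by
    calc C₁ * lam₁ * K = lam₁ * (C₁ * K) := by ring
      _ ≤ c₀ * (C₁ * K) := by gcongr
      _ ≤ 1 / 16 := h3
  set τ : ℝ := 4 * (C₁ * lam₁ * K) with hτ
  have hτ0 : 0 ≤ τ := by positivity
  have hτ2 : τ ≤ 1 / 2 := by rw [hτ]; linarith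
  have hab : ∀ i, |chainWeight φ h y θh i - chainWeight φ h y θs i| ≤
      τ * chainWeight φ h y θs i := by
    have : chainWeight φ h y θh =
        reweight (chainWeight φ h y θs) fun i => (θh - θs) ⬝ᵥ φ (y i) := by
      rw [← chainWeight_add φ y hh hm]; congr 1; abel
    rw [this]
    refine ha.abs_reweight_sub_le (by linarith) fun i => ?_
    exact (abs_dotProduct_le _ _ (hK (y i))).trans (by gcongr)
  have hwN : 1 + norm1 w ≤ N := by
    have e1 := norm1_le_norm0_mul hD
    have e2 : (norm0 w : ℝ) * D ≤ s₀ * D := by gcongr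
    rw [hN_def]; linarith
  have hhess : hess (mcmcLoss φ h x y) θh =
      wcovMatrix (chainWeight φ h y θh) fun i => φ (y i) := by
    rw [hess_mcmcLoss φ x y hh hm]; rfl
  have hr2 : norm1 (wh - w) ≤ C₂ * lam₁ := by
    rw [hhess] at hLasso
    refine (decorrLasso_rate ha hb hτ0 hτ2 hab hK0.le (fun i j => hK (y i) j) hρ0 hev hs hHess hRE
      hw hcard' (fun j hj => eq_zero_of_notMem_suppFinset hj) hwN hl' hρ' ?_ hLasso).trans ?_
    · refine le_trans ?_ h2
      rw [mul_assoc]; gcongr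
    · exact lasso_error_le hev hs hl1.le hl' h'1 h1' hτ hC₂_def
  have hr2' : C₂ * lam₁ ≤ 1 := by
    calc C₂ * lam₁ = lam₁ * C₂ := by ring
      _ ≤ c₀ * C₂ := by gcongr
      _ ≤ 1 := h4
  have hwhN : 1 + norm1 wh ≤ N + 1 := by
    have e1 := norm1_add_le w (wh - w)
    have e2 : w + (wh - w) = wh := by abel
    rw [e2] at e1
    linarith
  constructor
  · rw [plugInInfo_mcmcLoss hh hm]
    have e1 : ∀ i j, |wcovMatrix (chainWeight φ h y θh) (fun i => φ (y i)) i j - H i j| ≤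
        ρ + 8 * τ * (K * K) := by
      intro i j
      have e2 := ha.abs_wcov_sub_le hb hτ0 (by linarith) hab (fun l => hK (y l) i)
        (fun l => hK (y l) j) hK0.le
      have e3 := hHess i j
      refine (abs_sub_le _ (wcovMatrix (chainWeight φ h y θs) (fun i => φ (y i)) i j) _).trans ?_
      rw [add_comm]
      exact add_le_add e3 e2
    refine (abs_plugIn_sub_le hwN e1
      (fun i j => hb.abs_wcov_le (fun l => hK (y l) i) (fun l => hK (y l) j))
      (by positivity) (by positivity) hr2).trans ?_
    have e4 : N * (ρ + 8 * τ * (K * K)) + C₂ * lam₁ * (4 * (K * K)) ≤ C₃ * lam₁ := by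
      have : N * ρ ≤ N * lam₁ := by gcongr
      calc _ = N * ρ + (N * (8 * (4 * (C₁ * K)) * (K * K)) + C₂ * (4 * (K * K))) * lam₁ := by
            rw [hτ]; ring
        _ ≤ N * lam₁ + (N * (8 * (4 * (C₁ * K)) * (K * K)) + C₂ * (4 * (K * K))) * lam₁ := by
            gcongr
        _ = C₃ * lam₁ := by rw [hC₃_def]; ring
    have := mul_nonneg hC₄ hl1.le
    linarith
  · refine (abs_score_expansion_le hh hm hK0.le hK hl'.le hgrad hwhN hr1 (by linarith) hr2 hl1.le
      hLasso).trans ?_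
    have e1 : C₁ * lam₁ * lam' ≤ C₁ * lam₁ * (c * lam₁) := by gcongr
    have e2 : 64 * ((N + 1) * K) * (C₁ * lam₁ * K) ^ 2 + C₁ * lam₁ * (c * lam₁) +
        C₂ * lam₁ * (lam₁ / 2) = C₄ * lam₁ ^ 2 := by rw [hC₄_def]; ring
    have := mul_pos hC₃ (pow_pos hl1 2)
    linarith

end Expansion

/-! ### An exponential inequality for Markov chains with a spectral gap -/

section Operator

variable {S : Type*} [Fintype S]

/-- The transition operator `(P f)(x) = ∑ᵧ P(x, y) f(y)`. -/
def transOp (P : S → S → ℝ) (f : S → ℝ) (x : S) : ℝ := ∑ y, P x y * f y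

variable {h : S → ℝ} {P : S → S → ℝ}

lemma IsStationary.isWeight (hP : IsStationary h P) : IsWeight h :=
  ⟨fun x => (hP.pos x).le, hP.sum_one⟩

lemma IsStationary.isWeight_row (hP : IsStationary h P) (x : S) : IsWeight (P x) :=
  ⟨hP.nonneg x, hP.row_sum x⟩

lemma IsStationary.wmean_transOp (hP : IsStationary h P) (f : S → ℝ) :
    wmean h (transOp P f) = wmean h f := by
  simp only [wmean, transOp, Finset.mul_sum]
  rw [Finset.sum_comm]
  refine Finset.sum_congr rfl fun y _ => ?_
  rw [← hP.invariant y, Finset.sum_mul]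
  exact Finset.sum_congr rfl fun x _ => by ring

lemma IsStationary.transOp_sub_const (hP : IsStationary h P) (f : S → ℝ) (c : ℝ) (x : S) :
    transOp P (fun y => f y - c) x = transOp P f x - c :=
  (hP.isWeight_row x).wmean_sub_const f c

/-- The transition operator is a contraction of `L²(h)`, by Jensen's inequality. -/
lemma IsStationary.wmean_transOp_sq_le_self (hP : IsStationary h P) (f : S → ℝ) :
    (wmean h fun x => transOp P f x ^ 2) ≤ wmean h fun x => f x ^ 2 := by
  rw [← hP.wmean_transOp fun x => f x ^ 2]
  refine hP.isWeight.wmean_mono fun x => ?_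
  have h1 := (hP.isWeight_row x).wcov_self_nonneg f
  rw [(hP.isWeight_row x).wcov_eq] at h1
  have h2 : transOp P (fun x => f x ^ 2) x = wmean (P x) fun i => f i * f i := by
    simp only [transOp, wmean, sq]
  have h3 : transOp P f x = wmean (P x) f := rfl
  rw [h2, h3]
  linarith

/-- The set in the definition of `κ` is bounded, so that `κ` is a genuine supremum. -/
lemma IsStationary.bddAbove_kappa (hP : IsStationary h P) :
    BddAbove {r | ∃ f : S → ℝ, ∑ x, h x * f x = 0 ∧ ∑ x, h x * f x ^ 2 ≤ 1 ∧
      r = Real.sqrt (∑ x, h x * (∑ y, P x y * f y) ^ 2)} := by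
  refine ⟨1, ?_⟩
  rintro r ⟨f, -, hf, rfl⟩
  refine Real.sqrt_le_iff.2 ⟨zero_le_one, ?_⟩
  rw [one_pow]
  exact (hP.wmean_transOp_sq_le_self f).trans hf

lemma IsStationary.kappa_nonneg (hP : IsStationary h P) : 0 ≤ kappa h P :=
  le_csSup hP.bddAbove_kappa ⟨fun _ => 0, by simp, by simp, by simp⟩

/-- The transition operator contracts centred functions by the factor `κ` in `L²(h)`. -/
lemma IsStationary.wmean_transOp_sq_le (hP : IsStationary h P) {f : S → ℝ} (hf : wmean h f = 0) :
    (wmean h fun x => transOp P f x ^ 2) ≤ kappa h P ^ 2 * wmean h fun x => f x ^ 2 := by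
  have hV0 : 0 ≤ wmean h fun x => f x ^ 2 := hP.isWeight.wmean_nonneg fun _ => sq_nonneg _
  rcases hV0.eq_or_lt with h0 | h0
  · have := hP.wmean_transOp_sq_le_self f
    rw [← h0] at this ⊢
    simpa using this
  · set V := wmean h fun x => f x ^ 2 with hV
    have h1 : Real.sqrt (wmean h fun x => transOp P (fun y => (Real.sqrt V)⁻¹ * f y) x ^ 2) ≤
        kappa h P := by
      refine le_csSup hP.bddAbove_kappa ⟨fun y => (Real.sqrt V)⁻¹ * f y, ?_, ?_, rfl⟩
      · change wmean h (fun y => (Real.sqrt V)⁻¹ * f y) = 0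
        rw [wmean_const_mul, hf, mul_zero]
      · change wmean h (fun y => ((Real.sqrt V)⁻¹ * f y) ^ 2) ≤ 1
        simp only [mul_pow, inv_pow, Real.sq_sqrt hV0]
        rw [wmean_const_mul, inv_mul_cancel₀ h0.ne']
    have h2 : (fun x => transOp P (fun y => (Real.sqrt V)⁻¹ * f y) x ^ 2) =
        fun x => V⁻¹ * transOp P f x ^ 2 := by
      funext x
      have : transOp P (fun y => (Real.sqrt V)⁻¹ * f y) x = (Real.sqrt V)⁻¹ * transOp P f x :=
        wmean_const_mul _ _ _
      rw [this, mul_pow, inv_pow, Real.sq_sqrt hV0]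
    rw [h2, wmean_const_mul] at h1
    have h3 := (Real.sqrt_le_left hP.kappa_nonneg).1 h1
    rwa [inv_mul_le_iff₀ h0, mul_comm] at h3

/-- One step of the chain multiplies the tilted second moment `E_h[exp(s f) b²]` by at most
`1 + O(s²)`: the first-order term vanishes on constants because `f` is centred, and off the
constants it is absorbed by the spectral gap. -/
lemma IsStationary.tilted_step (hP : IsStationary h P) {δ s : ℝ} (hδ0 : 0 < δ) (hδ1 : δ ≤ 1)
    (hκ : kappa h P ^ 2 ≤ 1 - δ) (hs : |s| ≤ δ / 16) {f : S → ℝ} (hf : ∀ x, |f x| ≤ 1)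
    (hf0 : wmean h f = 0) (b : S → ℝ) :
    (wmean h fun x => Real.exp (s * f x) *
        transOp P (fun y => Real.exp (s * f y) * b y) x ^ 2) ≤
      (1 + 24 / δ * s ^ 2) * wmean h fun x => Real.exp (s * f x) * b x ^ 2 := by
  have hw := hP.isWeight
  -- `V = c + g` and `P V = c + g'` with `g`, `g'` centred, and `E_h g'² ≤ (1 - δ) E_h g²`
  set V := fun y => Real.exp (s * f y) * b y with hV
  set c := wmean h V with hc
  set g := fun y => V y - c with hg
  set g' := fun x => transOp P V x - c with hg'
  have hg0 : wmean h g = 0 := by rw [hg, hw.wmean_sub_const, sub_self]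
  have hg'0 : wmean h g' = 0 := by rw [hg', hw.wmean_sub_const, hP.wmean_transOp, sub_self]
  set G := wmean h fun x => g x ^ 2 with hG
  set G' := wmean h fun x => g' x ^ 2 with hG'
  have hG0 : 0 ≤ G := hw.wmean_nonneg fun _ => sq_nonneg _
  have hGG : G' ≤ (1 - δ) * G := by
    have h1 := hP.wmean_transOp_sq_le hg0
    have h2 : (fun x => transOp P g x ^ 2) = fun x => g' x ^ 2 := by
      funext x; rw [hg, hP.transOp_sub_const]
    rw [h2] at h1
    exact h1.trans (mul_le_mul_of_nonneg_right hκ hG0)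
  have hs0 := abs_nonneg s
  have hsf : ∀ x, |s * f x| ≤ |s| := fun x => by
    rw [abs_mul]; exact mul_le_of_le_one_right hs0 (hf x)
  -- the cross term, by the weighted arithmetic-geometric mean inequality
  have hcross : ∀ x u, |2 * c * (s * f x) * u| ≤ 8 / δ * s ^ 2 * c ^ 2 + δ / 8 * u ^ 2 := by
    intro x u
    have h1 : |2 * c * (s * f x) * u| ≤ 2 * |c| * |s| * |u| := by
      rw [abs_mul, abs_mul, abs_mul, abs_two]
      have := hsf x
      gcongr
    refine h1.trans ?_
    have h2 : 8 / δ * s ^ 2 * c ^ 2 = δ / 8 * (8 / δ * (|c| * |s|)) ^ 2 := by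
      rw [← sq_abs s, ← sq_abs c]; field_simp
    have h3 : 2 * |c| * |s| * |u| = δ / 8 * (2 * (8 / δ * (|c| * |s|)) * |u|) := by
      field_simp
    rw [h2, h3, ← mul_add, ← sq_abs u]
    gcongr
    nlinarith [sq_nonneg (8 / δ * (|c| * |s|) - |u|)]
  have hquad : ∀ x u, |s * f x * u ^ 2| ≤ |s| * u ^ 2 := by
    intro x u
    rw [abs_mul, abs_of_nonneg (sq_nonneg u)]
    exact mul_le_mul_of_nonneg_right (hsf x) (sq_nonneg u)
  have hupper : (wmean h fun x => Real.exp (s * f x) * transOp P V x ^ 2) ≤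
      c ^ 2 * (1 + s ^ 2 + 8 / δ * s ^ 2) + G' * (1 + s ^ 2 + |s| + δ / 8) := by
    have h1 : ∀ x, Real.exp (s * f x) * transOp P V x ^ 2 ≤
        (c ^ 2 * (1 + s ^ 2 + 8 / δ * s ^ 2) + (1 + s ^ 2 + |s| + δ / 8) * g' x ^ 2) +
          (c ^ 2 * s * f x + (1 + s ^ 2) * 2 * c * g' x) := by
      intro x
      have e1 : transOp P V x = c + g' x := by simp [hg']
      have e2 : Real.exp (s * f x) ≤ 1 + s * f x + s ^ 2 := by
        have := (abs_le.1 (Real.abs_exp_sub_one_sub_id_le ((hsf x).trans (by linarith)))).2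
        have h3 : (s * f x) ^ 2 ≤ s ^ 2 := by
          rw [← sq_abs (s * f x), ← sq_abs s]
          exact pow_le_pow_left₀ (abs_nonneg _) (hsf x) 2
        linarith
      have e3 := (abs_le.1 (hcross x (g' x))).2
      have e4 := (abs_le.1 (hquad x (g' x))).2
      rw [e1]
      calc _ ≤ (1 + s * f x + s ^ 2) * (c + g' x) ^ 2 := by gcongr
        _ ≤ _ := by linarith
    refine (hw.wmean_mono h1).trans_eq ?_
    rw [wmean_add, wmean_add, wmean_add, hw.wmean_const, wmean_const_mul, wmean_const_mul,
      wmean_const_mul, hf0, hg'0]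
    ring
  have hlower : c ^ 2 * (1 - 8 / δ * s ^ 2) + G * (1 - |s| - δ / 8) ≤
      wmean h fun x => Real.exp (s * f x) * b x ^ 2 := by
    have h1 : ∀ x, (c ^ 2 * (1 - 8 / δ * s ^ 2) + (1 - |s| - δ / 8) * g x ^ 2) +
        ((-(c ^ 2 * s)) * f x + 2 * c * g x) ≤ Real.exp (s * f x) * b x ^ 2 := by
      intro x
      have e1 : V x = c + g x := by simp [hg]
      have e2 : Real.exp (s * f x) * b x ^ 2 = Real.exp (-(s * f x)) * V x ^ 2 := by
        rw [hV, Real.exp_neg]; field_simp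
      have e3 : 1 - s * f x ≤ Real.exp (-(s * f x)) := by
        linarith [Real.add_one_le_exp (-(s * f x))]
      have e4 := (abs_le.1 (hcross x (g x))).2
      have e5 := (abs_le.1 (hquad x (g x))).2
      rw [e2, e1]
      calc _ ≤ (1 - s * f x) * (c + g x) ^ 2 := by linarith
        _ ≤ _ := by gcongr
    refine le_trans (le_of_eq ?_) (hw.wmean_mono h1)
    rw [wmean_add, wmean_add, wmean_add, hw.wmean_const, wmean_const_mul, wmean_const_mul,
      wmean_const_mul, hf0, hg0]
    ring
  refine hupper.trans (le_trans ?_ (mul_le_mul_of_nonneg_left hlower (by positivity)))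
  set X := 8 / δ * s ^ 2 with hX
  have hX0 : 0 ≤ X := by positivity
  have hs2 : s ^ 2 ≤ (δ / 16) ^ 2 := by rw [← sq_abs]; gcongr
  have hX1 : X ≤ 1 / 32 := by
    rw [hX, div_mul_eq_mul_div, div_le_iff₀ hδ0]; nlinarith
  have hsX : s ^ 2 ≤ X / 8 := by
    rw [hX, div_mul_eq_mul_div, div_div, le_div_iff₀ (by positivity)]
    nlinarith [sq_nonneg s]
  have h24 : 24 / δ * s ^ 2 = 3 * X := by rw [hX]; ring
  rw [h24]
  have hc2 := sq_nonneg c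
  have k1 : 1 + s ^ 2 + X ≤ (1 + 3 * X) * (1 - X) := by nlinarith
  have k2 : (1 - δ) * (1 + s ^ 2 + |s| + δ / 8) ≤ 1 - |s| - δ / 8 := by nlinarith
  have k3 : G' * (1 + s ^ 2 + |s| + δ / 8) ≤ G * (1 - |s| - δ / 8) := by
    calc _ ≤ (1 - δ) * G * (1 + s ^ 2 + |s| + δ / 8) := by gcongr
      _ = G * ((1 - δ) * (1 + s ^ 2 + |s| + δ / 8)) := by ring
      _ ≤ _ := by gcongr
  have k4 : 0 ≤ G * (1 - |s| - δ / 8) := mul_nonneg hG0 (by linarith)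
  calc _ ≤ c ^ 2 * ((1 + 3 * X) * (1 - X)) + G * (1 - |s| - δ / 8) := by gcongr
    _ ≤ c ^ 2 * ((1 + 3 * X) * (1 - X)) + (1 + 3 * X) * (G * (1 - |s| - δ / 8)) := by
      have := le_mul_of_one_le_left k4 (by linarith : 1 ≤ 1 + 3 * X)
      linarith
    _ = _ := by ring

/-- The Feynman–Kac iterates `b₀ = 1`, `bₜ₊₁ = P (exp(s f) bₜ)`. -/
noncomputable def feynmanKac (P : S → S → ℝ) (s : ℝ) (f : S → ℝ) : ℕ → S → ℝ
  | 0 => fun _ => 1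
  | t + 1 => transOp P fun y => Real.exp (s * f y) * feynmanKac P s f t y

lemma IsStationary.feynmanKac_le (hP : IsStationary h P) {δ s : ℝ} (hδ0 : 0 < δ) (hδ1 : δ ≤ 1)
    (hκ : kappa h P ^ 2 ≤ 1 - δ) (hs : |s| ≤ δ / 16) {f : S → ℝ} (hf : ∀ x, |f x| ≤ 1)
    (hf0 : wmean h f = 0) (t : ℕ) :
    (wmean h fun x => Real.exp (s * f x) * feynmanKac P s f t x ^ 2) ≤
      Real.exp (24 / δ * s ^ 2 * t + 1) := by
  induction t with
  | zero =>
    refine hP.isWeight.wmean_le fun x => ?_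
    simp only [feynmanKac, one_pow, mul_one, Nat.cast_zero, mul_zero, zero_add]
    refine Real.exp_le_exp.2 ((le_abs_self _).trans ?_)
    rw [abs_mul]
    nlinarith [abs_nonneg s, hf x, abs_nonneg (f x)]
  | succ t ih =>
    refine (hP.tilted_step hδ0 hδ1 hκ hs hf hf0 (feynmanKac P s f t)).trans ?_
    have h1 : 1 + 24 / δ * s ^ 2 ≤ Real.exp (24 / δ * s ^ 2) := by
      linarith [Real.add_one_le_exp (24 / δ * s ^ 2)]
    calc _ ≤ Real.exp (24 / δ * s ^ 2) * Real.exp (24 / δ * s ^ 2 * t + 1) := by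
          gcongr
          exact hP.isWeight.wmean_nonneg fun x => by positivity
      _ = _ := by rw [← Real.exp_add]; push_cast; ring_nf

/-- Change of measure from the initial distribution to the stationary one, by the Cauchy–Schwarz
inequality. -/
lemma sum_mul_sq_le {q h : S → ℝ} (hh : ∀ x, 0 < h x) (b : S → ℝ) :
    (∑ x, q x * b x) ^ 2 ≤ (∑ x, q x ^ 2 / h x) * wmean h fun x => b x ^ 2 := by
  have h1 := Finset.sum_mul_sq_le_sq_mul_sq Finset.univ (fun x => q x / Real.sqrt (h x))
    fun x => Real.sqrt (h x) * b x
  have h2 : ∀ x, q x / Real.sqrt (h x) * (Real.sqrt (h x) * b x) = q x * b x := fun x => by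
    have := (Real.sqrt_pos.2 (hh x)).ne'
    field_simp
  simp only [h2, div_pow, mul_pow, Real.sq_sqrt (hh _).le] at h1
  exact h1

lemma IsStationary.sum_feynmanKac_le (hP : IsStationary h P) {q : S → ℝ} {Q₀ : ℝ}
    (hQ : ∑ x, q x ^ 2 / h x ≤ Q₀) {δ s : ℝ} (hδ0 : 0 < δ) (hδ1 : δ ≤ 1)
    (hκ : kappa h P ^ 2 ≤ 1 - δ) (hs : |s| ≤ δ / 16) {f : S → ℝ} (hf : ∀ x, |f x| ≤ 1)
    (hf0 : wmean h f = 0) (t : ℕ) :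
    ∑ x, q x * (Real.exp (s * f x) * feynmanKac P s f t x) ≤
      Real.sqrt Q₀ * Real.exp (12 / δ * s ^ 2 * t + 1) := by
  have h1 := sum_mul_sq_le (q := q) hP.pos fun x => Real.exp (s * f x) * feynmanKac P s f t x
  have h2 := hP.feynmanKac_le hδ0 hδ1 hκ hs hf hf0 t
  have h3 : (wmean h fun x => (Real.exp (s * f x) * feynmanKac P s f t x) ^ 2) ≤
      Real.exp 1 * wmean h fun x => Real.exp (s * f x) * feynmanKac P s f t x ^ 2 := by
    rw [← wmean_const_mul]
    refine hP.isWeight.wmean_mono fun x => ?_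
    have : Real.exp (s * f x) ≤ Real.exp 1 := by
      refine Real.exp_le_exp.2 ((le_abs_self _).trans ?_)
      rw [abs_mul]
      nlinarith [abs_nonneg s, hf x, abs_nonneg (f x)]
    calc _ = Real.exp (s * f x) * (Real.exp (s * f x) * feynmanKac P s f t x ^ 2) := by ring
      _ ≤ _ := by gcongr
  have hQ0 : 0 ≤ ∑ x, q x ^ 2 / h x :=
    Finset.sum_nonneg fun x _ => div_nonneg (sq_nonneg _) (hP.pos x).le
  refine abs_le_of_sq_le_sq' ?_ (by positivity) |>.2
  calc _ ≤ (∑ x, q x ^ 2 / h x) *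
        wmean h fun x => (Real.exp (s * f x) * feynmanKac P s f t x) ^ 2 := h1
    _ ≤ Q₀ * (Real.exp 1 * Real.exp (24 / δ * s ^ 2 * t + 1)) := by
        refine mul_le_mul hQ (h3.trans (by gcongr)) ?_ (hQ0.trans hQ)
        exact hP.isWeight.wmean_nonneg fun x => sq_nonneg _
    _ = _ := by
        rw [mul_pow, Real.sq_sqrt (hQ0.trans hQ), ← Real.exp_add, ← Real.exp_nat_mul]
        push_cast; ring_nf

/-- Summation over paths, one coordinate at a time. -/
lemma sum_path_eq (P : S → S → ℝ) (s : ℝ) (f : S → ℝ) (t : ℕ) (q : S → ℝ) :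
    ∑ p : Fin (t + 1) → S, q (p 0) * (∏ i : Fin t, P (p i.castSucc) (p i.succ)) *
        ∏ i, Real.exp (s * f (p i)) =
      ∑ x, q x * (Real.exp (s * f x) * feynmanKac P s f t x) := by
  induction t generalizing q with
  | zero =>
    rw [← (Equiv.funUnique (Fin 1) S).symm.sum_comp]
    simp [feynmanKac]
  | succ t ih =>
    rw [← (Fin.consEquiv fun _ => S).sum_comp, Fintype.sum_prod_type]
    have h1 := ih fun y => ∑ x, q x * Real.exp (s * f x) * P x y
    have h2 : ∑ y, (∑ x, q x * Real.exp (s * f x) * P x y) *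
        (Real.exp (s * f y) * feynmanKac P s f t y) =
        ∑ x, q x * (Real.exp (s * f x) * feynmanKac P s f (t + 1) x) := by
      simp only [feynmanKac, transOp, Finset.sum_mul, Finset.mul_sum]
      rw [Finset.sum_comm]
      exact Finset.sum_congr rfl fun x _ => Finset.sum_congr rfl fun y _ => by ring
    rw [← h2, ← h1, Finset.sum_comm]
    refine Finset.sum_congr rfl fun p _ => ?_
    rw [Finset.sum_mul, Finset.sum_mul]
    refine Finset.sum_congr rfl fun x _ => ?_
    simp only [Fin.consEquiv_apply, Fin.prod_univ_succ, Fin.cons_zero, Fin.cons_succ,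
      Fin.castSucc_zero]
    simp only [← Fin.succ_castSucc, Fin.cons_succ]
    ring

end Operator

section Chain

variable {Ω S : Type*} [MeasurableSpace Ω] [MeasurableSpace S] {μ : Measure Ω} {Y : ℕ → Ω → S}
  {h q : S → ℝ} {P : S → S → ℝ}

lemma IsMarkovChain.measureReal_path (hY : IsMarkovChain μ Y q P) (t : ℕ) (p : Fin (t + 1) → S) :
    μ.real ((fun ω (i : Fin (t + 1)) => Y i ω) ⁻¹' {p}) =
      q (p 0) * ∏ i : Fin t, P (p i.castSucc) (p i.succ) := by
  have h1 := hY.law t fun i => if hi : i < t + 1 then p ⟨i, hi⟩ else p 0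
  have h2 : (fun ω (i : Fin (t + 1)) => Y i ω) ⁻¹' {p} =
      {ω | ∀ i ≤ t, Y i ω = if hi : i < t + 1 then p ⟨i, hi⟩ else p 0} := by
    ext ω
    simp only [Set.mem_preimage, Set.mem_singleton_iff, Set.mem_ofPred_eq, funext_iff]
    constructor
    · intro h i hi
      rw [dif_pos (Nat.lt_succ_of_le hi)]
      exact h ⟨i, Nat.lt_succ_of_le hi⟩
    · intro h i
      have := h i (Nat.le_of_lt_succ i.2)
      rwa [dif_pos i.2] at this
  rw [h2, h1, Finset.prod_range]
  congr 1
  refine Finset.prod_congr rfl fun i _ => ?_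
  rw [dif_pos (by omega), dif_pos (by omega)]
  rfl

variable [Fintype S] [MeasurableSingletonClass S] [IsProbabilityMeasure μ]

lemma IsMarkovChain.mgf_sum (hY : IsMarkovChain μ Y q P) (s : ℝ) (f : S → ℝ) (t : ℕ) :
    mgf (fun ω => ∑ i : Fin (t + 1), f (Y i ω)) μ s =
      ∑ x, q x * (Real.exp (s * f x) * feynmanKac P s f t x) := by
  have hm : Measurable fun ω (i : Fin (t + 1)) => Y i ω :=
    measurable_pi_lambda _ fun i => hY.measurable i
  rw [mgf, ← sum_path_eq]
  have h1 : ∫ ω, Real.exp (s * ∑ i : Fin (t + 1), f (Y i ω)) ∂μ =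
      ∫ p : Fin (t + 1) → S, Real.exp (s * ∑ i, f (p i))
        ∂(μ.map fun ω (i : Fin (t + 1)) => Y i ω) := by
    rw [integral_map hm.aemeasurable (measurable_of_finite _).aestronglyMeasurable]
  have : IsProbabilityMeasure (μ.map fun ω (i : Fin (t + 1)) => Y i ω) :=
    Measure.isProbabilityMeasure_map hm.aemeasurable
  rw [h1, integral_fintype .of_finite]
  refine Finset.sum_congr rfl fun p _ => ?_
  rw [map_measureReal_apply hm (measurableSet_singleton p), hY.measureReal_path, Finset.mul_sum,
    Real.exp_sum, smul_eq_mul]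

/-- One-sided exponential inequality for the ergodic averages of a bounded centred function. -/
lemma IsMarkovChain.measureReal_sum_ge_le (hY : IsMarkovChain μ Y q P) (hP : IsStationary h P)
    {Q₀ : ℝ} (hQ : ∑ x, q x ^ 2 / h x ≤ Q₀) {δ : ℝ} (hδ0 : 0 < δ) (hδ1 : δ ≤ 1)
    (hκ : kappa h P ^ 2 ≤ 1 - δ) {f : S → ℝ} (hf : ∀ x, |f x| ≤ 1) (hf0 : wmean h f = 0)
    {m : ℕ} (hm : 0 < m) {u : ℝ} (hu0 : 0 ≤ u) (hu1 : u ≤ 1) :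
    μ.real {ω | u * m ≤ ∑ i : Fin m, f (Y i ω)} ≤
      Real.sqrt Q₀ * Real.exp 1 * Real.exp (-(δ / 48 * (m * u ^ 2))) := by
  obtain ⟨t, rfl⟩ : ∃ t, m = t + 1 := ⟨m - 1, by omega⟩
  -- the minimiser of the exponent `-s u m + 12 s² m / δ` of the Chernoff bound
  set s := u * δ / 24 with hs
  have hs0 : 0 ≤ s := by positivity
  have hmeas : Measurable fun ω => ∑ i : Fin (t + 1), f (Y i ω) :=
    Finset.measurable_fun_sum _ fun i _ => (measurable_of_finite f).comp (hY.measurable i)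
  have hint : Integrable (fun ω => Real.exp (s * ∑ i : Fin (t + 1), f (Y i ω))) μ := by
    refine Integrable.of_bound (hmeas.const_mul s).exp.aestronglyMeasurable (Real.exp (s * (t + 1))) (ae_of_all _ fun ω => ?_)
    rw [Real.norm_eq_abs, Real.abs_exp]
    refine Real.exp_le_exp.2 (mul_le_mul_of_nonneg_left ?_ hs0)
    refine (Finset.sum_le_card_nsmul _ _ 1 fun i _ => (abs_le.1 (hf _)).2).trans_eq ?_
    simp
  refine (measure_ge_le_exp_mul_mgf (u * (t + 1 : ℕ)) hs0 hint).trans ?_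
  rw [hY.mgf_sum]
  have h1 := hP.sum_feynmanKac_le hQ hδ0 hδ1 hκ (s := s)
    (by rw [abs_of_nonneg hs0, hs]; nlinarith) hf hf0 t
  calc _ ≤ Real.exp (-s * (u * (t + 1 : ℕ))) *
        (Real.sqrt Q₀ * Real.exp (12 / δ * s ^ 2 * t + 1)) := by gcongr
    _ = Real.sqrt Q₀ * (Real.exp (-s * (u * (t + 1 : ℕ))) *
        Real.exp (12 / δ * s ^ 2 * t + 1)) := by ring
    _ ≤ Real.sqrt Q₀ * (Real.exp 1 * Real.exp (-(δ / 48 * ((t + 1 : ℕ) * u ^ 2)))) := by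
        refine mul_le_mul_of_nonneg_left ?_ (Real.sqrt_nonneg _)
        rw [← Real.exp_add, ← Real.exp_add]
        refine Real.exp_le_exp.2 ?_
        have e1 : 12 / δ * s ^ 2 * t = δ * u ^ 2 / 48 * t := by rw [hs]; field_simp; ring
        rw [e1, hs]; push_cast
        nlinarith [mul_nonneg hδ0.le (sq_nonneg u)]
    _ = _ := by ring

/-- Exponential inequality for the ergodic averages of a bounded centred function. -/
theorem IsMarkovChain.measureReal_abs_avg_ge_le (hY : IsMarkovChain μ Y q P)
    (hP : IsStationary h P) {Q₀ : ℝ} (hQ : ∑ x, q x ^ 2 / h x ≤ Q₀) {δ : ℝ} (hδ0 : 0 < δ)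
    (hδ1 : δ ≤ 1) (hκ : kappa h P ^ 2 ≤ 1 - δ) {f : S → ℝ} {M : ℝ} (hM : 0 < M)
    (hf : ∀ x, |f x| ≤ M) (hf0 : wmean h f = 0)
    {m : ℕ} (hm : 0 < m) {u : ℝ} (hu0 : 0 ≤ u) (hu1 : u ≤ M) :
    μ.real {ω | u ≤ |1 / (m : ℝ) * ∑ i : Fin m, f (Y i ω)|} ≤
      2 * Real.sqrt Q₀ * Real.exp 1 * Real.exp (-(δ / (48 * M ^ 2) * (m * u ^ 2))) := by
  have hm' : (0 : ℝ) < m := by exact_mod_cast hm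
  have key : ∀ σ : ℝ, |σ| = 1 →
      μ.real {ω | u / M * m ≤ ∑ i : Fin m, σ / M * f (Y i ω)} ≤
      Real.sqrt Q₀ * Real.exp 1 * Real.exp (-(δ / 48 * (m * (u / M) ^ 2))) := by
    intro σ hσ
    refine hY.measureReal_sum_ge_le hP hQ hδ0 hδ1 hκ (f := fun x => σ / M * f x) (fun x => ?_) ?_ hm
      (by positivity) ((div_le_one hM).2 hu1)
    · rw [abs_mul, abs_div, hσ, abs_of_pos hM, div_mul_eq_mul_div, one_mul, div_le_one hM]
      exact hf x
    · rw [wmean_const_mul, hf0, mul_zero]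
  have hsub : {ω | u ≤ |1 / (m : ℝ) * ∑ i : Fin m, f (Y i ω)|} ⊆
      {ω | u / M * m ≤ ∑ i : Fin m, 1 / M * f (Y i ω)} ∪
      {ω | u / M * m ≤ ∑ i : Fin m, (-1) / M * f (Y i ω)} := by
    intro ω hω
    simp only [Set.mem_union, Set.mem_ofPred_eq, ← Finset.mul_sum] at hω ⊢
    have e1 : u / M * m = u * m / M := by ring
    rw [e1, div_mul_eq_mul_div, div_mul_eq_mul_div, div_le_div_iff_of_pos_right hM,
      div_le_div_iff_of_pos_right hM]
    rw [one_div, inv_mul_eq_div, abs_div, abs_of_pos hm', le_div_iff₀ hm'] at hω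
    rcases le_abs.1 hω with h1 | h1
    · left; linarith
    · right; linarith
  refine (measureReal_mono hsub).trans ((measureReal_union_le _ _).trans ?_)
  have h1 := key 1 (by simp)
  have h2 := key (-1) (by simp)
  have e2 : δ / (48 * M ^ 2) * (m * u ^ 2) = δ / 48 * (m * (u / M) ^ 2) := by
    field_simp
  rw [e2]
  linarith

end Chain

/-! ### Independent samples: Hoeffding's inequality and the central limit theorem -/

section IID

variable {Ω S : Type*} [MeasurableSpace Ω] [MeasurableSpace S] [Fintype S]
  [MeasurableSingletonClass S] {μ : Measure Ω} [IsProbabilityMeasure μ] {n : ℕ}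
  {X : Fin n → Ω → S} {p : S → ℝ}

lemma IsIIDSample.integral_map_eq (hX : IsIIDSample μ X p) (i : Fin n) {E : Type*}
    [NormedAddCommGroup E] [NormedSpace ℝ E] [CompleteSpace E] (g : S → E) :
    ∫ x, g x ∂(μ.map (X i)) = ∑ x, p x • g x := by
  have : IsProbabilityMeasure (μ.map (X i)) :=
    Measure.isProbabilityMeasure_map (hX.measurable i).aemeasurable
  rw [integral_fintype .of_finite]
  refine Finset.sum_congr rfl fun x _ => ?_
  rw [map_measureReal_apply (hX.measurable i) (measurableSet_singleton x), ← hX.law i x]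
  rfl

lemma IsIIDSample.integral_eq (hX : IsIIDSample μ X p) (i : Fin n) (g : S → ℝ) :
    ∫ ω, g (X i ω) ∂μ = wmean p g := by
  rw [← integral_map (hX.measurable i).aemeasurable
    (measurable_of_finite g).aestronglyMeasurable, hX.integral_map_eq]
  rfl

/-- **Hoeffding's inequality** for the average of a bounded statistic. -/
lemma IsIIDSample.measureReal_abs_avg_sub_ge_le (hX : IsIIDSample μ X p) {g : S → ℝ} {K : ℝ}
    (hK : 0 < K) (hg : ∀ x, |g x| ≤ K) (hn : 0 < n) {t : ℝ} (ht : 0 ≤ t) :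
    μ.real {ω | t ≤ |1 / (n : ℝ) * ∑ i, g (X i ω) - wmean p g|} ≤
      2 * Real.exp (-(n * t ^ 2 / (2 * K ^ 2))) := by
  have hn' : (0 : ℝ) < n := by exact_mod_cast hn
  have key : ∀ σ : ℝ, |σ| = 1 →
      μ.real {ω | n * t ≤ ∑ i, σ * (g (X i ω) - wmean p g)} ≤
        Real.exp (-(n * t ^ 2 / (2 * K ^ 2))) := by
    intro σ hσ
    have hind : iIndepFun (fun i ω => σ * (g (X i ω) - wmean p g)) μ :=
      hX.indep.comp (fun _ x => σ * (g x - wmean p g)) fun _ => measurable_of_finite _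
    have hsub : ∀ i ∈ (Finset.univ : Finset (Fin n)),
        HasSubgaussianMGF (fun ω => σ * (g (X i ω) - wmean p g)) ((‖K - -K‖₊ / 2) ^ 2) μ := by
      intro i _
      have hm : Measurable fun ω => σ * g (X i ω) :=
        ((measurable_of_finite g).comp (hX.measurable i)).const_mul σ
      have h1 := hasSubgaussianMGF_of_mem_Icc (μ := μ) (X := fun ω => σ * g (X i ω)) (a := -K)
        (b := K) hm.aemeasurable (ae_of_all _ fun ω => by
          rw [Set.mem_Icc, ← abs_le, abs_mul, hσ, one_mul]; exact hg _)
      rw [integral_const_mul, hX.integral_eq] at h1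
      simpa only [mul_sub] using h1
    have h2 := HasSubgaussianMGF.measure_sum_ge_le_of_iIndepFun hind hsub
      (ε := n * t) (by positivity)
    refine h2.trans_eq ?_
    congr 1
    have e1 : ((‖K - -K‖₊ / 2 : NNReal) : ℝ) = K := by
      simp only [NNReal.coe_div, coe_nnnorm, Real.norm_eq_abs, NNReal.coe_ofNat]
      rw [abs_of_pos (by linarith)]; ring
    simp only [Finset.sum_const, Finset.card_univ, Fintype.card_fin, nsmul_eq_mul,
      NNReal.coe_pow, e1, NNReal.coe_mul, NNReal.coe_natCast]
    field_simp
  have hsub : {ω | t ≤ |1 / (n : ℝ) * ∑ i, g (X i ω) - wmean p g|} ⊆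
      {ω | n * t ≤ ∑ i, 1 * (g (X i ω) - wmean p g)} ∪
      {ω | n * t ≤ ∑ i, (-1) * (g (X i ω) - wmean p g)} := by
    intro ω hω
    simp only [Set.mem_union, Set.mem_ofPred_eq, ← Finset.mul_sum, Finset.sum_sub_distrib,
      Finset.sum_const, Finset.card_univ, Fintype.card_fin, nsmul_eq_mul] at hω ⊢
    have e1 : 1 / (n : ℝ) * ∑ i, g (X i ω) - wmean p g =
        (∑ i, g (X i ω) - n * wmean p g) / n := by field_simp
    rw [e1, abs_div, abs_of_pos hn', le_div_iff₀ hn'] at hω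
    rcases le_abs.1 hω with h1 | h1
    · left; linarith
    · right; linarith
  refine (measureReal_mono hsub).trans ((measureReal_union_le _ _).trans ?_)
  have h1 := key 1 (by simp)
  have h2 := key (-1) (by simp)
  linarith

lemma IsIIDSample.charFun_sum (hX : IsIIDSample μ X p) (g : S → ℝ) (c t : ℝ) :
    charFun (μ.map fun ω => c * ∑ i, g (X i ω)) t =
      (∑ x, p x • Complex.exp ((c * t * g x : ℝ) * Complex.I)) ^ n := by
  have hm : ∀ i, Measurable fun ω => g (X i ω) := fun i =>
    (measurable_of_finite g).comp (hX.measurable i)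
  have hind : iIndepFun (fun i ω => g (X i ω)) μ :=
    hX.indep.comp (fun _ x => g x) fun _ => measurable_of_finite _
  rw [charFun_map_mul_comp (Finset.measurable_fun_sum _ fun i _ => hm i).aemeasurable,
    hind.charFun_map_fun_sum_eq_prod fun i => (hm i).aemeasurable, Finset.prod_apply]
  have key : ∀ i, charFun (μ.map fun ω => g (X i ω)) (c * t) =
      ∑ x, p x • Complex.exp ((c * t * g x : ℝ) * Complex.I) := by
    intro i
    have h1 : (μ.map fun ω => g (X i ω)) = (μ.map (X i)).map g :=
      (Measure.map_map (measurable_of_finite g) (hX.measurable i)).symm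
    rw [charFun_apply_real, h1,
      integral_map (measurable_of_finite g).aemeasurable (by fun_prop), hX.integral_map_eq]
    refine Finset.sum_congr rfl fun x _ => ?_
    push_cast; rfl
  simp [key]

end IID

section CLT

/-- Second-order expansion of the characteristic function of a bounded standardised variable. -/
lemma norm_charFun_sub_le {S : Type*} [Fintype S] {p g : S → ℝ} (hp : IsWeight p) {M u : ℝ}
    (hg : ∀ x, |g x| ≤ M) (h0 : wmean p g = 0) (h1 : wmean p (fun x => g x ^ 2) = 1)
    (hu : |u| * M ≤ 1) :
    ‖(∑ x, p x • Complex.exp ((u * g x : ℝ) * Complex.I)) - (1 - (u ^ 2 / 2 : ℝ))‖ ≤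
      (|u| * M) ^ 3 := by
  have e1 : ((1 : ℂ) - (u ^ 2 / 2 : ℝ)) =
      ∑ x, p x • (1 + (u * g x : ℝ) * Complex.I - ((u * g x) ^ 2 / 2 : ℝ)) := by
    have h2 : ∀ x, p x • ((1 : ℂ) + (u * g x : ℝ) * Complex.I - ((u * g x) ^ 2 / 2 : ℝ)) =
        (p x : ℂ) + u * Complex.I * ((p x * g x : ℝ) : ℂ)
          - u ^ 2 / 2 * ((p x * g x ^ 2 : ℝ) : ℂ) := by
      intro x
      rw [Complex.real_smul]; push_cast; ring
    simp only [h2, Finset.sum_sub_distrib, Finset.sum_add_distrib, ← Finset.mul_sum,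
      ← Complex.ofReal_sum]
    rw [hp.sum_one]
    change _ = ((1 : ℝ) : ℂ) + u * Complex.I * ((wmean p g : ℝ) : ℂ) - u ^ 2 / 2 *
      ((wmean p fun x => g x ^ 2 : ℝ) : ℂ)
    rw [h0, h1]; push_cast; ring
  rw [e1, ← Finset.sum_sub_distrib]
  refine (norm_sum_le _ _).trans ?_
  have h3 : ∀ x, ‖p x • Complex.exp ((u * g x : ℝ) * Complex.I) -
      p x • (1 + (u * g x : ℝ) * Complex.I - ((u * g x) ^ 2 / 2 : ℝ))‖ ≤
        p x * (|u| * M) ^ 3 := by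
    intro x
    have hz : ‖((u * g x : ℝ) : ℂ) * Complex.I‖ ≤ |u| * M := by
      rw [norm_mul, Complex.norm_I, mul_one, Complex.norm_real, Real.norm_eq_abs, abs_mul]
      exact mul_le_mul_of_nonneg_left (hg x) (abs_nonneg u)
    have h4 := Complex.exp_bound (hz.trans hu) (n := 3) (by norm_num)
    have h5 : ∑ m ∈ Finset.range 3, (((u * g x : ℝ) : ℂ) * Complex.I) ^ m / m.factorial =
        1 + (u * g x : ℝ) * Complex.I - ((u * g x) ^ 2 / 2 : ℝ) := by
      simp [Finset.sum_range_succ, Nat.factorial, mul_pow]; ring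
    rw [h5] at h4
    rw [← smul_sub, norm_smul, Real.norm_eq_abs, abs_of_nonneg (hp.nonneg x)]
    refine mul_le_mul_of_nonneg_left (h4.trans ?_) (hp.nonneg x)
    have h6 : ((Nat.succ 3 : ℕ) : ℝ) * ((Nat.factorial 3 : ℕ) * (3 : ℕ) : ℝ)⁻¹ ≤ 1 := by
      norm_num [Nat.factorial]
    have h7 : 0 ≤ |u| * M := (norm_nonneg _).trans hz
    calc _ ≤ (|u| * M) ^ 3 * 1 := by gcongr
      _ = _ := mul_one _
  refine (Finset.sum_le_sum fun x _ => h3 x).trans_eq ?_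
  rw [← Finset.sum_mul, hp.sum_one, one_mul]

variable {Ω S : ℕ → Type*} [∀ n, MeasurableSpace (Ω n)] [∀ n, MeasurableSpace (S n)]
  [∀ n, Fintype (S n)] [∀ n, MeasurableSingletonClass (S n)] {μ : ∀ n, Measure (Ω n)}
  [∀ n, IsProbabilityMeasure (μ n)]

/-- **Central limit theorem** for row-wise independent arrays of uniformly bounded, standardised
statistics. -/
theorem tendstoInDistribution_sum_of_isIIDSample {X : ∀ n, Fin n → Ω n → S n} {p : ∀ n, S n → ℝ}
    (hX : ∀ n, IsIIDSample (μ n) (X n) (p n)) (hp : ∀ n, IsWeight (p n)) {g : ∀ n, S n → ℝ} {M : ℝ}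
    (hg : ∀ n x, |g n x| ≤ M) (h0 : ∀ n, wmean (p n) (g n) = 0)
    (h1 : ∀ n, wmean (p n) (fun x => g n x ^ 2) = 1) :
    TendstoInDistribution (fun (n : ℕ) ω => (√n)⁻¹ * ∑ i, g n (X n i ω)) atTop
      (id : ℝ → ℝ) μ (gaussianReal 0 1) where
  forall_aemeasurable n := (Measurable.const_mul (Finset.measurable_fun_sum _ fun i _ =>
    (measurable_of_finite (g n)).comp ((hX n).measurable i)) _).aemeasurable
  tendsto := by
    refine ProbabilityMeasure.tendsto_iff_tendsto_charFun.2 fun t => ?_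
    simp only [ProbabilityMeasure.coe_mk, Measure.map_id, charFun_gaussianReal]
    simp only [(hX _).charFun_sum]
    set ψ : ℕ → ℂ := fun n =>
      ∑ x, p n x • Complex.exp (((√n)⁻¹ * t * g n x : ℝ) * Complex.I) with hψ
    have hM : 0 ≤ M := by
      by_contra! hneg
      have := h1 0
      rw [wmean, Finset.sum_eq_zero] at this
      · exact zero_ne_one this
      · intro x _
        linarith [abs_nonneg (g 0 x), hg 0 x]
    -- this limit gives `(ψ n) ^ n → exp (-t² / 2)`
    have hlim : Tendsto (fun n : ℕ => (n : ℂ) * (ψ n - 1)) atTop (𝓝 (-(t ^ 2 / 2 : ℝ) : ℂ)) := by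
      rw [tendsto_iff_norm_sub_tendsto_zero]
      have hsq : Tendsto (fun n : ℕ => (√(n : ℝ))⁻¹) atTop (𝓝 0) :=
        tendsto_inv_atTop_zero.comp (Real.tendsto_sqrt_atTop.comp tendsto_natCast_atTop_atTop)
      have hb : Tendsto (fun n : ℕ => (|t| * M) ^ 3 * (√(n : ℝ))⁻¹) atTop (𝓝 0) := by
        simpa using hsq.const_mul ((|t| * M) ^ 3)
      have hsmall : ∀ᶠ n : ℕ in atTop, (√(n : ℝ))⁻¹ * (|t| * M) ≤ 1 := by
        have := hsq.mul_const (|t| * M)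
        rw [zero_mul] at this
        exact this.eventually (ge_mem_nhds one_pos)
      refine squeeze_zero' (Eventually.of_forall fun _ => norm_nonneg _) ?_ hb
      filter_upwards [hsmall, eventually_gt_atTop 0] with n hn hn0
      have hn' : (0 : ℝ) < n := by exact_mod_cast hn0
      have hs0 : 0 < √(n : ℝ) := Real.sqrt_pos.2 hn'
      have habs : |(√(n : ℝ))⁻¹ * t| * M = (√(n : ℝ))⁻¹ * (|t| * M) := by
        rw [abs_mul, abs_of_pos (inv_pos.2 hs0), mul_assoc]
      have h2 := norm_charFun_sub_le (hp n) (u := (√(n : ℝ))⁻¹ * t) (hg n) (h0 n) (h1 n)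
        (by rw [habs]; exact hn)
      rw [habs] at h2
      have hsqn : (√(n : ℝ)) ^ 2 = n := Real.sq_sqrt hn'.le
      have e1 : (n : ℂ) * (ψ n - 1) - (-(t ^ 2 / 2 : ℝ) : ℂ) =
          (n : ℂ) * (ψ n - (1 - ((((√(n : ℝ))⁻¹ * t) ^ 2 / 2 : ℝ) : ℂ))) := by
        have e2 : (((√(n : ℝ))⁻¹ * t) ^ 2 / 2 : ℝ) = t ^ 2 / 2 / n := by
          rw [mul_pow, inv_pow, hsqn]; field_simp
        rw [e2]
        have : (n : ℂ) ≠ 0 := by exact_mod_cast hn0.ne'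
        push_cast
        field_simp
        ring
      rw [e1, norm_mul, Complex.norm_natCast]
      calc (n : ℝ) * _ ≤ n * ((√(n : ℝ))⁻¹ * (|t| * M)) ^ 3 := by gcongr
        _ = (√(n : ℝ)) ^ 2 * ((√(n : ℝ))⁻¹ * (|t| * M)) ^ 3 := by rw [hsqn]
        _ = _ := by field_simp
    have h3 := Complex.tendsto_one_add_pow_exp_of_tendsto hlim
    simp only [add_sub_cancel] at h3
    convert h3 using 2
    congr 1
    push_cast; ring

end CLT

/-! ### Convergence in probability and in distribution along an array -/

section Slutsky

variable {Ω : ℕ → Type*} [∀ n, MeasurableSpace (Ω n)] {μ : ∀ n, Measure (Ω n)}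

/-- `Z n → 0` in probability, for variables that may live on different probability spaces. -/
def TendstoZeroInProb (μ : ∀ n, Measure (Ω n)) (Z : ∀ n, Ω n → ℝ) : Prop :=
  ∀ ε > 0, Tendsto (fun n => (μ n).real {ω | ε ≤ |Z n ω|}) atTop (𝓝 0)

variable [∀ n, IsProbabilityMeasure (μ n)]

/-- **Slutsky's lemma** for variables on varying probability spaces. -/
theorem tendstoInDistribution_of_sub {X Y : ∀ n, Ω n → ℝ} {Z : ℝ → ℝ} {ν : Measure ℝ}
    [IsProbabilityMeasure ν] (hX : TendstoInDistribution X atTop Z μ ν)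
    (hXm : ∀ n, Measurable (X n)) (hYm : ∀ n, Measurable (Y n))
    (h : TendstoZeroInProb μ fun n ω => Y n ω - X n ω) :
    TendstoInDistribution Y atTop Z μ ν where
  forall_aemeasurable n := (hYm n).aemeasurable
  aemeasurable_limit := hX.aemeasurable_limit
  tendsto := by
    refine ProbabilityMeasure.tendsto_iff_tendsto_charFun.2 fun t => ?_
    have hXt := ProbabilityMeasure.tendsto_iff_tendsto_charFun.1 hX.tendsto t
    simp only [ProbabilityMeasure.coe_mk] at hXt ⊢
    rw [tendsto_iff_norm_sub_tendsto_zero] at hXt ⊢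
    have hdiff : Tendsto (fun n => ‖charFun ((μ n).map (Y n)) t - charFun ((μ n).map (X n)) t‖)
        atTop (𝓝 0) := by
      -- split according to whether the difference of the variables exceeds `ε`
      have hbound : ∀ ε > 0, ∀ n, ‖charFun ((μ n).map (Y n)) t - charFun ((μ n).map (X n)) t‖ ≤
          |t| * ε + 2 * (μ n).real {ω | ε ≤ |Y n ω - X n ω|} := by
        intro ε hε n
        set s := {ω | ε ≤ |Y n ω - X n ω|} with hs
        have hsm : MeasurableSet s :=
          measurableSet_le measurable_const ((hYm n).sub (hXm n)).abs
        have hmY : Measurable fun ω => Complex.exp (t * Y n ω * Complex.I) := by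
          have := hYm n; fun_prop
        have hmX : Measurable fun ω => Complex.exp (t * X n ω * Complex.I) := by
          have := hXm n; fun_prop
        have hnorm : ∀ a : ℝ, ‖Complex.exp (t * a * Complex.I)‖ = 1 := fun a => by
          have := Complex.norm_exp_ofReal_mul_I (t * a); push_cast at this; exact this
        have hiY : Integrable (fun ω => Complex.exp (t * Y n ω * Complex.I)) (μ n) :=
          Integrable.of_bound hmY.aestronglyMeasurable 1 (ae_of_all _ fun ω => (hnorm _).le)
        have hiX : Integrable (fun ω => Complex.exp (t * X n ω * Complex.I)) (μ n) :=
          Integrable.of_bound hmX.aestronglyMeasurable 1 (ae_of_all _ fun ω => (hnorm _).le)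
        rw [charFun_apply_real, charFun_apply_real,
          integral_map (hYm n).aemeasurable (by fun_prop),
          integral_map (hXm n).aemeasurable (by fun_prop), ← integral_sub hiY hiX]
        have hpt : ∀ ω, ‖Complex.exp (t * Y n ω * Complex.I) - Complex.exp (t * X n ω * Complex.I)‖
            ≤ |t| * ε + s.indicator (fun _ => 2) ω := by
          intro ω
          by_cases hω : ω ∈ s
          · rw [Set.indicator_of_mem hω]
            refine (norm_sub_le _ _).trans ?_
            rw [hnorm, hnorm]
            have : 0 ≤ |t| * ε := by positivity
            linarith
          · rw [Set.indicator_of_notMem hω, add_zero]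
            have h1 : Complex.exp (t * Y n ω * Complex.I) - Complex.exp (t * X n ω * Complex.I) =
                Complex.exp (t * X n ω * Complex.I) *
                  (Complex.exp (Complex.I * ((t * (Y n ω - X n ω) : ℝ) : ℂ)) - 1) := by
              rw [mul_sub, mul_one, ← Complex.exp_add]
              congr 2; push_cast; ring
            rw [h1, norm_mul, hnorm, one_mul]
            refine Real.norm_exp_I_mul_ofReal_sub_one_le.trans ?_
            rw [Real.norm_eq_abs, abs_mul]
            have : |Y n ω - X n ω| < ε := by simpa [hs] using hω
            gcongr
        refine (norm_integral_le_integral_norm _).trans ?_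
        have hind : Integrable (s.indicator fun _ => (2 : ℝ)) (μ n) :=
          (integrable_const _).indicator hsm
        refine (integral_mono (hiY.sub hiX).norm ((integrable_const _).add hind) hpt).trans_eq ?_
        have h2 := integral_add (integrable_const (μ := μ n) (|t| * ε)) hind
        refine h2.trans ?_
        rw [integral_indicator_const _ hsm]
        simp [mul_comm]
      rw [Metric.tendsto_atTop]
      intro η hη
      have hε : 0 < η / (2 * (|t| + 1)) := by positivity
      obtain ⟨N, hN⟩ := (Metric.tendsto_atTop.1 (h _ hε)) (η / 4) (by positivity)
      refine ⟨N, fun n hn => ?_⟩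
      have h1 := hN n hn
      rw [Real.dist_eq, sub_zero, abs_of_nonneg measureReal_nonneg] at h1
      rw [Real.dist_eq, sub_zero, abs_of_nonneg (norm_nonneg _)]
      refine (hbound _ hε n).trans_lt ?_
      have h2 : |t| * (η / (2 * (|t| + 1))) ≤ η / 2 := by
        rw [← mul_div_assoc, div_le_iff₀ (by positivity)]
        nlinarith [abs_nonneg t]
      linarith
    have hsum := hdiff.add hXt
    rw [add_zero] at hsum
    refine squeeze_zero (fun _ => norm_nonneg _) (fun n => ?_) hsum
    exact norm_sub_le_norm_sub_add_norm_sub _ _ _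

/-- A perturbation of a tight sequence that is small relative to it, on events of probability
tending to one, converges to zero in probability. -/
lemma tendstoZeroInProb_of_relative {T G e : ∀ n, Ω n → ℝ} {bad : ∀ n, Set (Ω n)} {d : ℕ → ℝ}
    (hG : ∀ ε > 0, ∃ R, 0 < R ∧ ∀ᶠ n in atTop, (μ n).real {ω | R ≤ |G n ω|} ≤ ε)
    (he : TendstoZeroInProb μ e) (hbad : Tendsto (fun n => (μ n).real (bad n)) atTop (𝓝 0))
    (hd : Tendsto d atTop (𝓝 0))
    (hle : ∀ᶠ n in atTop, ∀ ω ∉ bad n, |T n ω| ≤ d n * (|G n ω| + 1) + 2 * |e n ω|) :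
    TendstoZeroInProb μ T := by
  intro ε hε
  rw [Metric.tendsto_atTop]
  intro η hη
  obtain ⟨R, hR, hGR⟩ := hG (η / 4) (by positivity)
  have hdR : ∀ᶠ n in atTop, d n * (R + 1) < ε / 2 := by
    have := hd.mul_const (R + 1)
    rw [zero_mul] at this
    exact this.eventually (gt_mem_nhds (by positivity))
  have h1 := (he (ε / 4) (by positivity)).eventually (gt_mem_nhds (by positivity : 0 < η / 4))
  have h2 := hbad.eventually (gt_mem_nhds (by positivity : 0 < η / 4))
  obtain ⟨N, hN⟩ := eventually_atTop.1 (((hGR.and hdR).and (h1.and h2)).and hle)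
  refine ⟨N, fun n hn => ?_⟩
  obtain ⟨⟨⟨a1, a2⟩, a3, a4⟩, a5⟩ := hN n hn
  rw [Real.dist_eq, sub_zero, abs_of_nonneg measureReal_nonneg]
  have hsub : {ω | ε ≤ |T n ω|} ⊆
      bad n ∪ ({ω | ε / 4 ≤ |e n ω|} ∪ {ω | R ≤ |G n ω|}) := by
    intro ω hω
    by_contra hcon
    simp only [Set.mem_union, Set.mem_ofPred_eq, not_or, not_le] at hcon hω
    obtain ⟨c1, c2, c3⟩ := hcon
    have c4 := a5 ω c1
    have c5 : d n * (|G n ω| + 1) ≤ ε / 2 := by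
      rcases le_or_gt (d n) 0 with hd0 | hd0
      · have := mul_nonpos_of_nonpos_of_nonneg hd0 (by positivity : 0 ≤ |G n ω| + 1)
        linarith
      · have : d n * (|G n ω| + 1) ≤ d n * (R + 1) := by gcongr
        linarith
    linarith
  have := measureReal_mono (μ := μ n) hsub
  have := measureReal_union_le (μ := μ n) (bad n) ({ω | ε / 4 ≤ |e n ω|} ∪ {ω | R ≤ |G n ω|})
  have := measureReal_union_le (μ := μ n) {ω | ε / 4 ≤ |e n ω|} {ω | R ≤ |G n ω|}
  linarith

/-- Rescaling by deterministic factors that stay in a compact interval: the rescaled laws merge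
with the rescaled limit. -/
theorem tendsto_integral_mul_sub {T : ∀ n, Ω n → ℝ} {ν : Measure ℝ} [IsProbabilityMeasure ν]
    (hT : TendstoInDistribution T atTop (id : ℝ → ℝ) μ ν) {c : ℕ → ℝ} {a b : ℝ}
    (hc : ∀ n, c n ∈ Set.Icc a b) (f : BoundedContinuousFunction ℝ ℝ) :
    Tendsto (fun n => (∫ ω, f (c n * T n ω) ∂(μ n)) - ∫ z, f (c n * z) ∂ν) atTop (𝓝 0) := by
  -- `Φ (ρ, r) = ∫ f (r z) dρ(z)` is jointly continuous, as a functional of the product of `ρ` with a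
  -- point mass, so that convergence of the laws is uniform over `r` in a compact interval
  let F : BoundedContinuousFunction (ℝ × ℝ) ℝ :=
    f.compContinuous ⟨fun z => z.2 * z.1, by fun_prop⟩
  let Φ : ProbabilityMeasure ℝ × ℝ → ℝ := fun z =>
    ∫ w, F w ∂((z.1.prod (diracProba z.2) : ProbabilityMeasure (ℝ × ℝ)) : Measure (ℝ × ℝ))
  have hΦ : Continuous Φ := by
    have h1 : Continuous fun z : ProbabilityMeasure ℝ × ℝ => z.1.prod (diracProba z.2) :=
      ProbabilityMeasure.continuous_prod.comp
        (continuous_fst.prodMk (continuous_diracProba.comp continuous_snd))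
    exact (continuous_iff_continuousAt.2 fun ρ =>
      (ProbabilityMeasure.tendsto_iff_forall_integral_tendsto.1 tendsto_id F)).comp h1
  have hΦeq : ∀ (ρ : ProbabilityMeasure ℝ) (r : ℝ), Φ (ρ, r) = ∫ z, f (r * z) ∂(ρ : Measure ℝ) := by
    intro ρ r
    change ∫ w, F w ∂((ρ : Measure ℝ).prod (Measure.dirac r)) = _
    rw [integral_prod _ (F.integrable _)]
    refine integral_congr_ae (ae_of_all _ fun z => ?_)
    simp [F]
  set γ : ProbabilityMeasure ℝ := ⟨ν, inferInstance⟩ with hγ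
  set law : ℕ → ProbabilityMeasure ℝ := fun n =>
    ⟨(μ n).map (T n), Measure.isProbabilityMeasure_map (hT.forall_aemeasurable n)⟩ with hlaw
  have hlim : Tendsto law atTop (𝓝 γ) := by
    have := hT.tendsto
    simpa only [Measure.map_id] using this
  have hconv : ∀ ε > 0, ∀ᶠ ρ in 𝓝 γ, ∀ r ∈ Set.Icc a b, |Φ (ρ, r) - Φ (γ, r)| < ε := by
    intro ε hε
    refine isCompact_Icc.eventually_forall_of_forall_eventually fun r _ => ?_
    have hcont : Continuous fun z : ProbabilityMeasure ℝ × ℝ => |Φ (z.1, z.2) - Φ (γ, z.2)| := by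
      fun_prop
    have := hcont.tendsto (γ, r)
    simp only [sub_self, abs_zero] at this
    exact this.eventually (gt_mem_nhds hε)
  rw [Metric.tendsto_nhds]
  intro ε hε
  filter_upwards [hlim.eventually (hconv ε hε)] with n hn
  have h1 := hn (c n) (hc n)
  rw [hΦeq, hΦeq] at h1
  rw [Real.dist_eq, sub_zero]
  have h2 : ∫ z, f (c n * z) ∂(law n : Measure ℝ) = ∫ ω, f (c n * T n ω) ∂(μ n) := by
    change ∫ z, f (c n * z) ∂((μ n).map (T n)) = _
    rw [integral_map (hT.forall_aemeasurable n)]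
    exact (f.continuous.comp (continuous_const_mul (c n))).aestronglyMeasurable
  rwa [h2] at h1

/-- The central interval between symmetric normal quantiles has the nominal probability. -/
lemma gaussianReal_Icc_quantile {η z : ℝ} (hη : η ∈ Set.Ioo (0 : ℝ) 1)
    (hz : cdf (gaussianReal 0 1) z = 1 - η / 2) :
    (gaussianReal 0 1).real (Set.Icc (-z) z) = 1 - η := by
  set γ := gaussianReal 0 1 with hγ
  have : NullSingletonClass γ := nullSingletonClass_gaussianReal one_ne_zero
  have hsymm : ∀ x, γ.real (Set.Iio (-x)) = γ.real (Set.Ioi x) := by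
    intro x
    have h1 : γ.map (fun y => -y) = γ := by rw [hγ, gaussianReal_map_neg, neg_zero]
    have h2 : γ.real (Set.Iio (-x)) = (γ.map fun y => -y).real (Set.Iio (-x)) := by rw [h1]
    rw [h2, map_measureReal_apply measurable_neg measurableSet_Iio]
    congr 1; ext y; simp
  have hIic : γ.real (Set.Iic z) = 1 - η / 2 := by rw [← hz, cdf_eq_real]
  have hIoi : γ.real (Set.Ioi z) = η / 2 := by
    rw [← Set.compl_Iic, probReal_compl_eq_one_sub measurableSet_Iic, hIic]; ring
  have hIio := (hsymm z).trans hIoi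
  have hz0 : 0 ≤ z := by
    by_contra! hneg
    have h1 : γ.real (Set.Iic z) ≤ γ.real (Set.Iio (-z)) :=
      measureReal_mono fun y hy => by simp only [Set.mem_Iic, Set.mem_Iio] at *; linarith
    rw [hIic, hIio] at h1
    linarith [hη.2]
  have hcompl : (Set.Icc (-z) z)ᶜ = Set.Iio (-z) ∪ Set.Ioi z := by
    ext y
    simp only [Set.mem_compl_iff, Set.mem_Icc, not_and_or, not_le, Set.mem_union, Set.mem_Iio,
      Set.mem_Ioi]
  have hdisj : Disjoint (Set.Iio (-z)) (Set.Ioi z) :=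
    Set.disjoint_left.2 fun y h1 h2 => by simp only [Set.mem_Iio, Set.mem_Ioi] at *; linarith
  have h1 := probReal_compl_eq_one_sub (μ := γ) (measurableSet_Icc (a := -z) (b := z))
  rw [hcompl, measureReal_union hdisj measurableSet_Ioi, hIio, hIoi] at h1
  linarith

/-- Coverage of the interval obtained by inverting an asymptotically standard normal pivot. -/
theorem tendsto_coverage {W : ∀ n, Ω n → ℝ}
    (hW : TendstoInDistribution W atTop (id : ℝ → ℝ) μ (gaussianReal 0 1))
    {η z : ℝ} (hη : η ∈ Set.Ioo (0 : ℝ) 1) (hz : cdf (gaussianReal 0 1) z = 1 - η / 2) :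
    Tendsto (fun n => (μ n).real {ω | |W n ω| ≤ z}) atTop (𝓝 (1 - η)) := by
  have : NullSingletonClass (gaussianReal 0 1) := nullSingletonClass_gaussianReal one_ne_zero
  have h0 : gaussianReal 0 1 (frontier (Set.Icc (-z) z)) = 0 := by
    refine measure_mono_null ?_ ((Set.toFinite {-z, z}).measure_zero _)
    rcases le_or_gt (-z) z with h | h
    · rw [frontier_Icc h]
    · simp [Set.Icc_eq_empty_of_lt h]
  have h1 := ProbabilityMeasure.tendsto_measure_of_null_frontier_of_tendsto' hW.tendsto
    (E := Set.Icc (-z) z) (by simpa only [ProbabilityMeasure.coe_mk, Measure.map_id] using h0)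
  simp only [ProbabilityMeasure.coe_mk, Measure.map_id] at h1
  have h2 := (ENNReal.tendsto_toReal (measure_ne_top _ _)).comp h1
  have h3 : ((gaussianReal 0 1) (Set.Icc (-z) z)).toReal = 1 - η := gaussianReal_Icc_quantile hη hz
  rw [h3] at h2
  refine h2.congr fun n => ?_
  have h4 : {ω | |W n ω| ≤ z} = W n ⁻¹' Set.Icc (-z) z := by
    ext ω; simp [abs_le]
  rw [h4, Function.comp_apply, Measure.map_apply_of_aemeasurable (hW.forall_aemeasurable n)
    measurableSet_Icc]
  rfl

end Slutsky

/-! ### The information matrix of the model -/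

section Model

variable {S ι : Type*} [Fintype S] [Fintype ι]

lemma partitionFn_pos [Nonempty S] (φ : S → ι → ℝ) (θ : ι → ℝ) : 0 < partitionFn φ θ :=
  Finset.sum_pos (fun _ _ => Real.exp_pos _) Finset.univ_nonempty

lemma isWeight_pmass [Nonempty S] (φ : S → ι → ℝ) (θ : ι → ℝ) : IsWeight (pmass φ θ) where
  nonneg _ := div_nonneg (Real.exp_pos _).le (partitionFn_pos φ θ).le
  sum_one := by
    simp only [pmass, ← Finset.sum_div]
    exact div_self (partitionFn_pos φ θ).ne'

lemma covStat_eq_wcovMatrix (φ : S → ι → ℝ) (θ : ι → ℝ) :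
    covStat φ θ = wcovMatrix (pmass φ θ) φ := rfl

lemma dotProduct_covStat_mulVec (φ : S → ι → ℝ) (θ u v : ι → ℝ) :
    u ⬝ᵥ covStat φ θ *ᵥ v = wcov (pmass φ θ) (fun s => u ⬝ᵥ φ s) fun s => v ⬝ᵥ φ s :=
  (wcov_dot _ _ _ _).symm

/-- A lower bound on the eigenvalues of a symmetric matrix bounds its quadratic form below. -/
lemma mul_sum_sq_le_of_spectrum [DecidableEq ι] {H : Matrix ι ι ℝ} (hH : H.IsSymm) {a b : ℝ}
    (h : spectrum ℝ H ⊆ Set.Icc a b) (u : ι → ℝ) : a * ∑ j, u j ^ 2 ≤ u ⬝ᵥ H *ᵥ u := by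
  have hps : (H - algebraMap ℝ (Matrix ι ι ℝ) a).PosSemidef := by
    rw [Matrix.posSemidef_iff_isHermitian_and_spectrum_nonneg]
    refine ⟨?_, ?_⟩
    · refine Matrix.IsHermitian.sub ?_ ?_
      · rw [Matrix.IsHermitian, Matrix.conjTranspose_eq_transpose_of_trivial, hH.eq]
      · rw [Matrix.IsHermitian, Matrix.conjTranspose_eq_transpose_of_trivial,
          Matrix.algebraMap_eq_diagonal, Matrix.diagonal_transpose]
    · rw [← spectrum.sub_singleton_eq]
      rintro _ ⟨c, hc, _, rfl, rfl⟩
      exact sub_nonneg.2 (h hc).1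
  have h1 := hps.dotProduct_mulVec_nonneg u
  rw [Matrix.sub_mulVec, dotProduct_sub, Algebra.algebraMap_eq_smul_one, Matrix.smul_mulVec,
    Matrix.one_mulVec, star_trivial, dotProduct_smul, smul_eq_mul] at h1
  have h2 : u ⬝ᵥ u = ∑ j, u j ^ 2 := by simp [dotProduct, sq]
  rw [h2] at h1
  linarith

variable {k : ℕ}

lemma blockAB_eq_mulVec_decorrWeight {H : Matrix (Fin (k + 1)) (Fin (k + 1)) ℝ} {ev : ℝ}
    (hev : 0 < ev) (hH : ∀ u : Fin (k + 1) → ℝ, ev * ∑ j, u j ^ 2 ≤ u ⬝ᵥ H *ᵥ u) :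
    blockAB H = blockBB H *ᵥ decorrWeight H := by
  have hinj : Function.Injective (blockBB H).mulVec := by
    intro u v huv
    have h0 : blockBB H *ᵥ (u - v) = 0 := by rw [Matrix.mulVec_sub]; exact sub_eq_zero.2 huv
    have h1 := hH (Matrix.vecCons 0 (u - v))
    rw [vecCons_zero_dotProduct_mulVec_self, h0, dotProduct_zero, Fin.sum_univ_succ] at h1
    simp only [Matrix.cons_val_zero, Matrix.cons_val_succ, ne_eq, OfNat.ofNat_ne_zero,
      not_false_eq_true, zero_pow, zero_add] at h1
    have h2 : ∑ j, (u - v) j ^ 2 = 0 :=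
      le_antisymm (by nlinarith) (Finset.sum_nonneg fun _ _ => sq_nonneg _)
    funext j
    have h3 := (Finset.sum_eq_zero_iff_of_nonneg fun _ _ => sq_nonneg _).1 h2 j (Finset.mem_univ j)
    exact sub_eq_zero.1 (pow_eq_zero_iff two_ne_zero |>.1 h3)
  have hu : IsUnit (blockBB H) := Matrix.mulVec_injective_iff_isUnit.1 hinj
  rw [decorrWeight, Matrix.mulVec_mulVec, Matrix.mul_nonsing_inv _
    ((Matrix.isUnit_iff_isUnit_det _).1 hu), Matrix.one_mulVec]

/-- The partial information is the quadratic form at the decorrelated direction `(1, -w*)`. -/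
lemma partialInfo_eq_dotProduct_mulVec {H : Matrix (Fin (k + 1)) (Fin (k + 1)) ℝ} (hs : H.IsSymm)
    (hw : blockAB H = blockBB H *ᵥ decorrWeight H) :
    partialInfo H =
      Matrix.vecCons 1 (-decorrWeight H) ⬝ᵥ H *ᵥ Matrix.vecCons 1 (-decorrWeight H) := by
  rw [dotProduct_mulVec_vecCons_one hs, ← hw, sub_self, dotProduct_zero, add_zero,
    Matrix.cons_val_zero, one_mul, partialInfo]

lemma le_partialInfo {H : Matrix (Fin (k + 1)) (Fin (k + 1)) ℝ} (hs : H.IsSymm) {ev : ℝ}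
    (hev : 0 < ev) (hH : ∀ u : Fin (k + 1) → ℝ, ev * ∑ j, u j ^ 2 ≤ u ⬝ᵥ H *ᵥ u) :
    ev ≤ partialInfo H := by
  rw [partialInfo_eq_dotProduct_mulVec hs (blockAB_eq_mulVec_decorrWeight hev hH)]
  refine le_trans ?_ (hH _)
  rw [Fin.sum_univ_succ, Matrix.cons_val_zero]
  have : 0 ≤ ∑ i : Fin k, Matrix.vecCons 1 (-decorrWeight H) i.succ ^ 2 :=
    Finset.sum_nonneg fun _ _ => sq_nonneg _
  nlinarith

/-! ### Importance sampling with a Markov chain -/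

lemma pmass_div_le_maxRatio (φ : S → ι → ℝ) (θ : ι → ℝ) (h : S → ℝ) (s : S) :
    pmass φ θ s / h s ≤ maxRatio φ θ h :=
  le_ciSup (f := fun y => pmass φ θ y / h y) (Set.finite_range _).bddAbove s

variable {m : ℕ} {h : S → ℝ}

/-- The self-normalised importance sampling average is close to its target when the numerator is
small and the denominator is not. -/
lemma abs_wmean_chainWeight_sub_lt [Nonempty S] (φ : S → ι → ℝ) (θ : ι → ℝ) (y : Fin m → S)
    (hm : 0 < m) (f : S → ℝ) (c : ℝ) {u : ℝ}
    (h1 : |1 / (m : ℝ) * ∑ i, (pmass φ θ (y i) / h (y i) - 1)| < 1 / 2)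
    (h2 : |1 / (m : ℝ) * ∑ i, pmass φ θ (y i) / h (y i) * (f (y i) - c)| < u) :
    |wmean (chainWeight φ h y θ) (fun i => f (y i)) - c| ≤ 2 * u := by
  have hm' : (0 : ℝ) < m := by exact_mod_cast hm
  have hC := partitionFn_pos φ θ
  have e1 : ∀ s, Real.exp (θ ⬝ᵥ φ s) / h s = partitionFn φ θ * (pmass φ θ s / h s) := by
    intro s
    rw [pmass]
    field_simp
  set R := 1 / (m : ℝ) * ∑ i, pmass φ θ (y i) / h (y i) with hR
  set N := 1 / (m : ℝ) * ∑ i, pmass φ θ (y i) / h (y i) * (f (y i) - c) with hN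
  have hR1 : 1 / (m : ℝ) * ∑ i, (pmass φ θ (y i) / h (y i) - 1) = R - 1 := by
    rw [Finset.sum_sub_distrib, mul_sub, hR]
    simp [hm'.ne']
  rw [hR1] at h1
  have hRpos : 1 / 2 < R := by have := (abs_lt.1 h1).1; linarith
  have e2 : wmean (chainWeight φ h y θ) (fun i => f (y i)) - c = N / R := by
    rw [wmean_chainWeight]
    have e3 : ∑ i, Real.exp (θ ⬝ᵥ φ (y i)) / h (y i) = partitionFn φ θ * (m * R) := by
      simp only [e1, ← Finset.mul_sum, hR]
      field_simp
    have e4 : ∑ i, Real.exp (θ ⬝ᵥ φ (y i)) / h (y i) * f (y i) =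
        partitionFn φ θ * (m * (N + c * R)) := by
      have : m * (N + c * R) = ∑ i, pmass φ θ (y i) / h (y i) * f (y i) := by
        rw [hN, hR]
        simp only [mul_sub, Finset.sum_sub_distrib, ← Finset.sum_mul]
        field_simp
        ring
      rw [this, Finset.mul_sum]
      exact Finset.sum_congr rfl fun i _ => by rw [e1]; ring
    rw [e3, e4]
    have : R ≠ 0 := by linarith
    field_simp
    ring
  rw [e2, abs_div, abs_of_pos (by linarith : 0 < R), div_le_iff₀ (by linarith)]
  have := (abs_nonneg N).trans h2.le
  nlinarith

/-- Concentration of the self-normalised importance sampling average along the chain. -/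
theorem IsMarkovChain.measureReal_abs_wmean_chainWeight_sub_gt_le {Ω : Type*} [MeasurableSpace Ω]
    [MeasurableSpace S] [MeasurableSingletonClass S] {μ : Measure Ω} [IsProbabilityMeasure μ]
    {Y : ℕ → Ω → S} {q : S → ℝ} {P : S → S → ℝ} {Q₀ δ M₀ L M u : ℝ}
    (hY : IsMarkovChain μ Y q P) (hP : IsStationary h P) (hQ : ∑ x, q x ^ 2 / h x ≤ Q₀)
    (hδ0 : 0 < δ) (hδ1 : δ ≤ 1) (hκ : kappa h P ^ 2 ≤ 1 - δ) (φ : S → ι → ℝ) (θ : ι → ℝ)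
    (hM₀ : maxRatio φ θ h ≤ M₀) {f : S → ℝ} (hf : ∀ s, |f s| ≤ L)
    (hM : 1 + M₀ + 2 * M₀ * L ≤ M) (hm : 0 < m) (hu0 : 0 ≤ u) (hu1 : u ≤ 1 / 2) :
    μ.real {ω | 2 * u < |wmean (chainWeight φ h (fun i : Fin m => Y i ω) θ)
        (fun i : Fin m => f (Y i ω)) - wmean (pmass φ θ) f|} ≤
      4 * √Q₀ * Real.exp 1 * Real.exp (-(δ / (48 * M ^ 2) * (m * u ^ 2))) := by
  have hne : Nonempty S := by
    by_contra hn
    rw [not_nonempty_iff] at hn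
    simpa using hP.sum_one
  obtain ⟨s₀⟩ := id hne
  have hp := isWeight_pmass φ θ
  have hr0 : ∀ s, 0 ≤ pmass φ θ s / h s := fun s => div_nonneg (hp.nonneg s) (hP.pos s).le
  have hr1 : ∀ s, pmass φ θ s / h s ≤ M₀ := fun s => (pmass_div_le_maxRatio φ θ h s).trans hM₀
  have hM0 : 0 ≤ M₀ := (hr0 s₀).trans (hr1 s₀)
  have hL0 : 0 ≤ L := (abs_nonneg _).trans (hf s₀)
  have hML : 0 ≤ M₀ * L := mul_nonneg hM0 hL0
  have hrh : ∀ s, h s * (pmass φ θ s / h s) = pmass φ θ s := fun s =>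
    mul_div_cancel₀ _ (hP.pos s).ne'
  have b1 := hY.measureReal_abs_avg_ge_le hP hQ hδ0 hδ1 hκ (M := M) (m := m)
    (f := fun s => pmass φ θ s / h s - 1) (u := u) (by linarith)
    (fun s => by rw [abs_le]; constructor <;> linarith [hr0 s, hr1 s])
    (by rw [wmean_sub, hP.isWeight.wmean_const]; simp [wmean, hrh, hp.sum_one])
    hm hu0 (by linarith)
  have b2 := hY.measureReal_abs_avg_ge_le hP hQ hδ0 hδ1 hκ (M := M) (m := m)
    (f := fun s => pmass φ θ s / h s * (f s - wmean (pmass φ θ) f)) (u := u) (by linarith)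
    (fun s => by
      rw [abs_mul, abs_of_nonneg (hr0 s)]
      have := mul_le_mul (hr1 s) (hp.abs_sub_wmean_le hf s) (abs_nonneg _) hM0
      linarith)
    (by
      have : wmean (pmass φ θ) (fun s => f s - wmean (pmass φ θ) f) = 0 := by
        rw [hp.wmean_sub_const, sub_self]
      simpa [wmean, ← mul_assoc, hrh] using this)
    hm hu0 (by linarith)
  calc _ ≤ μ.real ({ω | u ≤ |1 / (m : ℝ) * ∑ i : Fin m, (pmass φ θ (Y i ω) / h (Y i ω) - 1)|} ∪
      {ω | u ≤ |1 / (m : ℝ) * ∑ i : Fin m, pmass φ θ (Y i ω) / h (Y i ω) *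
        (f (Y i ω) - wmean (pmass φ θ) f)|}) := by
        refine measureReal_mono fun ω hω => ?_
        by_contra hc
        rw [Set.mem_union, not_or] at hc
        simp only [Set.mem_ofPred_eq, not_le] at hc hω
        exact absurd (abs_wmean_chainWeight_sub_lt φ θ (fun i : Fin m => Y i ω) hm f _
          (hc.1.trans_le hu1) hc.2) (not_le.2 hω)
    _ ≤ _ := measureReal_union_le _ _
    _ ≤ _ := add_le_add b1 b2
    _ = _ := by ring

/-- First and second moments that are close give covariances that are close. -/
lemma abs_wcov_sub_wcov_le {I J : Type*} [Fintype I] [Fintype J] {a : I → ℝ} {b : J → ℝ}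
    (ha : IsWeight a) (hb : IsWeight b) {f g : I → ℝ} {f' g' : J → ℝ} {K t : ℝ}
    (hf : ∀ i, |f i| ≤ K) (hg : ∀ j, |g' j| ≤ K)
    (h1 : |wmean a f - wmean b f'| ≤ t) (h2 : |wmean a g - wmean b g'| ≤ t)
    (h3 : |wmean a (fun i => f i * g i) - wmean b (fun j => f' j * g' j)| ≤ t) :
    |wcov a f g - wcov b f' g'| ≤ (1 + 2 * K) * t := by
  rw [ha.wcov_eq, hb.wcov_eq]
  have e : ∀ x x' p p' q q' : ℝ, x - p * q - (x' - p' * q') =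
      (x - x') - (p * (q - q') + q' * (p - p')) := by intros; ring
  rw [e]
  have k1 := ha.abs_wmean_le hf
  have k2 := hb.abs_wmean_le hg
  refine (abs_sub _ _).trans ?_
  have k3 := abs_add_le (wmean a f * (wmean a g - wmean b g')) (wmean b g' * (wmean a f - wmean b f'))
  rw [abs_mul, abs_mul] at k3
  have k4 := mul_le_mul k1 h2 (abs_nonneg _) ((abs_nonneg _).trans k1)
  have k5 := mul_le_mul k2 h1 (abs_nonneg _) ((abs_nonneg _).trans k2)
  linarith

end Model


/-! ### Standardised and studentised limits of a one-step estimator -/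

section Studentize

/-- If `X ≈ √H (G - e)` and `c ≈ 1 / √H` then `c X ≈ G`, with an error relative to `G`. -/
lemma abs_scaled_sub_le {c rH X b d e G : ℝ} (hc : |c| ≤ d) (hd : |c * rH - 1| ≤ b) (hb : b ≤ 1)
    {η : ℝ} (hX : |X - rH * (G - e)| ≤ η) :
    |c * X - G| ≤ (b + d * η) * (|G| + 1) + 2 * |e| := by
  have e1 : c * X - G = c * (X - rH * (G - e)) + (c * rH - 1) * (G - e) - e := by ring
  have h1 : |c * (X - rH * (G - e))| ≤ d * η := by
    rw [abs_mul]
    exact mul_le_mul hc hX (abs_nonneg _) ((abs_nonneg _).trans hc)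
  have hb0 : 0 ≤ b := (abs_nonneg _).trans hd
  have h2 : |(c * rH - 1) * (G - e)| ≤ b * |G| + |e| := by
    rw [abs_mul]
    calc _ ≤ b * (|G| + |e|) := mul_le_mul hd (abs_sub _ _) (abs_nonneg _) hb0
      _ ≤ _ := by nlinarith [abs_nonneg e]
  have h3 : 0 ≤ d * η := (abs_nonneg _).trans h1
  have h4 : |c * X - G| ≤ d * η + (b * |G| + |e|) + |e| := by
    rw [e1]
    refine (abs_sub _ _).trans ?_
    have := abs_add_le (c * (X - rH * (G - e))) ((c * rH - 1) * (G - e))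
    linarith
  have := mul_nonneg h3 (abs_nonneg G)
  nlinarith

lemma abs_div_sub_one_le {ev H Hh κ : ℝ} (hev : 0 < ev) (hH : ev ≤ H) (hd : |Hh - H| ≤ κ)
    (hκ : κ ≤ ev / 2) : |H / Hh - 1| ≤ 2 * κ / ev := by
  have h1 := abs_le.1 hd
  have hpos : ev / 2 ≤ Hh := by linarith [h1.1]
  have hHh : 0 < Hh := by linarith
  rw [div_sub_one hHh.ne', abs_div, abs_of_pos hHh, abs_sub_comm, div_le_div_iff₀ hHh hev]
  have := (abs_nonneg _).trans hd
  nlinarith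

lemma standardize_le {ev H Hh κ s x G e η : ℝ} (hev : 0 < ev) (hH : ev ≤ H)
    (hd : |Hh - H| ≤ κ) (hκ : κ ≤ ev / 2) (hX : |s * (Hh * x) - √H * (G - e)| ≤ η) :
    |√H * (s * x) - G| ≤ (2 * κ / ev + 2 / √ev * η) * (|G| + 1) + 2 * |e| := by
  have h1 := abs_le.1 hd
  have hHh : 0 < Hh := by linarith [h1.1]
  have hH0 : 0 < H := hev.trans_le hH
  have hrH : 0 < √H := Real.sqrt_pos.2 hH0
  have hrev : 0 < √ev := Real.sqrt_pos.2 hev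
  have hsq := Real.mul_self_sqrt hH0.le
  have e1 : √H * (s * x) = √H / Hh * (s * (Hh * x)) := by field_simp
  rw [e1]
  refine abs_scaled_sub_le ?_ ?_ ?_ hX
  · rw [abs_of_pos (by positivity), div_le_div_iff₀ hHh hrev]
    have : √ev ≤ √H := Real.sqrt_le_sqrt hH
    nlinarith [h1.1]
  · rw [div_mul_eq_mul_div, hsq]
    exact abs_div_sub_one_le hev hH hd hκ
  · rw [div_le_one hev]; linarith

lemma studentize_le {ev H Hh κ s x G e η : ℝ} (hev : 0 < ev) (hH : ev ≤ H)
    (hd : |Hh - H| ≤ κ) (hκ : κ ≤ ev / 2) (hX : |s * (Hh * x) - √H * (G - e)| ≤ η) :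
    |√Hh * (s * x) - G| ≤ (2 * κ / ev + 2 / √ev * η) * (|G| + 1) + 2 * |e| := by
  have h1 := abs_le.1 hd
  have hHh : ev / 2 ≤ Hh := by linarith [h1.1]
  have hHh0 : 0 < Hh := by linarith
  have hH0 : 0 < H := hev.trans_le hH
  have hrHh : 0 < √Hh := Real.sqrt_pos.2 hHh0
  have hrev : 0 < √ev := Real.sqrt_pos.2 hev
  have hsq := Real.mul_self_sqrt hHh0.le
  have e1 : √Hh * (s * x) = 1 / √Hh * (s * (Hh * x)) := by
    field_simp
    rw [sq, hsq]
    ring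
  rw [e1]
  refine abs_scaled_sub_le ?_ ?_ ?_ hX
  · rw [abs_of_pos (by positivity), div_le_div_iff₀ hrHh hrev, one_mul]
    have : √ev ≤ √(2 ^ 2 * Hh) := Real.sqrt_le_sqrt (by linarith)
    rwa [Real.sqrt_mul (by norm_num), Real.sqrt_sq (by norm_num)] at this
  · refine le_trans ?_ (abs_div_sub_one_le hev hH hd hκ)
    -- `|r - 1| ≤ |r ^ 2 - 1|` for `r ≥ 0`
    have e2 : H / Hh = (1 / √Hh * √H) * (1 / √Hh * √H) := by
      have := Real.mul_self_sqrt hH0.le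
      field_simp
      rw [Real.sq_sqrt hHh0.le, Real.sq_sqrt hH0.le]
      ring
    have hr : 0 ≤ 1 / √Hh * √H := by positivity
    rw [e2]
    generalize 1 / √Hh * √H = r at hr
    have e3 : r * r - 1 = (r - 1) * (r + 1) := by ring
    rw [e3, abs_mul, abs_of_nonneg (by linarith : 0 ≤ r + 1)]
    nlinarith [abs_nonneg (r - 1)]
  · rw [div_le_one hev]; linarith

variable {Ω : ℕ → Type*} [∀ n, MeasurableSpace (Ω n)] {μ : ∀ n, Measure (Ω n)}
  [∀ n, IsProbabilityMeasure (μ n)]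

/-- Limits of an estimation error `x` for which `√n Ĥ x = √H (G - e)` up to `O(√n λ²)`, where
`Ĥ - H = O(λ)`, the main term `G` is asymptotically standard normal and `e` is negligible. -/
theorem limits_of_expansion {x Hh G e : ∀ n, Ω n → ℝ} {bad : ∀ n, Set (Ω n)} {Hs lam : ℕ → ℝ}
    {ev b C : ℝ} (hx : ∀ n, Measurable (x n)) (hHhm : ∀ n, Measurable (Hh n))
    (hGm : ∀ n, Measurable (G n)) (hev : 0 < ev) (hHs : ∀ n, Hs n ∈ Set.Icc ev b)
    (hlam : Tendsto lam atTop (𝓝 0)) (hnlam : Tendsto (fun n : ℕ => √n * lam n ^ 2) atTop (𝓝 0))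
    (hG : TendstoInDistribution G atTop (id : ℝ → ℝ) μ (gaussianReal 0 1))
    (htight : ∀ ε > 0, ∃ R, 0 < R ∧ ∀ᶠ n in atTop, (μ n).real {ω | R ≤ |G n ω|} ≤ ε)
    (he : TendstoZeroInProb μ e) (hbad : Tendsto (fun n => (μ n).real (bad n)) atTop (𝓝 0))
    (hle : ∀ᶠ n : ℕ in atTop, ∀ ω ∉ bad n, |Hh n ω - Hs n| ≤ C * lam n ∧
      |√n * (Hh n ω * x n ω) - √(Hs n) * (G n ω - e n ω)| ≤ C * (√n * lam n ^ 2)) :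
    (∀ f : BoundedContinuousFunction ℝ ℝ, Tendsto (fun n : ℕ =>
      (∫ ω, f (√n * x n ω) ∂(μ n)) - ∫ z, f z ∂(gaussianReal 0 (1 / Hs n).toNNReal))
        atTop (𝓝 0)) ∧
    TendstoInDistribution (fun (n : ℕ) ω => √(n * Hs n) * x n ω) atTop
      (id : ℝ → ℝ) μ (gaussianReal 0 1) ∧
    TendstoZeroInProb μ (fun n ω => Hh n ω - Hs n) ∧
    TendstoInDistribution (fun (n : ℕ) ω => √(n * Hh n ω) * x n ω) atTop
      (id : ℝ → ℝ) μ (gaussianReal 0 1) ∧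
    (∀ η ∈ Set.Ioo (0 : ℝ) 1, ∀ z : ℝ, cdf (gaussianReal 0 1) z = 1 - η / 2 →
      Tendsto (fun n : ℕ => (μ n).real {ω | 0 < Hh n ω ∧ |√(n * Hh n ω) * x n ω| ≤ z})
        atTop (𝓝 (1 - η))) := by
  have hClam : Tendsto (fun n => C * lam n) atTop (𝓝 0) := by simpa using hlam.const_mul C
  have hsmall : ∀ᶠ n in atTop, C * lam n ≤ ev / 2 :=
    (hClam.eventually (gt_mem_nhds (by positivity : 0 < ev / 2))).mono fun _ h => h.le
  have hd : Tendsto (fun n : ℕ => 2 * (C * lam n) / ev + 2 / √ev * (C * (√n * lam n ^ 2)))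
      atTop (𝓝 0) := by
    have := ((hClam.const_mul 2).div_const ev).add ((hnlam.const_mul C).const_mul (2 / √ev))
    simpa using this
  have h2 : TendstoInDistribution (fun (n : ℕ) ω => √(n * Hs n) * x n ω) atTop
      (id : ℝ → ℝ) μ (gaussianReal 0 1) := by
    refine tendstoInDistribution_of_sub hG hGm (fun n => (hx n).const_mul _) ?_
    refine tendstoZeroInProb_of_relative htight he hbad hd ?_
    filter_upwards [hle, hsmall] with n hn hs ω hω
    have := standardize_le hev (hHs n).1 (hn ω hω).1 hs (hn ω hω).2
    rwa [← mul_assoc, mul_comm √(Hs n), ← Real.sqrt_mul (Nat.cast_nonneg n)] at this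
  have h3 : TendstoZeroInProb μ (fun n ω => Hh n ω - Hs n) := by
    intro ε hε
    refine squeeze_zero' (Eventually.of_forall fun _ => measureReal_nonneg) ?_ hbad
    filter_upwards [hle, hClam.eventually (gt_mem_nhds hε)] with n hn hs
    refine measureReal_mono fun ω hω => ?_
    by_contra hb
    have := (hn ω hb).1
    rw [Set.mem_ofPred_eq] at hω
    linarith
  have h4 : TendstoInDistribution (fun (n : ℕ) ω => √(n * Hh n ω) * x n ω) atTop
      (id : ℝ → ℝ) μ (gaussianReal 0 1) := by
    refine tendstoInDistribution_of_sub hG hGm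
      (fun n => (((hHhm n).const_mul _).sqrt).mul (hx n)) ?_
    refine tendstoZeroInProb_of_relative htight he hbad hd ?_
    filter_upwards [hle, hsmall] with n hn hs ω hω
    have := studentize_le hev (hHs n).1 (hn ω hω).1 hs (hn ω hω).2
    rwa [← mul_assoc, mul_comm √(Hh n ω), ← Real.sqrt_mul (Nat.cast_nonneg n)] at this
  refine ⟨fun f => ?_, h2, h3, h4, fun η hη z hz => ?_⟩
  · have hpos : ∀ n, 0 < Hs n := fun n => hev.trans_le (hHs n).1
    have hc : ∀ n, 1 / √(Hs n) ∈ Set.Icc (1 / √b) (1 / √ev) := fun n =>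
      ⟨one_div_le_one_div_of_le (Real.sqrt_pos.2 (hpos n)) (Real.sqrt_le_sqrt (hHs n).2),
        one_div_le_one_div_of_le (Real.sqrt_pos.2 hev) (Real.sqrt_le_sqrt (hHs n).1)⟩
    refine (tendsto_integral_mul_sub h2 hc f).congr fun n => ?_
    have e1 : ∀ ω, 1 / √(Hs n) * (√(n * Hs n) * x n ω) = √n * x n ω := fun ω => by
      rw [Real.sqrt_mul (Nat.cast_nonneg n)]
      have := (Real.sqrt_pos.2 (hpos n)).ne'
      field_simp
    have e2 : (gaussianReal 0 1).map (fun z => 1 / √(Hs n) * z) =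
        gaussianReal 0 (1 / Hs n).toNNReal := by
      rw [gaussianReal_map_const_mul, mul_zero, mul_one]
      congr 1
      ext
      rw [Real.coe_toNNReal _ (by have := hpos n; positivity)]
      simp only [NNReal.coe_mk, div_pow, one_pow, Real.sq_sqrt (hpos n).le]
    simp only [e1]
    rw [← e2, integral_map (by fun_prop) f.continuous.aestronglyMeasurable]
  · have h5 := tendsto_coverage h4 hη hz
    have h6 := h3 ev hev
    have h7 : Tendsto (fun n : ℕ => (μ n).real {ω | |√(n * Hh n ω) * x n ω| ≤ z}
        - (μ n).real {ω | ev ≤ |Hh n ω - Hs n|}) atTop (𝓝 (1 - η)) := by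
      simpa using h5.sub h6
    refine tendsto_of_tendsto_of_tendsto_of_le_of_le h7 h5 (fun n => ?_) fun n =>
      measureReal_mono fun ω hω => hω.2
    have h8 : {ω | |√(n * Hh n ω) * x n ω| ≤ z} ⊆
        {ω | 0 < Hh n ω ∧ |√(n * Hh n ω) * x n ω| ≤ z} ∪ {ω | ev ≤ |Hh n ω - Hs n|} := by
      intro ω hω
      rcases lt_or_ge 0 (Hh n ω) with h | h
      · exact Or.inl ⟨h, hω⟩
      · refine Or.inr ?_
        rw [Set.mem_ofPred_eq, abs_sub_comm]
        exact le_trans (by linarith [(hHs n).1]) (le_abs_self _)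
    have h9 := (measureReal_mono (μ := μ n) h8).trans (measureReal_union_le _ _)
    simp only [sub_le_iff_le_add]
    exact h9

/-- Inverting the studentised pivot gives the confidence interval. -/
lemma mem_Icc_iff_abs_pivot_le {a θ z H : ℝ} {n : ℕ} (hn : 0 < n) (hH : 0 < H) :
    θ ∈ Set.Icc (a - z / √(n * H)) (a + z / √(n * H)) ↔ |√(n * H) * (a - θ)| ≤ z := by
  have hr : 0 < √(n * H) := Real.sqrt_pos.2 (by positivity)
  rw [abs_mul, abs_of_pos hr, ← le_div_iff₀' hr, abs_le, Set.mem_Icc]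
  constructor <;> rintro ⟨h1, h2⟩ <;> constructor <;> linarith

end Studentize


/-! ### The asymptotic regime -/

section Regime

variable {ℓ lam : ℕ → ℝ} {m : ℕ → ℕ}

lemma exists_mul_le_of_isBigO (hmn : ℓ =O[atTop] fun n : ℕ => (m n : ℝ) / n) (hℓ : ∀ n, 0 ≤ ℓ n) :
    ∃ c, 0 < c ∧ ∀ᶠ n : ℕ in atTop, c * (n * ℓ n) ≤ m n := by
  obtain ⟨C, hC, h⟩ := hmn.exists_pos
  refine ⟨C⁻¹, by positivity, ?_⟩
  filter_upwards [h.bound, eventually_gt_atTop 0] with n hn hn0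
  have hn' : (0 : ℝ) < n := by exact_mod_cast hn0
  rw [Real.norm_of_nonneg (hℓ n), Real.norm_of_nonneg (by positivity)] at hn
  rw [inv_mul_le_iff₀ hC]
  calc (n : ℝ) * ℓ n ≤ n * (C * (m n / n)) := by gcongr
    _ = _ := by field_simp

lemma exists_le_mul_of_isBigO {a b : ℕ → ℝ} (h : a =O[atTop] b) (ha : ∀ n, 0 ≤ a n)
    (hb : ∀ n, 0 ≤ b n) : ∃ C, 0 < C ∧ ∀ᶠ n in atTop, a n ≤ C * b n := by
  obtain ⟨C, hC, h⟩ := h.exists_pos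
  refine ⟨C, hC, h.bound.mono fun n hn => ?_⟩
  rwa [Real.norm_of_nonneg (ha n), Real.norm_of_nonneg (hb n)] at hn

/-- The effective signal in the Monte Carlo tail bounds: `m λ²` dominates `(log p)²`, because
`λ² ≳ (log p) / n` and `m ≳ n log p`. -/
lemma exists_mul_sq_le {r : ℕ → ℝ} (hℓ : ∀ n, 0 ≤ ℓ n) (hr : ∀ n, 0 ≤ r n) (hlam : ∀ n, 0 ≤ lam n)
    (hrate : (fun n => √(ℓ n / n) + r n) =O[atTop] lam) {c : ℝ} (hc : 0 < c)
    (hm : ∀ᶠ n : ℕ in atTop, c * (n * ℓ n) ≤ m n) :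
    ∃ c', 0 < c' ∧ ∀ᶠ n : ℕ in atTop, c' * ℓ n ^ 2 ≤ m n * lam n ^ 2 := by
  obtain ⟨C, hC, h⟩ := exists_le_mul_of_isBigO hrate
    (fun n => add_nonneg (Real.sqrt_nonneg _) (hr n)) hlam
  refine ⟨c / C ^ 2, by positivity, ?_⟩
  filter_upwards [h, hm, eventually_gt_atTop 0] with n h1 h2 hn0
  have hn' : (0 : ℝ) < n := by exact_mod_cast hn0
  have h3 : √(ℓ n / n) ≤ C * lam n := by linarith [hr n]
  have h4 : ℓ n / n ≤ (C * lam n) ^ 2 := by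
    rw [← Real.sq_sqrt (div_nonneg (hℓ n) hn'.le)]
    exact pow_le_pow_left₀ (Real.sqrt_nonneg _) h3 2
  rw [div_mul_eq_mul_div, div_le_iff₀ (by positivity)]
  calc c * ℓ n ^ 2 = (c * (n * ℓ n)) * (ℓ n / n) := by field_simp
    _ ≤ m n * (C * lam n) ^ 2 :=
      mul_le_mul h2 h4 (div_nonneg (hℓ n) hn'.le) (Nat.cast_nonneg _)
    _ = _ := by ring

/-- The remainder of the expansion is negligible: `√n λ² → 0`. -/
lemma tendsto_sqrt_mul_sq (hℓ : Tendsto ℓ atTop atTop) (hℓ0 : ∀ n, 0 ≤ ℓ n)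
    (hlam : ∀ n, 0 ≤ lam n)
    (hrate : lam =O[atTop] fun n => √(ℓ n / n) + √(ℓ n / m n) + ℓ n / m n) {c : ℝ} (hc : 0 < c)
    (hm : ∀ᶠ n : ℕ in atTop, c * (n * ℓ n) ≤ m n)
    (hreg : Tendsto (fun n : ℕ => ℓ n / √n) atTop (𝓝 0)) :
    Tendsto (fun n : ℕ => √n * lam n ^ 2) atTop (𝓝 0) := by
  obtain ⟨C, hC, h⟩ := exists_le_mul_of_isBigO hrate hlam fun n => by
    have := hℓ0 n; positivity
  have hlim : Tendsto (fun n : ℕ => C ^ 2 * 3 * (1 + 2 / c) * (ℓ n / √n)) atTop (𝓝 0) := by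
    simpa using hreg.const_mul (C ^ 2 * 3 * (1 + 2 / c))
  refine squeeze_zero' (Eventually.of_forall fun n => by positivity) ?_ hlim
  filter_upwards [h, hm, eventually_gt_atTop 0, hℓ.eventually_ge_atTop 1] with n h1 h2 hn0 hl
  have hn' : (0 : ℝ) < n := by exact_mod_cast hn0
  have hl0 : 0 < ℓ n := by linarith
  have hm0 : 0 < (m n : ℝ) := lt_of_lt_of_le (by positivity) h2
  have hm1 : (1 : ℝ) ≤ m n := by exact_mod_cast (by exact_mod_cast hm0 : 0 < m n)
  have e1 : √(ℓ n / n) ^ 2 = ℓ n / n := Real.sq_sqrt (by positivity)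
  have e2 : √(ℓ n / m n) ^ 2 = ℓ n / m n := Real.sq_sqrt (by positivity)
  have h3 : lam n ^ 2 ≤ C ^ 2 * 3 * (ℓ n / n + ℓ n / m n + (ℓ n / m n) ^ 2) := by
    calc lam n ^ 2 ≤ (C * (√(ℓ n / n) + √(ℓ n / m n) + ℓ n / m n)) ^ 2 :=
          pow_le_pow_left₀ (hlam n) h1 2
      _ ≤ C ^ 2 * 3 * (√(ℓ n / n) ^ 2 + √(ℓ n / m n) ^ 2 + (ℓ n / m n) ^ 2) := by
          rw [mul_pow, mul_assoc]
          refine mul_le_mul_of_nonneg_left ?_ (by positivity)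
          generalize √(ℓ n / n) = a
          generalize √(ℓ n / m n) = b
          generalize ℓ n / m n = d
          nlinarith [sq_nonneg (a - b), sq_nonneg (b - d), sq_nonneg (a - d)]
      _ = _ := by rw [e1, e2]
  -- both Monte Carlo terms are at most `ℓ / (c n)`, since `m ≥ c n ℓ` and `ℓ, m ≥ 1`
  have h4 : ℓ n / m n ≤ 1 / c * (ℓ n / n) := by
    rw [div_mul_div_comm, one_mul, div_le_div_iff₀ hm0 (by positivity)]
    have : c * n ≤ m n := le_trans (by nlinarith [mul_pos hc hn']) h2
    nlinarith
  have h5 : (ℓ n / m n) ^ 2 ≤ 1 / c * (ℓ n / n) := by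
    rw [div_pow, div_mul_div_comm, one_mul, div_le_div_iff₀ (by positivity) (by positivity)]
    calc ℓ n ^ 2 * (c * n) = ℓ n * (c * (n * ℓ n)) := by ring
      _ ≤ ℓ n * m n := by gcongr
      _ ≤ ℓ n * m n ^ 2 := by
        refine mul_le_mul_of_nonneg_left ?_ hl0.le
        nlinarith
  have h6 : lam n ^ 2 ≤ C ^ 2 * 3 * (1 + 2 / c) * (ℓ n / n) := by
    refine h3.trans ?_
    rw [mul_assoc (C ^ 2 * 3)]
    refine mul_le_mul_of_nonneg_left ?_ (by positivity)
    have : (1 + 2 / c) * (ℓ n / n) = ℓ n / n + 1 / c * (ℓ n / n) + 1 / c * (ℓ n / n) := by ring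
    linarith
  calc √n * lam n ^ 2 ≤ √n * (C ^ 2 * 3 * (1 + 2 / c) * (ℓ n / n)) := by gcongr
    _ = C ^ 2 * 3 * (1 + 2 / c) * (ℓ n / √n) := by
      have hs : 0 < √(n : ℝ) := Real.sqrt_pos.2 hn'
      have : (n : ℝ) = √n * √n := (Real.mul_self_sqrt hn'.le).symm
      have e : √(n : ℝ) * (ℓ n / n) = ℓ n / √n := by
        rw [mul_div_assoc', div_eq_div_iff hn'.ne' hs.ne']
        linear_combination -ℓ n * this
      rw [← e]; ring

/-- The union bound over the entries of the gradient and of the Hessian vanishes. -/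
lemma tendsto_union_bound {k : ℕ → ℕ} {A K κ B ε c : ℝ} (hk : Tendsto (fun n => Real.log (k n + 1))
    atTop atTop) (hK : 0 < K) (hA : 4 * √2 * K < A) (hκ : 0 < κ) (hε : 0 < ε) (hB : 0 ≤ B)
    (hlarge : ∀ᶠ n : ℕ in atTop, A * √(Real.log (k n + 1) / n) ≤ lam n) (hc : 0 < c)
    (hm : ∀ᶠ n : ℕ in atTop, c * Real.log (k n + 1) ^ 2 ≤ m n * lam n ^ 2) :
    Tendsto (fun n : ℕ => ((k n : ℝ) + 1) * (2 * Real.exp (-(n * (lam n / 4) ^ 2 / (2 * K ^ 2))))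
      + (((k n : ℝ) + 1) + ((k n : ℝ) + 1) ^ 2) *
        (B * Real.exp (-(κ * (m n * (ε * lam n) ^ 2))))) atTop (𝓝 0) := by
  set ℓ : ℕ → ℝ := fun n => Real.log (k n + 1) with hℓ
  have hℓ0 : ∀ n, 0 ≤ ℓ n := fun n => Real.log_nonneg (by linarith [(k n).cast_nonneg (α := ℝ)])
  have hexp : ∀ n, (k n : ℝ) + 1 = Real.exp (ℓ n) := fun n => (Real.exp_log (by positivity)).symm
  have hA0 : 0 < A := lt_trans (by positivity) hA
  -- the threshold `4 √2 K` for `A` makes the exponent of Hoeffding's inequality exceed `log p`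
  set b := A ^ 2 / (32 * K ^ 2) with hb
  have hb1 : 1 < b := by
    rw [hb, lt_div_iff₀ (by positivity)]
    have h1 : (4 * √2 * K) ^ 2 < A ^ 2 := pow_lt_pow_left₀ hA (by positivity) two_ne_zero
    have h2 : (4 * √2 * K) ^ 2 = 32 * K ^ 2 := by
      rw [mul_pow, mul_pow, Real.sq_sqrt (by norm_num)]; ring
    linarith
  have hsq : ∀ᶠ n : ℕ in atTop, A ^ 2 * ℓ n ≤ n * lam n ^ 2 := by
    filter_upwards [hlarge, eventually_gt_atTop 0] with n h1 hn0
    have hn' : (0 : ℝ) < n := by exact_mod_cast hn0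
    have h2 := pow_le_pow_left₀ (by positivity) h1 2
    rw [mul_pow, Real.sq_sqrt (div_nonneg (hℓ0 n) hn'.le)] at h2
    calc A ^ 2 * ℓ n = n * (A ^ 2 * (ℓ n / n)) := by field_simp
      _ ≤ _ := by gcongr
  set a := κ * ε ^ 2 * c with ha
  have ha0 : 0 < a := by positivity
  have hlim1 : Tendsto (fun n => 2 * Real.exp ((1 - b) * ℓ n)) atTop (𝓝 0) := by
    have := (Real.tendsto_exp_atBot.comp (hk.const_mul_atTop_of_neg (by linarith : 1 - b < 0)))
    simpa using this.const_mul 2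
  have hlim2 : Tendsto (fun n => 2 * B * Real.exp (ℓ n * (2 - a * ℓ n))) atTop (𝓝 0) := by
    have h1 : Tendsto (fun n => 2 - a * ℓ n) atTop atBot := by
      have := tendsto_atBot_add_const_left atTop (2 : ℝ)
        (hk.const_mul_atTop_of_neg (neg_lt_zero.2 ha0))
      simpa [sub_eq_add_neg] using this
    have := (Real.tendsto_exp_atBot.comp (hk.atTop_mul_atBot₀ h1))
    simpa using this.const_mul (2 * B)
  have hlim := hlim1.add hlim2
  rw [add_zero] at hlim
  refine squeeze_zero' (Eventually.of_forall fun n => by positivity) ?_ hlim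
  filter_upwards [hsq, hm] with n h1 h2
  refine add_le_add ?_ ?_
  · rw [hexp, mul_left_comm, ← Real.exp_add]
    refine mul_le_mul_of_nonneg_left (Real.exp_le_exp.2 ?_) (by norm_num)
    have h3 : b * ℓ n ≤ n * (lam n / 4) ^ 2 / (2 * K ^ 2) := by
      rw [hb, div_mul_eq_mul_div, div_le_div_iff₀ (by positivity) (by positivity)]
      nlinarith [mul_le_mul_of_nonneg_left h1 (by positivity : 0 ≤ 2 * K ^ 2)]
    linarith
  · have h3 : (k n : ℝ) + 1 ≤ ((k n : ℝ) + 1) ^ 2 := by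
      nlinarith [(k n).cast_nonneg (α := ℝ)]
    have h4 : a * ℓ n ^ 2 ≤ κ * (m n * (ε * lam n) ^ 2) := by
      calc a * ℓ n ^ 2 = κ * ε ^ 2 * (c * ℓ n ^ 2) := by rw [ha]; ring
        _ ≤ κ * ε ^ 2 * (m n * lam n ^ 2) := by gcongr
        _ = _ := by ring
    calc _ ≤ (2 * ((k n : ℝ) + 1) ^ 2) * (B * Real.exp (-(a * ℓ n ^ 2))) := by
          gcongr
          linarith
      _ = _ := by
        rw [hexp, ← Real.exp_nat_mul]
        have : Real.exp (ℓ n * (2 - a * ℓ n)) =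
            Real.exp ((2 : ℕ) * ℓ n) * Real.exp (-(a * ℓ n ^ 2)) := by
          rw [← Real.exp_add]; congr 1; push_cast; ring
        rw [this]; ring

end Regime


/-! ### The random events and variables of the one-step expansion -/

section Events

variable {Ω S ι : Type*} [MeasurableSpace Ω] [MeasurableSpace S] [Fintype S] [Fintype ι]
  [MeasurableSingletonClass S] {μ : Measure Ω} [IsProbabilityMeasure μ] {n m : ℕ}
  {X : Fin n → Ω → S} {Y : ℕ → Ω → S} {h q : S → ℝ} {P : S → S → ℝ} {φ : S → ι → ℝ} {θ : ι → ℝ}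

/-- With high probability the gradient of the loss at the true parameter is at most `lam / 2` and
its Hessian is within `ρ` of the information matrix, entry by entry. Half of the bound on the
gradient is spent on the sampling error of the data, half on the Monte Carlo error. -/
theorem measureReal_gradient_hessian_le {Q₀ δ M₀ L M K t lam ρ : ℝ} (hX : IsIIDSample μ X (pmass φ θ))
    (hY : IsMarkovChain μ Y q P) (hP : IsStationary h P) (hQ : ∑ x, q x ^ 2 / h x ≤ Q₀)
    (hδ0 : 0 < δ) (hδ1 : δ ≤ 1) (hκ : kappa h P ^ 2 ≤ 1 - δ) (hM₀ : maxRatio φ θ h ≤ M₀)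
    (hK : 0 < K) (hφ : ∀ s j, |φ s j| ≤ K) (hKL : K ≤ L) (hKL2 : K * K ≤ L)
    (hM : 1 + M₀ + 2 * M₀ * L ≤ M) (hn : 0 < n) (hm : 0 < m) (ht0 : 0 ≤ t) (ht1 : t ≤ 1 / 2)
    (hlam0 : 0 ≤ lam) (hlam : 2 * t ≤ lam / 4) (hρ : (1 + 2 * K) * (2 * t) ≤ ρ) :
    μ.real {ω | ¬ ((∀ j, |wmean (chainWeight φ h (fun i : Fin m => Y i ω) θ)
          (fun i : Fin m => φ (Y i ω) j) - sampleMean φ (fun i => X i ω) j| ≤ lam / 2) ∧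
        ∀ i j, |wcovMatrix (chainWeight φ h (fun i : Fin m => Y i ω) θ)
          (fun i : Fin m => φ (Y i ω)) i j - covStat φ θ i j| ≤ ρ)} ≤
      Fintype.card ι * (2 * Real.exp (-(n * (lam / 4) ^ 2 / (2 * K ^ 2)))) +
        (Fintype.card ι + (Fintype.card ι : ℝ) ^ 2) *
          (4 * √Q₀ * Real.exp 1 * Real.exp (-(δ / (48 * M ^ 2) * (m * t ^ 2)))) := by
  have hne : Nonempty S := by
    by_contra hn
    rw [not_nonempty_iff] at hn
    simpa using hP.sum_one
  set T : ℝ := 4 * √Q₀ * Real.exp 1 * Real.exp (-(δ / (48 * M ^ 2) * (m * t ^ 2))) with hT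
  obtain ⟨dev, hdev⟩ : ∃ dev : (S → ℝ) → Set Ω, ∀ f, dev f =
    {ω | 2 * t < |wmean (chainWeight φ h (fun i : Fin m => Y i ω) θ)
      (fun i : Fin m => f (Y i ω)) - wmean (pmass φ θ) f|} := ⟨_, fun _ => rfl⟩
  have hdevle : ∀ f : S → ℝ, (∀ s, |f s| ≤ L) → μ.real (dev f) ≤ T := fun f hf => by
    rw [hdev]
    exact hY.measureReal_abs_wmean_chainWeight_sub_gt_le hP hQ hδ0 hδ1 hκ φ θ hM₀ hf hM hm ht0 ht1
  set A : ι → Set Ω := fun j =>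
    {ω | lam / 4 ≤ |1 / (n : ℝ) * ∑ i, φ (X i ω) j - wmean (pmass φ θ) fun s => φ s j|} with hA
  have hsub : {ω | ¬ ((∀ j, |wmean (chainWeight φ h (fun i : Fin m => Y i ω) θ)
          (fun i : Fin m => φ (Y i ω) j) - sampleMean φ (fun i => X i ω) j| ≤ lam / 2) ∧
        ∀ i j, |wcovMatrix (chainWeight φ h (fun i : Fin m => Y i ω) θ)
          (fun i : Fin m => φ (Y i ω)) i j - covStat φ θ i j| ≤ ρ)} ⊆
      (⋃ j, A j) ∪ ((⋃ j, dev fun s => φ s j) ∪ ⋃ z : ι × ι, dev fun s => φ s z.1 * φ s z.2) := by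
    intro ω hω
    by_contra hc
    simp only [Set.mem_union, Set.mem_iUnion, not_or, not_exists, hA, hdev, Set.mem_ofPred_eq,
      not_le, not_lt] at hc
    obtain ⟨c1, c2, c3⟩ := hc
    refine hω ⟨fun j => ?_, fun i j => ?_⟩
    · have d1 := abs_le.1 (c2 j)
      have d2 := abs_lt.1 (c1 j)
      rw [sampleMean, abs_le]
      constructor <;> linarith [d1.1, d1.2, d2.1, d2.2]
    · rw [covStat_eq_wcovMatrix]
      exact (abs_wcov_sub_wcov_le (isWeight_chainWeight φ _ hP.pos hm θ) (isWeight_pmass φ θ)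
        (fun l => hφ _ i) (fun s => hφ s j) (c2 i) (c2 j) (c3 (i, j))).trans hρ
  have b1 : μ.real (⋃ j, A j) ≤
      Fintype.card ι * (2 * Real.exp (-(n * (lam / 4) ^ 2 / (2 * K ^ 2)))) := by
    refine (measureReal_iUnion_fintype_le _).trans ?_
    refine (Finset.sum_le_card_nsmul _ _ _ fun j _ =>
      hX.measureReal_abs_avg_sub_ge_le hK (fun s => hφ s j) hn (by positivity)).trans_eq ?_
    rw [nsmul_eq_mul, Finset.card_univ]
  have b2 : μ.real (⋃ j, dev fun s => φ s j) ≤ Fintype.card ι * T := by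
    refine (measureReal_iUnion_fintype_le _).trans ?_
    refine (Finset.sum_le_card_nsmul _ _ _ fun j _ =>
      hdevle _ fun s => (hφ s j).trans hKL).trans_eq ?_
    rw [nsmul_eq_mul, Finset.card_univ]
  have b3 : μ.real (⋃ z : ι × ι, dev fun s => φ s z.1 * φ s z.2) ≤
      (Fintype.card ι : ℝ) ^ 2 * T := by
    refine (measureReal_iUnion_fintype_le _).trans ?_
    have hz : ∀ z : ι × ι, μ.real (dev fun s => φ s z.1 * φ s z.2) ≤ T := fun z =>
      hdevle _ fun s => by
        rw [abs_mul]
        exact (mul_le_mul (hφ s _) (hφ s _) (abs_nonneg _) hK.le).trans hKL2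
    refine (Finset.sum_le_card_nsmul _ _ T fun z _ => hz z).trans_eq ?_
    rw [nsmul_eq_mul, Finset.card_univ, Fintype.card_prod, Nat.cast_mul, sq]
  refine (measureReal_mono hsub).trans ((measureReal_union_le _ _).trans ((add_le_add b1
    ((measureReal_union_le _ _).trans (add_le_add b2 b3))).trans_eq ?_))
  rw [add_mul]

/-- A statistic of finitely many finite-valued observations is measurable. -/
lemma measurable_statistic (hX : ∀ i, Measurable (X i)) (hY : ∀ i, Measurable (Y i))
    (F : (Fin n → S) → (Fin m → S) → ℝ) :
    Measurable fun ω => F (fun i => X i ω) fun i : Fin m => Y i ω :=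
  (measurable_of_finite fun z : (Fin n → S) × (Fin m → S) => F z.1 z.2).comp
    ((measurable_pi_lambda _ hX).prodMk (measurable_pi_lambda _ fun i => hY i))

end Events

section Arrays

variable {Ω S : ℕ → Type*} [∀ n, MeasurableSpace (Ω n)] [∀ n, MeasurableSpace (S n)]
  [∀ n, Fintype (S n)] [∀ n, MeasurableSingletonClass (S n)] {μ : ∀ n, Measure (Ω n)}
  [∀ n, IsProbabilityMeasure (μ n)]

/-- Normalised sums of uniformly bounded centred statistics are tight. -/
lemma tight_sum_of_isIIDSample {X : ∀ n, Fin n → Ω n → S n} {p : ∀ n, S n → ℝ}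
    (hX : ∀ n, IsIIDSample (μ n) (X n) (p n)) {g : ∀ n, S n → ℝ} {M : ℝ} (hM : 0 < M)
    (hg : ∀ n x, |g n x| ≤ M) (h0 : ∀ n, wmean (p n) (g n) = 0) {ε : ℝ} (hε : 0 < ε) :
    ∃ R, 0 < R ∧ ∀ᶠ n : ℕ in atTop,
      (μ n).real {ω | R ≤ |(√n)⁻¹ * ∑ i, g n (X n i ω)|} ≤ ε := by
  have hlim : Tendsto (fun R : ℝ => 2 * Real.exp (-(R ^ 2 / (2 * M ^ 2)))) atTop (𝓝 0) := by
    have h1 : Tendsto (fun R : ℝ => R ^ 2 / (2 * M ^ 2)) atTop atTop :=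
      (tendsto_pow_atTop two_ne_zero).atTop_div_const (by positivity)
    simpa using (Real.tendsto_exp_neg_atTop_nhds_zero.comp h1).const_mul 2
  obtain ⟨R, hR, hR0⟩ := ((hlim.eventually (gt_mem_nhds hε)).and (eventually_gt_atTop 0)).exists
  refine ⟨R, hR0, ?_⟩
  filter_upwards [eventually_gt_atTop 0] with n hn
  have hn' : (0 : ℝ) < n := by exact_mod_cast hn
  have hs : 0 < √(n : ℝ) := Real.sqrt_pos.2 hn'
  have h2 := (hX n).measureReal_abs_avg_sub_ge_le hM (hg n) hn (t := R / √n) (by positivity)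
  refine le_trans ?_ (h2.trans ?_)
  · refine measureReal_mono fun ω hω => ?_
    rw [Set.mem_ofPred_eq] at hω ⊢
    have e : 1 / (n : ℝ) * ∑ i, g n (X n i ω) = ((√n)⁻¹ * ∑ i, g n (X n i ω)) / √n := by
      rw [div_eq_mul_inv (_ * _), mul_right_comm, ← mul_inv, Real.mul_self_sqrt hn'.le, one_div]
    rw [h0, sub_zero, e, abs_div, abs_of_pos hs]
    exact div_le_div_of_nonneg_right hω hs.le
  · have e : (n : ℝ) * (R / √n) ^ 2 = R ^ 2 := by
      rw [div_pow, Real.sq_sqrt hn'.le]; field_simp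
    rw [e]
    exact hR.le

/-- The Monte Carlo error of the decorrelated score is of smaller order than its sampling error
when `m / n → ∞`. -/
lemma tendstoZeroInProb_chain_error {ι : ℕ → Type*} [∀ n, Fintype (ι n)] {m : ℕ → ℕ}
    {Y : ∀ n, ℕ → Ω n → S n} {h q : ∀ n, S n → ℝ} {P : ∀ n, S n → S n → ℝ}
    {φ : ∀ n, S n → ι n → ℝ} {θ : ∀ n, ι n → ℝ} {Q₀ δ M₀ L M a : ℝ}
    (hY : ∀ n, IsMarkovChain (μ n) (Y n) (q n) (P n)) (hP : ∀ n, IsStationary (h n) (P n))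
    (hQ : ∀ n, ∑ x, q n x ^ 2 / h n x ≤ Q₀) (hδ0 : 0 < δ) (hδ1 : δ ≤ 1)
    (hκ : ∀ n, kappa (h n) (P n) ^ 2 ≤ 1 - δ) (hM₀ : ∀ n, maxRatio (φ n) (θ n) (h n) ≤ M₀)
    {f : ∀ n, S n → ℝ} (hf : ∀ n s, |f n s| ≤ L) (hM0 : 0 < M) (hM : 1 + M₀ + 2 * M₀ * L ≤ M)
    (hm : Tendsto (fun n : ℕ => (m n : ℝ) / n) atTop atTop) {b : ℕ → ℝ} (ha : 0 < a)
    (hb : ∀ n, |b n| ≤ a) :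
    TendstoZeroInProb μ fun n ω => √n * b n *
      (wmean (chainWeight (φ n) (h n) (fun i : Fin (m n) => Y n i ω) (θ n))
        (fun i : Fin (m n) => f n (Y n i ω)) - wmean (pmass (φ n) (θ n)) (f n)) := by
  intro ε hε
  set u : ℕ → ℝ := fun n => ε / (4 * a * √n) with hu
  set c := δ / (48 * M ^ 2) * (ε / (4 * a)) ^ 2 with hc
  have hc0 : 0 < c := by positivity
  have hlim : Tendsto (fun n : ℕ => 4 * √Q₀ * Real.exp 1 * Real.exp (-(c * (m n / n)))) atTop
      (𝓝 0) := by
    have := Real.tendsto_exp_neg_atTop_nhds_zero.comp (hm.const_mul_atTop hc0)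
    simpa using this.const_mul (4 * √Q₀ * Real.exp 1)
  have hu1 : ∀ᶠ n in atTop, u n ≤ 1 / 2 := by
    have h1 : Tendsto (fun n : ℕ => 4 * a * √(n : ℝ)) atTop atTop :=
      (Real.tendsto_sqrt_atTop.comp tendsto_natCast_atTop_atTop).const_mul_atTop (by positivity)
    exact ((h1.const_div_atTop ε).eventually (gt_mem_nhds (by norm_num))).mono fun _ h => h.le
  refine squeeze_zero' (Eventually.of_forall fun _ => measureReal_nonneg) ?_ hlim
  filter_upwards [hu1, eventually_gt_atTop 0, hm.eventually_gt_atTop 0] with n h1 hn hm0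
  have hn' : (0 : ℝ) < n := by exact_mod_cast hn
  have hs : 0 < √(n : ℝ) := Real.sqrt_pos.2 hn'
  have hmn : 0 < m n := by
    have : (0 : ℝ) < m n := by
      have := mul_pos hm0 hn'
      rwa [div_mul_cancel₀ _ hn'.ne'] at this
    exact_mod_cast this
  have hun : 0 < u n := by positivity
  refine le_trans (measureReal_mono fun ω hω => ?_)
    (((hY n).measureReal_abs_wmean_chainWeight_sub_gt_le (hP n) (hQ n) hδ0 hδ1 (hκ n) (φ n) (θ n)
      (hM₀ n) (hf n) hM hmn hun.le h1).trans_eq ?_)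
  · rw [Set.mem_ofPred_eq] at hω ⊢
    by_contra hlt
    rw [not_lt] at hlt
    rw [abs_mul, abs_mul, abs_of_pos hs] at hω
    have : √(n : ℝ) * |b n| * |wmean (chainWeight (φ n) (h n) (fun i : Fin (m n) => Y n i ω) (θ n))
        (fun i : Fin (m n) => f n (Y n i ω)) - wmean (pmass (φ n) (θ n)) (f n)| ≤
        √n * a * (2 * u n) := by
      gcongr
      exact hb n
    have e : √(n : ℝ) * a * (2 * u n) = ε / 2 := by
      rw [hu]; field_simp; norm_num
    linarith
  · congr 3
    rw [hc, hu]
    have : (ε / (4 * a * √n)) ^ 2 = (ε / (4 * a)) ^ 2 / n := by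
      rw [← div_div, div_pow, Real.sq_sqrt hn'.le]
    simp only [this]
    ring

end Arrays


section Score

variable {S : Type*} {k n m : ℕ} {φ : S → Fin (k + 1) → ℝ} {h : S → ℝ} {x : Fin n → S}
  {y : Fin m → S}

/-- The decorrelated score at the true parameter splits into a sampling error of the data and a
Monte Carlo error, both of the scalar statistic `(1, -w)ᵀ φ`. -/
lemma decorrScore_eq_sub (hh : ∀ s, 0 < h s) (hm : 0 < m) (w : Fin k → ℝ) (θ : Fin (k + 1) → ℝ) :
    decorrScore (mcmcLoss φ h x y) w (θ 0) (Matrix.vecTail θ) =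
      wmean (chainWeight φ h y θ) (fun i => Matrix.vecCons 1 (-w) ⬝ᵥ φ (y i)) -
        1 / (n : ℝ) * ∑ i, Matrix.vecCons 1 (-w) ⬝ᵥ φ (x i) := by
  rw [decorrScore_mcmcLoss hh hm, wmean_dot, dotProduct_sampleMean, ← dotProduct_sub]
  rfl

/-- The expansion of the one-step correction, rescaled by `√n`: the main term is the standardised sum
of the decorrelated statistic over the data, corrected by the Monte Carlo error. -/
lemma abs_scaled_oneStep_sub_le (hh : ∀ s, 0 < h s) (hm : 0 < m) (hn : 0 < n)
    {θs θh : Fin (k + 1) → ℝ} {w wh : Fin k → ℝ} {η I c : ℝ} (hI : 0 < I)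
    (hH : plugInInfo (mcmcLoss φ h x y) θh wh ≠ 0)
    (hexp : |plugInInfo (mcmcLoss φ h x y) θh wh * (θh 0 - θs 0) -
        decorrScore (mcmcLoss φ h x y) wh (θh 0) (Matrix.vecTail θh) +
        decorrScore (mcmcLoss φ h x y) w (θs 0) (Matrix.vecTail θs)| ≤ η) :
    |√n * (plugInInfo (mcmcLoss φ h x y) θh wh * (oneStep (mcmcLoss φ h x y) θh wh - θs 0)) -
      √I * ((√n)⁻¹ * ∑ i, (Matrix.vecCons 1 (-w) ⬝ᵥ φ (x i) - c) / √I -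
        √n * (1 / √I) * (wmean (chainWeight φ h y θs)
          (fun i => Matrix.vecCons 1 (-w) ⬝ᵥ φ (y i)) - c))| ≤ √n * η := by
  have hn' : (0 : ℝ) < n := by exact_mod_cast hn
  have hs : 0 < √(n : ℝ) := Real.sqrt_pos.2 hn'
  have hss := Real.mul_self_sqrt hn'.le
  have hrI : 0 < √I := Real.sqrt_pos.2 hI
  rw [decorrScore_eq_sub hh hm w θs] at hexp
  rw [oneStep, deriv_decorrScore φ x y hh hm]
  generalize decorrScore (mcmcLoss φ h x y) wh (θh 0) (Matrix.vecTail θh) = U at *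
  generalize plugInInfo (mcmcLoss φ h x y) θh wh = Hh at *
  generalize wmean (chainWeight φ h y θs) (fun i => Matrix.vecCons 1 (-w) ⬝ᵥ φ (y i)) = V at *
  have e1 : √I * ((√n)⁻¹ * ∑ i, (Matrix.vecCons 1 (-w) ⬝ᵥ φ (x i) - c) / √I -
      √n * (1 / √I) * (V - c)) =
      -(√n * (V - 1 / (n : ℝ) * ∑ i, Matrix.vecCons 1 (-w) ⬝ᵥ φ (x i))) := by
    rw [← Finset.sum_div, Finset.sum_sub_distrib, Finset.sum_const, Finset.card_univ,
      Fintype.card_fin, nsmul_eq_mul]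
    generalize ∑ i, Matrix.vecCons 1 (-w) ⬝ᵥ φ (x i) = A at *
    have e3 : 1 / (n : ℝ) = (√(n : ℝ))⁻¹ * (√(n : ℝ))⁻¹ := by rw [← mul_inv, hss, one_div]
    have e4 : (n : ℝ) * c = √n * √n * c := by rw [hss]
    rw [e3, e4]
    generalize √(n : ℝ) = s at *
    field_simp
    ring
  have e2 : √n * (Hh * (θh 0 - Hh⁻¹ * U - θs 0)) = √n * (Hh * (θh 0 - θs 0) - U) := by
    congr 1
    field_simp
    ring
  rw [e1, e2, sub_neg_eq_add, ← mul_add, abs_mul, abs_of_pos hs]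
  exact mul_le_mul_of_nonneg_left hexp hs.le

end Score

section Direction

variable {S : Type*} {k : ℕ} {φ : S → Fin (k + 1) → ℝ} {θ : Fin (k + 1) → ℝ}
  {K D ev : ℝ} {s₀ : ℕ}

lemma abs_vecCons_one_dotProduct_le {w : Fin k → ℝ} (hK : 0 ≤ K) (hφ : ∀ s j, |φ s j| ≤ K)
    (hw : ∀ j, |w j| ≤ D) (hD : 0 ≤ D) (hs : norm0 w ≤ s₀) (s : S) :
    |Matrix.vecCons 1 (-w) ⬝ᵥ φ s| ≤ (1 + s₀ * D) * K := by
  refine (abs_dotProduct_le _ _ (hφ s)).trans (mul_le_mul_of_nonneg_right ?_ hK)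
  have h1 : norm1 (-w) = norm1 w := by simp [norm1]
  have h2 : (norm0 w : ℝ) * D ≤ s₀ * D :=
    mul_le_mul_of_nonneg_right (by exact_mod_cast hs) hD
  rw [norm1_vecCons, abs_one, h1]
  linarith [norm1_le_norm0_mul hw]

/-- The partial information is the variance of the decorrelated statistic `(1, -w*)ᵀ φ`. -/
lemma partialInfo_covStat_eq_wcov [Fintype S] (hev : 0 < ev)
    (hH : ∀ u : Fin (k + 1) → ℝ, ev * ∑ j, u j ^ 2 ≤ u ⬝ᵥ covStat φ θ *ᵥ u) :
    partialInfo (covStat φ θ) = wcov (pmass φ θ)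
      (fun s => Matrix.vecCons 1 (-decorrWeight (covStat φ θ)) ⬝ᵥ φ s)
      fun s => Matrix.vecCons 1 (-decorrWeight (covStat φ θ)) ⬝ᵥ φ s := by
  rw [partialInfo_eq_dotProduct_mulVec (H := covStat φ θ) (wcovMatrix_isSymm _ _)
    (blockAB_eq_mulVec_decorrWeight hev hH), dotProduct_covStat_mulVec]

end Direction

/-! ### The expansion along the array -/

section Array

/-- Outside events of vanishing probability the plug-in information is within `O(λ)` of the
partial information, and the one-step correction linearises up to `O(λ²)`. -/
theorem exists_bad_event {Ω : ℕ → Type*} {S : ℕ → Type} [∀ n, MeasurableSpace (Ω n)]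
    [∀ n, MeasurableSpace (S n)] [∀ n, Fintype (S n)] [∀ n, MeasurableSingletonClass (S n)]
    {μ : ∀ n, Measure (Ω n)} [∀ n, IsProbabilityMeasure (μ n)] {k m : ℕ → ℕ}
    {X : ∀ n, Fin n → Ω n → S n} {Y : ∀ n, ℕ → Ω n → S n} {h q : ∀ n, S n → ℝ}
    {P : ∀ n, S n → S n → ℝ} {φ : ∀ n, S n → Fin (k n + 1) → ℝ} {θs : ∀ n, Fin (k n + 1) → ℝ}
    {Q₀ δ M₀ K B D ev A c' : ℝ} {s₀ : ℕ} {lam₁ lam₂ lam' : ℕ → ℝ}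
    (hX : ∀ n, IsIIDSample (μ n) (X n) (pmass (φ n) (θs n)))
    (hY : ∀ n, IsMarkovChain (μ n) (Y n) (q n) (P n)) (hP : ∀ n, IsStationary (h n) (P n))
    (hQ : ∀ n, ∑ x, q n x ^ 2 / h n x ≤ Q₀) (hδ0 : 0 < δ) (hδ1 : δ ≤ 1)
    (hκ : ∀ n, kappa (h n) (P n) ^ 2 ≤ 1 - δ) (hM₀ : ∀ n, maxRatio (φ n) (θs n) (h n) ≤ M₀)
    (hM0 : 0 ≤ M₀) (hK : 0 < K) (hφ : ∀ n s j, |φ n s j| ≤ K) (hB0 : 0 ≤ B)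
    (hB : ∀ n j, |θs n j| ≤ B) (hD0 : 0 ≤ D)
    (hD : ∀ n j, |decorrWeight (covStat (φ n) (θs n)) j| ≤ D) (hev : 0 < ev)
    (hH : ∀ n (u : Fin (k n + 1) → ℝ), ev * ∑ j, u j ^ 2 ≤ u ⬝ᵥ covStat (φ n) (θs n) *ᵥ u)
    (hs : ∀ n, norm0 (θs n) ≤ s₀) (hs' : ∀ n, norm0 (decorrWeight (covStat (φ n) (θs n))) ≤ s₀)
    (hlam₁ : ∀ n, 0 < lam₁ n) (hlam₂ : ∀ n, 0 < lam₂ n) (hlam' : ∀ n, 0 < lam' n)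
    (h12 : lam₁ =Θ[atTop] lam₂) (h1' : lam₁ =Θ[atTop] lam')
    (hlam_zero : Tendsto lam₁ atTop (𝓝 0)) (hA : 4 * √2 * K < A)
    (hlam_large : ∀ᶠ n : ℕ in atTop, A * √(Real.log (k n + 1) / n) ≤ lam₁ n)
    (hk : Tendsto (fun n => Real.log (k n + 1)) atTop atTop) (hm : ∀ᶠ n in atTop, 0 < m n)
    (hc' : 0 < c') (hmlam : ∀ᶠ n : ℕ in atTop, c' * Real.log (k n + 1) ^ 2 ≤ m n * lam₁ n ^ 2)
    {θh : ∀ n, (Fin n → S n) → (Fin (m n) → S n) → Fin (k n + 1) → ℝ}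
    (hθh : ∀ n x y, IsElasticNet (mcmcLoss (φ n) (h n) x y) (lam₁ n) (lam₂ n) (θh n x y))
    {wh : ∀ n, (Fin n → S n) → (Fin (m n) → S n) → Fin (k n) → ℝ}
    (hwh : ∀ n x y, IsDecorrLasso (hess (mcmcLoss (φ n) (h n) x y) (θh n x y)) (lam' n)
      (wh n x y)) :
    ∃ (C : ℝ) (bad : ∀ n, Set (Ω n)), Tendsto (fun n => (μ n).real (bad n)) atTop (𝓝 0) ∧
      ∀ᶠ n in atTop, ∀ ω ∉ bad n, ∀ x y, x = (fun i => X n i ω) →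
        y = (fun i : Fin (m n) => Y n i ω) →
        |plugInInfo (mcmcLoss (φ n) (h n) x y) (θh n x y) (wh n x y) -
          partialInfo (covStat (φ n) (θs n))| ≤ C * lam₁ n ∧
        |plugInInfo (mcmcLoss (φ n) (h n) x y) (θh n x y) (wh n x y) *
          (θh n x y 0 - θs n 0) -
          decorrScore (mcmcLoss (φ n) (h n) x y) (wh n x y) (θh n x y 0)
            (Matrix.vecTail (θh n x y)) +
          decorrScore (mcmcLoss (φ n) (h n) x y) (decorrWeight (covStat (φ n) (θs n))) (θs n 0)
            (Matrix.vecTail (θs n))| ≤ C * lam₁ n ^ 2 := by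
  obtain ⟨c₁, hc₁, hc₁'⟩ := exists_le_mul_of_isBigO h12.2 (fun n => (hlam₂ n).le)
    fun n => (hlam₁ n).le
  obtain ⟨c₂, hc₂, hc₂'⟩ := exists_le_mul_of_isBigO h1'.2 (fun n => (hlam' n).le)
    fun n => (hlam₁ n).le
  obtain ⟨c₃, hc₃, hc₃'⟩ := exists_le_mul_of_isBigO h1'.1 (fun n => (hlam₁ n).le)
    fun n => (hlam' n).le
  set c := c₁ + c₂ + c₃ with hc
  have hc0 : 0 < c := by positivity
  have hcc₁ : c₁ ≤ c := by linarith
  have hcc₂ : c₂ ≤ c := by linarith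
  have hcc₃ : c₃ ≤ c := by linarith
  clear_value c
  obtain ⟨C, c₀, hC, hc₀, hmain⟩ := exists_oneStep_expansion s₀ hK hB0 hD0 hev hc0.le
  set N : ℝ := 1 + s₀ * D with hN
  have hN0 : 0 < N := by positivity
  -- the admissible error of the Hessian, and the Monte Carlo accuracy that achieves it, as
  -- fractions of the tuning parameter
  obtain ⟨ε', hε', hε1, hεN⟩ : ∃ ε', 0 < ε' ∧ ε' ≤ 1 ∧ N * ε' ≤ 1 / (2 * c) :=
    ⟨min 1 (1 / (2 * c) / N), by positivity, min_le_left _ _, by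
      rw [mul_comm, ← le_div_iff₀ hN0]; exact min_le_right _ _⟩
  obtain ⟨ε, hε, hε8, hεK⟩ : ∃ ε, 0 < ε ∧ ε ≤ 1 / 8 ∧ (1 + 2 * K) * (2 * ε) ≤ ε' :=
    ⟨min (1 / 8) (ε' / (2 * (1 + 2 * K))), by positivity, min_le_left _ _, by
      have h1 := min_le_right (1 / 8) (ε' / (2 * (1 + 2 * K)))
      rw [le_div_iff₀ (by positivity)] at h1
      linarith⟩
  set L := K + K * K with hL
  set M := 1 + M₀ + 2 * M₀ * L with hM
  have hM1 : 0 < M := by positivity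
  set bad : ∀ n, Set (Ω n) := fun n => {ω | ¬ ((∀ j, |wmean (chainWeight (φ n) (h n)
      (fun i : Fin (m n) => Y n i ω) (θs n)) (fun i : Fin (m n) => φ n (Y n i ω) j) -
        sampleMean (φ n) (fun i => X n i ω) j| ≤ lam₁ n / 2) ∧
      ∀ i j, |wcovMatrix (chainWeight (φ n) (h n) (fun i : Fin (m n) => Y n i ω) (θs n))
        (fun i : Fin (m n) => φ n (Y n i ω)) i j - covStat (φ n) (θs n) i j| ≤ ε' * lam₁ n)}
    with hbad
  have hlim := tendsto_union_bound (m := m) (B := 4 * √Q₀ * Real.exp 1) hk hK hA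
    (by positivity : 0 < δ / (48 * M ^ 2)) hε (by positivity) hlam_large hc' hmlam
  refine ⟨C, bad, ?_, ?_⟩
  · refine squeeze_zero' (Eventually.of_forall fun _ => measureReal_nonneg) ?_ hlim
    filter_upwards [hm, eventually_gt_atTop 0, hlam_zero.eventually (gt_mem_nhds one_pos)] with
      n hmn hn hl
    have hl0 := hlam₁ n
    have t1 : ε * lam₁ n ≤ 1 / 8 * lam₁ n := mul_le_mul_of_nonneg_right hε8 hl0.le
    have t2 := mul_le_mul_of_nonneg_right hεK hl0.le
    have := measureReal_gradient_hessian_le (L := L) (M := M) (t := ε * lam₁ n) (lam := lam₁ n)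
      (ρ := ε' * lam₁ n) (hX n) (hY n) (hP n) (hQ n) hδ0 hδ1 (hκ n) (hM₀ n) hK (hφ n)
      (le_add_of_nonneg_right (by positivity)) (le_add_of_nonneg_left hK.le) le_rfl hn hmn
      (by positivity) (by linarith) hl0.le (by linarith) (by linarith)
    rwa [Fintype.card_fin, Nat.cast_add_one] at this
  · filter_upwards [hm, hc₁', hc₂', hc₃', hlam_zero.eventually (gt_mem_nhds hc₀)] with
      n hmn k1 k2 k3 hl ω hω x y hx hy
    subst hx hy
    rw [hbad, Set.mem_ofPred_eq, not_not] at hω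
    have hl0 := hlam₁ n
    have hl0' := hlam' n
    have k3' : lam₁ n ≤ c * lam' n := k3.trans (mul_le_mul_of_nonneg_right hcc₃ hl0'.le)
    refine hmain (ρ := ε' * lam₁ n) (hP n).pos hmn (hφ n) (hB n) (hD n) (hs n) (hs' n) (hH n)
      (blockAB_eq_mulVec_decorrWeight hev (hH n)) hl0 (hlam₂ n) hl0'
      (k1.trans (mul_le_mul_of_nonneg_right hcc₁ hl0.le))
      (k2.trans (mul_le_mul_of_nonneg_right hcc₂ hl0.le))
      k3' hl.le (by positivity) (mul_le_of_le_one_left hl0.le hε1) ?_ hω.1 hω.2 (hθh n _ _) (hwh n _ _)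
    calc N * (ε' * lam₁ n) = N * ε' * lam₁ n := by ring
      _ ≤ 1 / (2 * c) * (c * lam' n) := by gcongr
      _ = lam' n / 2 := by field_simp

end Array

end MRF

/-! ### Asymptotic normality of the decorrelated one-step estimator -/

/-- Triangular array indexed by the sample size `n`, with `m n` Monte Carlo draws and
`k n + 1` parameters, of which the coordinate `0` is the parameter of interest. -/
theorem mainTheorem1
    -- dimensions: vertices, states per vertex, Monte Carlo size, number of nuisance parameters
    (d r m k : ℕ → ℕ)
    -- the model, its true parameter, and the Monte Carlo kernel
    (φ : ∀ n, (Fin (d n) → Fin (r n)) → Fin (k n + 1) → ℝ)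
    (θs : ∀ n, Fin (k n + 1) → ℝ)
    (h q : ∀ n, (Fin (d n) → Fin (r n)) → ℝ)
    (Pk : ∀ n, (Fin (d n) → Fin (r n)) → (Fin (d n) → Fin (r n)) → ℝ)
    -- the data and the simulated chain
    {Ω : ℕ → Type*} [∀ n, MeasurableSpace (Ω n)]
    (μ : ∀ n, Measure (Ω n)) [∀ n, IsProbabilityMeasure (μ n)]
    (X : ∀ n, Fin n → Ω n → (Fin (d n) → Fin (r n)))
    (Y : ∀ n, ℕ → Ω n → (Fin (d n) → Fin (r n)))
    (hX : ∀ n, MRF.IsIIDSample (μ n) (X n) (MRF.pmass (φ n) (θs n)))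
    (hPk : ∀ n, MRF.IsStationary (h n) (Pk n))
    (hY : ∀ n, MRF.IsMarkovChain (μ n) (Y n) (q n) (Pk n))
    -- the quantities that describe the chain are bounded along the array
    (κ₀ M₀ Q₀ : ℝ) (hκ₀ : κ₀ < 1)
    (hκ : ∀ n, MRF.kappa (h n) (Pk n) ≤ κ₀)
    (hM : ∀ n, MRF.maxRatio (φ n) (θs n) (h n) ≤ M₀)
    (hQ : ∀ n, ∑ y, q n y ^ 2 / h n y ≤ Q₀)
    -- boundedness of the statistic, of the parameter and of the decorrelation direction
    (K B D : ℝ)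
    (hK : ∀ n y j, |φ n y j| ≤ K)
    (hB : ∀ n j, |θs n j| ≤ B)
    (hD : ∀ n j, |MRF.decorrWeight (MRF.covStat (φ n) (θs n)) j| ≤ D)
    -- compatibility condition
    (Cmin : ℝ) (hCmin : 0 < Cmin)
    (hcompat : ∀ n, (Cmin : EReal) ≤
      ⨅ T : Finset (Fin (k n + 1)), ⨅ ζ ∈ Set.Ioi (1 : ℝ),
        MRF.compatFactor ζ T (MRF.covStat (φ n) (θs n)))
    -- eigenvalue condition
    (ev₁ ev₂ : ℝ) (hev₁ : 0 < ev₁)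
    (hev : ∀ n, spectrum ℝ (MRF.covStat (φ n) (θs n)) ⊆ Set.Icc ev₁ ev₂)
    -- sparsity
    (s₀ : ℕ)
    (hs : ∀ n, MRF.norm0 (θs n) ≤ s₀)
    (hs' : ∀ n, MRF.norm0 (MRF.decorrWeight (MRF.covStat (φ n) (θs n))) ≤ s₀)
    -- tuning parameters
    (lam₁ lam₂ lam' : ℕ → ℝ)
    (hlam₁ : ∀ n, 0 < lam₁ n) (hlam₂ : ∀ n, 0 < lam₂ n) (hlam' : ∀ n, 0 < lam' n)
    (hrate : lam₁ =Θ[atTop] fun n =>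
      √(Real.log (k n + 1) / n) + √(Real.log (k n + 1) / m n) + Real.log (k n + 1) / m n)
    (h12 : lam₁ =Θ[atTop] lam₂) (h1' : lam₁ =Θ[atTop] lam')
    (hlam_zero : Tendsto lam₁ atTop (𝓝 0))
    (A : ℝ) (hA : 4 * √2 * K < A)
    (hlam_large : ∀ᶠ n : ℕ in atTop, A * √(Real.log (k n + 1) / n) ≤ lam₁ n)
    -- asymptotic regime
    (hk : Tendsto k atTop atTop)
    (hreg : Tendsto (fun n : ℕ =>
      Real.log (k n + 1) / √n + Real.log (k n + 1) / √(m n)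
        + Real.log (k n + 1) ^ (3 / 2 : ℝ) / m n) atTop (𝓝 0))
    (hmn : (fun n : ℕ => Real.log (k n + 1)) =O[atTop] fun n : ℕ => (m n : ℝ) / n)
    -- the estimators are functions of the data that solve the two penalised problems
    (θh : ∀ n, (Fin n → (Fin (d n) → Fin (r n))) → (Fin (m n) → (Fin (d n) → Fin (r n))) →
      Fin (k n + 1) → ℝ)
    (hθh : ∀ n x y,
      MRF.IsElasticNet (MRF.mcmcLoss (φ n) (h n) x y) (lam₁ n) (lam₂ n) (θh n x y))
    (wh : ∀ n, (Fin n → (Fin (d n) → Fin (r n))) → (Fin (m n) → (Fin (d n) → Fin (r n))) →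
      Fin (k n) → ℝ)
    (hwh : ∀ n x y,
      MRF.IsDecorrLasso (MRF.hess (MRF.mcmcLoss (φ n) (h n) x y) (θh n x y)) (lam' n) (wh n x y))
    -- the one-step estimator, the estimated and the true partial information
    (αt Hh : ∀ n, Ω n → ℝ) (Hs : ℕ → ℝ)
    (hαt : ∀ n ω, αt n ω =
      let x := fun i => X n i ω
      let y := fun i : Fin (m n) => Y n i ω
      MRF.oneStep (MRF.mcmcLoss (φ n) (h n) x y) (θh n x y) (wh n x y))
    (hHh : ∀ n ω, Hh n ω =
      let x := fun i => X n i ω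
      let y := fun i : Fin (m n) => Y n i ω
      MRF.plugInInfo (MRF.mcmcLoss (φ n) (h n) x y) (θh n x y) (wh n x y))
    (hHs : ∀ n, Hs n = MRF.partialInfo (MRF.covStat (φ n) (θs n))) :
    -- the law of `√n (α̃ - α*)` and `N(0, 1 / H*)` merge weakly
    (∀ f : BoundedContinuousFunction ℝ ℝ, Tendsto (fun n : ℕ =>
      (∫ ω, f (√n * (αt n ω - θs n 0)) ∂(μ n))
        - ∫ z, f z ∂(gaussianReal 0 (1 / Hs n).toNNReal)) atTop (𝓝 0)) ∧
    -- equivalently, after standardisation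
    TendstoInDistribution (fun (n : ℕ) ω => √(n * Hs n) * (αt n ω - θs n 0)) atTop
      (id : ℝ → ℝ) μ (gaussianReal 0 1) ∧
    -- consistency of the estimated partial information
    (∀ ε > 0, Tendsto (fun n => (μ n).real {ω | ε ≤ |Hh n ω - Hs n|}) atTop (𝓝 0)) ∧
    -- studentised version
    TendstoInDistribution (fun (n : ℕ) ω => √(n * Hh n ω) * (αt n ω - θs n 0)) atTop
      (id : ℝ → ℝ) μ (gaussianReal 0 1) ∧
    -- asymptotic coverage of the confidence interval
    (∀ η ∈ Set.Ioo (0 : ℝ) 1, ∀ z : ℝ, cdf (gaussianReal 0 1) z = 1 - η / 2 →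
      Tendsto (fun n : ℕ => (μ n).real {ω | 0 < Hh n ω ∧
        θs n 0 ∈ Set.Icc (αt n ω - z / √(n * Hh n ω)) (αt n ω + z / √(n * Hh n ω))})
        atTop (𝓝 (1 - η))) := by
  -- bounds on the model
  have hne : ∀ n, Nonempty (Fin (d n) → Fin (r n)) := fun n => by
    by_contra hn
    rw [not_nonempty_iff] at hn
    simpa using (hPk n).sum_one
  have hp := fun n => MRF.isWeight_pmass (φ n) (θs n)
  have hquad := fun n => MRF.mul_sum_sq_le_of_spectrum
    (MRF.wcovMatrix_isSymm (MRF.pmass (φ n) (θs n)) (φ n)) (hev n)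
  have hHs1 : ∀ n, ev₁ ≤ Hs n := fun n => (hHs n).symm ▸
    MRF.le_partialInfo (MRF.wcovMatrix_isSymm _ _) hev₁ (hquad n)
  have hD' : ∀ n j, |MRF.decorrWeight (MRF.covStat (φ n) (θs n)) j| ≤ |D| :=
    fun n j => (hD n j).trans (le_abs_self D)
  obtain ⟨y₀⟩ := hne 0
  have hK0 : 0 ≤ K := (abs_nonneg _).trans (hK 0 y₀ 0)
  have hB0 : 0 ≤ B := (abs_nonneg _).trans (hB 0 0)
  have hM0 : 0 ≤ M₀ := (div_nonneg ((hp 0).nonneg y₀) ((hPk 0).pos y₀).le).trans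
    ((MRF.pmass_div_le_maxRatio (φ 0) (θs 0) (h 0) y₀).trans (hM 0))
  set N : ℝ := 1 + s₀ * |D| with hN
  have hN0 : 0 < N := by positivity
  set f : ∀ n, (Fin (d n) → Fin (r n)) → ℝ := fun n s =>
    Matrix.vecCons 1 (-MRF.decorrWeight (MRF.covStat (φ n) (θs n))) ⬝ᵥ φ n s with hf_def
  have hf : ∀ n s, |f n s| ≤ N * K := fun n s =>
    MRF.abs_vecCons_one_dotProduct_le hK0 (hK n) (hD' n) (abs_nonneg D) (hs' n) s
  have hHsf : ∀ n, Hs n = MRF.wcov (MRF.pmass (φ n) (θs n)) (f n) (f n) := fun n =>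
    (hHs n).trans (MRF.partialInfo_covStat_eq_wcov hev₁ (hquad n))
  have hHs2 : ∀ n, Hs n ≤ 4 * (N * K * (N * K)) := fun n =>
    (le_abs_self _).trans ((hHsf n).symm ▸ (hp n).abs_wcov_le (hf n) (hf n))
  have hHspos : ∀ n, 0 < Hs n := fun n => hev₁.trans_le (hHs1 n)
  have hKpos : 0 < K := hK0.lt_of_ne fun h0 => by
    have := (hHspos 0).trans_le (hHs2 0)
    simp [← h0] at this
  -- the mixing rate of the chain
  have hκ0 : 0 ≤ κ₀ := (hPk 0).kappa_nonneg.trans (hκ 0)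
  obtain ⟨δ, hδ0, hδ1, hδ⟩ : ∃ δ, 0 < δ ∧ δ ≤ 1 ∧
      ∀ n, MRF.kappa (h n) (Pk n) ^ 2 ≤ 1 - δ := by
    refine ⟨1 - κ₀ ^ 2, by nlinarith, by nlinarith, fun n => ?_⟩
    have := pow_le_pow_left₀ (hPk n).kappa_nonneg (hκ n) 2
    linarith
  -- the asymptotic regime
  have hℓ0 : ∀ n, 0 ≤ Real.log ((k n : ℝ) + 1) := fun n =>
    Real.log_nonneg (by linarith [(k n).cast_nonneg (α := ℝ)])
  have hℓ : Tendsto (fun n => Real.log ((k n : ℝ) + 1)) atTop atTop :=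
    Real.tendsto_log_atTop.comp
      (tendsto_atTop_add_const_right _ 1 (tendsto_natCast_atTop_atTop.comp hk))
  obtain ⟨c, hc, hcm⟩ := MRF.exists_mul_le_of_isBigO hmn hℓ0
  have hmpos : ∀ᶠ n in atTop, 0 < m n := by
    filter_upwards [hcm, eventually_gt_atTop 0, hℓ.eventually_gt_atTop 0] with n h1 hn hl
    have hn' : (0 : ℝ) < n := by exact_mod_cast hn
    have : (0 : ℝ) < m n := lt_of_lt_of_le (by positivity) h1
    exact_mod_cast this
  have hmn' : Tendsto (fun n : ℕ => (m n : ℝ) / n) atTop atTop := by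
    refine tendsto_atTop_mono' _ ?_ (hℓ.const_mul_atTop hc)
    filter_upwards [hcm, eventually_gt_atTop 0] with n h1 hn
    have hn' : (0 : ℝ) < n := by exact_mod_cast hn
    rw [le_div_iff₀ hn']
    linarith
  have hreg' : Tendsto (fun n : ℕ => Real.log ((k n : ℝ) + 1) / √n) atTop (𝓝 0) := by
    refine squeeze_zero (fun n => div_nonneg (hℓ0 n) (Real.sqrt_nonneg _)) (fun n => ?_) hreg
    have h1 := div_nonneg (hℓ0 n) (Real.sqrt_nonneg (m n))
    have h2 := div_nonneg (Real.rpow_nonneg (hℓ0 n) (3 / 2)) (Nat.cast_nonneg (α := ℝ) (m n))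
    linarith
  obtain ⟨c', hc', hmlam⟩ := MRF.exists_mul_sq_le
    (r := fun n => √(Real.log (k n + 1) / m n) + Real.log (k n + 1) / m n) hℓ0
    (fun n => add_nonneg (Real.sqrt_nonneg _) (div_nonneg (hℓ0 n) (Nat.cast_nonneg _)))
    (fun n => (hlam₁ n).le) (by simpa only [add_assoc] using hrate.2) hc hcm
  have hnlam := MRF.tendsto_sqrt_mul_sq hℓ hℓ0 (fun n => (hlam₁ n).le) hrate.1 hc hcm hreg'
  -- the expansion and its leading terms
  obtain ⟨C, bad, hbad, hexp⟩ := MRF.exists_bad_event hX hY hPk hQ hδ0 hδ1 hδ hM hM0 hKpos hK hB0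
    hB (abs_nonneg D) hD' hev₁ hquad hs hs' hlam₁ hlam₂ hlam' h12 h1' hlam_zero hA hlam_large hℓ
    hmpos hc' hmlam hθh hwh
  set g : ∀ n, (Fin (d n) → Fin (r n)) → ℝ := fun n s =>
    (f n s - MRF.wmean (MRF.pmass (φ n) (θs n)) (f n)) / √(Hs n) with hg_def
  have hg : ∀ n s, |g n s| ≤ 2 * (N * K) / √ev₁ := fun n s => by
    rw [hg_def, abs_div, abs_of_pos (Real.sqrt_pos.2 (hHspos n))]
    exact div_le_div₀ (by positivity) ((hp n).abs_sub_wmean_le (hf n) s) (Real.sqrt_pos.2 hev₁)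
      (Real.sqrt_le_sqrt (hHs1 n))
  have hg0 : ∀ n, MRF.wmean (MRF.pmass (φ n) (θs n)) (g n) = 0 := fun n => by
    simp only [hg_def, div_eq_mul_inv, MRF.wmean_mul_const, (hp n).wmean_sub_const, sub_self,
      zero_mul]
  have hg1 : ∀ n, MRF.wmean (MRF.pmass (φ n) (θs n)) (fun s => g n s ^ 2) = 1 := fun n => by
    simp only [hg_def, div_pow, Real.sq_sqrt (hHspos n).le]
    simp only [div_eq_mul_inv, MRF.wmean_mul_const, sq]
    rw [← MRF.wcov, ← hHsf, mul_inv_cancel₀ (hHspos n).ne']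
  have hrs : ∀ n, |1 / √(Hs n)| ≤ 1 / √ev₁ := fun n => by
    rw [abs_of_nonneg (by positivity)]
    exact one_div_le_one_div_of_le (Real.sqrt_pos.2 hev₁) (Real.sqrt_le_sqrt (hHs1 n))
  have he := MRF.tendstoZeroInProb_chain_error (M := 1 + M₀ + 2 * M₀ * (N * K)) hY hPk hQ hδ0 hδ1
    hδ hM hf (by positivity) le_rfl hmn' (by positivity : 0 < 1 / √ev₁) hrs
  have hsmall : ∀ᶠ n in atTop, C * lam₁ n < ev₁ := by
    have := hlam_zero.const_mul C
    rw [mul_zero] at this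
    exact this.eventually (gt_mem_nhds hev₁)
  have hαtm : ∀ n, Measurable (αt n) := fun n => by
    rw [funext (hαt n)]
    exact MRF.measurable_statistic (hX n).measurable (hY n).measurable fun x y =>
      MRF.oneStep (MRF.mcmcLoss (φ n) (h n) x y) (θh n x y) (wh n x y)
  have hHhm : ∀ n, Measurable (Hh n) := fun n => by
    rw [funext (hHh n)]
    exact MRF.measurable_statistic (hX n).measurable (hY n).measurable fun x y =>
      MRF.plugInInfo (MRF.mcmcLoss (φ n) (h n) x y) (θh n x y) (wh n x y)
  have key := MRF.limits_of_expansion (x := fun n ω => αt n ω - θs n 0) (Hh := Hh) (Hs := Hs)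
    (b := 4 * (N * K * (N * K))) (C := C) (bad := bad)
    (fun n => (hαtm n).sub_const _) hHhm
    (fun n => (Finset.measurable_fun_sum _ fun i _ =>
      (measurable_of_finite (g n)).comp ((hX n).measurable i)).const_mul _)
    hev₁ (fun n => ⟨hHs1 n, hHs2 n⟩) hlam_zero hnlam
    (MRF.tendstoInDistribution_sum_of_isIIDSample hX hp hg hg0 hg1)
    (fun ε hε => MRF.tight_sum_of_isIIDSample hX (by positivity) hg hg0 hε) he hbad (by
      filter_upwards [hexp, hsmall, hmpos, eventually_gt_atTop 0] with n h1 h2 hm0 hn0 ω hω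
      obtain ⟨h3, h4⟩ := h1 ω hω _ _ rfl rfl
      rw [← hHs n] at h3
      have h5 : 0 < Hh n ω := by
        have h3' : |Hh n ω - Hs n| ≤ C * lam₁ n := by rw [hHh n ω]; exact h3
        linarith [(abs_le.1 h3').1, hHs1 n]
      rw [hHh n ω] at h5
      have h6 := MRF.abs_scaled_oneStep_sub_le (hPk n).pos hm0 hn0 (hHspos n)
        (c := MRF.wmean (MRF.pmass (φ n) (θs n)) (f n)) h5.ne' h4
      rw [hHh n ω, hαt n ω]
      refine ⟨h3, h6.trans_eq (by ring)⟩)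
  obtain ⟨k1, k2, k3, k4, k5⟩ := key
  refine ⟨k1, k2, k3, k4, fun η hη z hz => (k5 η hη z hz).congr' ?_⟩
  filter_upwards [eventually_gt_atTop 0] with n hn
  congr 1
  ext ω
  exact and_congr_right fun hpos => (MRF.mem_Icc_iff_abs_pivot_le hn hpos).symm
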